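/- **Setting.** Let $\mathcal A$ be the Hopf $*$-algebra of polynomial functions on a compact matrix quantum group $G$ (it is generated as an algebra by the matrix elements of one finite-dimensional unitary representation), with coproduct $\phi(a)=a^{(1)}\otimes a^{(2)}$, counit $\epsilon$, antipode $\kappa$ and adjoint action $\mathrm{ad}(a)=a^{(2)}\otimes\kappa(a^{(1)})a^{(3)}$. Let $\Gamma$ be a bicovariant first-order $*$-calculus over $G$, determined by a right ideal $\mathcal R\subseteq\ker\epsilon$ with $\mathrm{ad}(\mathcal R)\subseteq\mathcal R\otimes\mathcal A$ and $\kappa(\mathcal R)^*\subseteq\mathcal R$. Let $\Gamma_{inv}$ be its space of left-invariant elements and $\pi\colon\mathcal A\to\Gamma_{inv}$, $\pi(a)=\kappa(a^{(1)})\,da^{(2)}$, the canonical projection map, which is onto with kernel $\mathbb C1\oplus\mathcal R$. Put $\pi(a)\circ b=\pi(ab)-\epsilon(a)\pi(b)$ and $\varpi\pi=(\pi\otimes\mathrm{id})\mathrm{ad}$. Let $\Gamma^\wedge$ be the universal differential envelope of $\Gamma$, and let $\Gamma_{inv}^\wedge$ be its left-invariant part: the quotient of the tensor algebra of $\Gamma_{inv}$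 by the ideal generated by the elements $\pi(a^{(1)})\otimes\pi(a^{(2)})$, $a\in\mathcal R$, with the differential given by $d\pi(a)=-\pi(a^{(1)})\pi(a^{(2)})$ and the graded Leibniz rule, and with the right $\mathcal A$-module structure $\circ$ extended by $1\circ a=\epsilon(a)1$ and $(\vartheta\eta)\circ a=(\vartheta\circ a^{(1)})(\eta\circ a^{(2)})$. Let $P=(\mathcal B,i,F)$ be a quantum principal $G$-bundle over a quantum space $M$ with unital $*$-algebra $\mathcal V$: $\mathcal B$ is a unital $*$-algebra, $F\colon\mathcal B\to\mathcal B\otimes\mathcal A$ is a $*$-homomorphism which is a coaction, $i\colon\mathcal V\to\mathcal B$ is an injective $*$-homomorphism onto $\{b\in\mathcal B: F(b)=b\otimes1\}$, and for every $a\in\mathcal A$ the element $1\otimes a$ has the form $\sum_k (q_k\otimes 1)F(b_k)$ with $q_k,b_k\in\mathcal B$. Let $\Omega(P)$ be a differential calculus on $P$: a graded-differential $*$-algebra with $\Omega^0(P)=\mathcal B$, generated as a differential algebra by $\mathcal B$, such that $F$ extends to a homomorphism $\widehat F\colon\Omega(P)\to\Omega(P)\mathbin{\widehat\otimes}\Gamma^\wedge$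 of graded-differential algebras (graded tensor product). Let $F^\wedge=(\mathrm{id}\otimes p_*)\widehat F\colon\Omega(P)\to\Omega(P)\otimes\mathcal A$, where $p_*\colon\Gamma^\wedge\to\mathcal A$ is the projection onto degree $0$; let $\mathrm{hor}(P)=\widehat F^{-1}(\Omega(P)\otimes\mathcal A)$ be the ($F^\wedge$-invariant) algebra of horizontal forms, and let $\mathrm{vh}(P)=\mathrm{hor}(P)\otimes\Gamma_{inv}^\wedge$, with the linear map $d_{vh}$ given on homogeneous $\varphi$, with $F^\wedge(\varphi)=\sum_k\varphi_k\otimes c_k$, by $$d_{vh}(\varphi\otimes\vartheta)=(-1)^{\partial\varphi}\sum_k\varphi_k\otimes\pi(c_k)\vartheta+(-1)^{\partial\varphi}\varphi\otimes d\vartheta .$$ A *tensorial form* of degree $\partial\lambda=p$ is a linear map $\lambda\colon\Gamma_{inv}\to\Omega(P)$ with values in the horizontal forms of degree $p$ such that $F^\wedge\lambda=(\lambda\otimes\mathrm{id})\varpi$. For $\varphi\in\mathrm{hor}(P)$ homogeneous and $\vartheta_1,\dots,\vartheta_n\in\Gamma_{inv}$ with $\varpi(\vartheta_i)=\sum_l\vartheta_{il}\otimes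 c_{il}$, put $$S_\lambda(\varphi\otimes\vartheta_1\cdots\vartheta_n)=\sum_k\varphi_k\,\lambda\pi(c_k)\otimes\vartheta_1\cdots\vartheta_n,$$ $$T_\lambda(\varphi\otimes\vartheta_1\cdots\vartheta_n)=(-1)^{\partial\varphi}\sum_{i=1}^n\sum_l(-1)^{i-1}\varphi\,\lambda(\vartheta_{il})\otimes\bigl(\{\vartheta_1\cdots\vartheta_{i-1}\}\circ c_{il}\bigr)\{\vartheta_{i+1}\cdots\vartheta_n\}.$$ For an irreducible unitary representation $u=(u_{ij})$ of $G$ on $H_u=\mathbb C^n$, $u(e_i)=\sum_j e_j\otimes u_{ji}$, let $\Lambda_u=H_u\otimes\Gamma_{inv}^\wedge$ with $$d_u(e_i\otimes\eta)=e_i\otimes d\eta+\sum_j e_j\otimes\pi(u_{ji})\eta .$$ **Statement.** 1. For every bundle $P$ with calculus $\Omega(P)$ and every tensorial form $\lambda$, the formula for $T_\lambda$ gives a well-defined linear map $T_\lambda\colon\mathrm{vh}(P)\to\mathrm{vh}(P)$, and $S_\lambda$ is chain-homotopic to zero: $$S_\lambda=T_\lambda d_{vh}+(-1)^{\partial\lambda}d_{vh}T_\lambda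 .$$ 2. The $\Lambda_u$ are, up to a sign in the differential, subcomplexes of $\mathrm{vh}(P)$: if $u$ is an irreducible unitary representation and $f\colon H_u\to\mathrm{hor}(P)$ is a nonzero linear map, with values in the forms of one degree $m$, that intertwines $u$ and $F^\wedge$, then $f\otimes\mathrm{id}\colon\Lambda_u\to\mathrm{vh}(P)$ is injective and $d_{vh}(f\otimes\mathrm{id})=(-1)^m(f\otimes\mathrm{id})d_u$. 3. If $u$ is an irreducible unitary representation of $G$ with $\pi(u)\neq0$, that is, $\pi(u_{ij})\neq0$ for some $i,j$, then the complex $\Lambda_u$ is acyclic: $\ker d_u=\operatorname{im}d_u$. -/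

import Mathlib

open scoped TensorProduct

namespace QPB

noncomputable section

/-! ## Compact matrix quantum groups -/

/-- Hopf `*`-algebras: the coproduct is a `*`-homomorphism. -/
class HopfStarAlgebra (A : Type*) [Ring A] [HopfAlgebra ℂ A] [StarRing A] [StarModule ℂ A] :
    Prop where
  comul_star : ∀ a : A, Coalgebra.comul (R := ℂ) (star a) = star (Coalgebra.comul (R := ℂ) a)

/-- An `n`-dimensional unitary representation `u` of the quantum group, i.e. a unitary matrix over
`A` with `φ(u i j) = ∑ k, u i k ⊗ u k j` and `ε(u i j) = δ i j`. -/
structure UnitaryRep (A : Type*) [Ring A] [HopfAlgebra ℂ A] [StarRing A] (n : ℕ) where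
  mat : Matrix (Fin n) (Fin n) A
  comul_mat : ∀ i j, Coalgebra.comul (R := ℂ) (mat i j) = ∑ k, mat i k ⊗ₜ[ℂ] mat k j
  counit_mat : ∀ i j, Coalgebra.counit (R := ℂ) (mat i j) = if i = j then 1 else 0
  mem_unitary : mat ∈ unitary (Matrix (Fin n) (Fin n) A)

/-- `A` is the Hopf `*`-algebra of polynomial functions on a compact matrix quantum group: it is
generated as an algebra by the entries of one finite-dimensional unitary representation. -/
class CompactMatrixQuantumGroup (A : Type*) [Ring A] [HopfAlgebra ℂ A] [StarRing A]
    [StarModule ℂ A] : Prop extends HopfStarAlgebra A where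
  exists_fundamental : ∃ (n : ℕ) (u : UnitaryRep A n),
    Algebra.adjoin ℂ (Set.range fun p : Fin n × Fin n => u.mat p.1 p.2) = ⊤

namespace UnitaryRep

variable {A : Type*} [Ring A] [HopfAlgebra ℂ A] [StarRing A] {n : ℕ}

/-- The coaction `H_u → H_u ⊗ A` on `H_u = ℂⁿ`, `e i ↦ ∑ j, e j ⊗ u j i`. -/
def coaction (u : UnitaryRep A n) : (Fin n → ℂ) →ₗ[ℂ] (Fin n → ℂ) ⊗[ℂ] A :=
  (Pi.basisFun ℂ (Fin n)).constr ℂ fun i => ∑ j, (Pi.single j (1 : ℂ)) ⊗ₜ[ℂ] u.mat j i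

/-- `u` is irreducible: `H_u ≠ 0`, and the only subspaces `W` with `u(W) ⊆ W ⊗ A` are trivial. -/
def IsIrreducible (u : UnitaryRep A n) : Prop :=
  0 < n ∧ ∀ W : Submodule ℂ (Fin n → ℂ),
    (∀ x ∈ W, u.coaction x ∈ LinearMap.range (W.subtype.rTensor A)) → W = ⊥ ∨ W = ⊤

end UnitaryRep

/-! ## Bicovariant first-order `*`-calculi -/

section Adjoint

variable (A : Type*) [Ring A] [HopfAlgebra ℂ A]

/-- The adjoint action `ad(a) = a₂ ⊗ κ(a₁) a₃`. -/
def ad : A →ₗ[ℂ] A ⊗[ℂ] A :=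
  (LinearMap.mul' ℂ A ∘ₗ (HopfAlgebra.antipode ℂ (A := A)).rTensor A).lTensor A
    ∘ₗ (TensorProduct.leftComm ℂ A A A).toLinearMap
    ∘ₗ (Coalgebra.comul (R := ℂ) (A := A)).lTensor A ∘ₗ Coalgebra.comul

end Adjoint

section AdjointIdentities

variable {A : Type*} [Ring A] [HopfAlgebra ℂ A]

lemma ad_eq (b : A) : ad A b = TensorProduct.lift (LinearMap.mk₂ ℂ
    (fun p y : A => (1 ⊗ₜ[ℂ] HopfAlgebra.antipode ℂ p) * Coalgebra.comul (R := ℂ) y)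
    (by intros; simp [TensorProduct.tmul_add, add_mul]) (by intros; simp)
    (by intros; simp [mul_add]) (by intros; simp)) (Coalgebra.comul (R := ℂ) b) := by
  simp only [ad, LinearMap.comp_apply]
  generalize Coalgebra.comul (R := ℂ) b = t
  induction t with
  | zero => simp
  | add x y hx hy => simp only [map_add, hx, hy]
  | tmul p y =>
    simp only [LinearMap.lTensor_tmul, TensorProduct.lift.tmul, LinearMap.mk₂_apply]
    generalize Coalgebra.comul (R := ℂ) y = s
    induction s with
    | zero => simp
    | add x y hx hy => simp only [map_add, hx, hy, TensorProduct.tmul_add, mul_add]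
    | tmul q r => simp

/-- The map `x ⊗ y ↦ y₂ ⊗ x κ(y₁) y₃`. -/
def adTwist : A ⊗[ℂ] A →ₗ[ℂ] A ⊗[ℂ] A :=
  TensorProduct.lift (LinearMap.mk₂ ℂ
    (fun x y : A => (1 ⊗ₜ[ℂ] x) * ad A y)
    (by intros; simp [TensorProduct.tmul_add, add_mul]) (by intros; simp)
    (by intros; simp [mul_add]) (by intros; simp))

/-- `b₃ ⊗ b₁ κ(b₂) b₄ = b₁ ⊗ b₂`. -/
lemma adTwist_comul (b : A) : adTwist (Coalgebra.comul (R := ℂ) b)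
    = Coalgebra.comul (R := ℂ) b := by
  let K : A ⊗[ℂ] (A ⊗[ℂ] A) →ₗ[ℂ] A ⊗[ℂ] A :=
    TensorProduct.lift (LinearMap.mk₂ ℂ
      (fun (x : A) (t : A ⊗[ℂ] A) => (1 ⊗ₜ[ℂ] x) * TensorProduct.lift (LinearMap.mk₂ ℂ
        (fun p y : A => (1 ⊗ₜ[ℂ] HopfAlgebra.antipode ℂ p) * Coalgebra.comul (R := ℂ) y)
        (by intros; simp [TensorProduct.tmul_add, add_mul]) (by intros; simp)
        (by intros; simp [mul_add]) (by intros; simp)) t)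
      (by intros; simp [TensorProduct.tmul_add, add_mul]) (by intros; simp)
      (by intros; simp [mul_add]) (by intros; simp))
  have h1 : ∀ t : A ⊗[ℂ] A, adTwist t
      = K ((Coalgebra.comul (R := ℂ)).lTensor A t) := by
    intro t
    induction t with
    | zero => simp
    | add x y hx hy => simp only [map_add, hx, hy]
    | tmul x y => simp [K, adTwist, ad_eq]
  have h2 : ∀ t : A ⊗[ℂ] A, K (TensorProduct.assoc ℂ A A A
      ((Coalgebra.comul (R := ℂ)).rTensor A t)) =
      Coalgebra.comul (R := ℂ) (TensorProduct.lid ℂ A ((Coalgebra.counit (R := ℂ)).rTensor A t)) := by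
    intro t
    induction t with
    | zero => simp
    | add x y hx hy => simp only [map_add, hx, hy]
    | tmul x y =>
      have e : ∀ s : A ⊗[ℂ] A, K (TensorProduct.assoc ℂ A A A (s ⊗ₜ y)) =
          (1 ⊗ₜ LinearMap.mul' ℂ A ((HopfAlgebra.antipode ℂ (A := A)).lTensor A s))
            * Coalgebra.comul (R := ℂ) y := by
        intro s
        induction s with
        | zero => simp
        | add x y hx hy =>
          simp only [map_add, TensorProduct.add_tmul, hx, hy, TensorProduct.tmul_add, add_mul]
        | tmul p q => simp [K, ← mul_assoc]
      rw [LinearMap.rTensor_tmul, e, HopfAlgebra.mul_antipode_lTensor_comul_apply,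
        LinearMap.rTensor_tmul, TensorProduct.lid_tmul, map_smul, Algebra.algebraMap_eq_smul_one,
        TensorProduct.tmul_smul, smul_mul_assoc, ← Algebra.TensorProduct.one_def, one_mul]
  rw [h1, ← Coalgebra.coassoc_apply, h2, Coalgebra.rTensor_counit_comul, TensorProduct.lid_tmul,
    one_smul]

/-- The diagonal coaction `a ⊗ b ↦ (a₁ ⊗ b₁) ⊗ a₂ b₂`. -/
def codiag : A ⊗[ℂ] A →ₗ[ℂ] (A ⊗[ℂ] A) ⊗[ℂ] A :=
  (LinearMap.mul' ℂ A).lTensor (A ⊗[ℂ] A)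
    ∘ₗ (TensorProduct.tensorTensorTensorComm ℂ A A A A).toLinearMap
    ∘ₗ TensorProduct.map Coalgebra.comul Coalgebra.comul

end AdjointIdentities

/-- A bicovariant first-order `*`-calculus over the quantum group, given by the right ideal
`ℛ ⊆ ker ε` that determines it: `ad(ℛ) ⊆ ℛ ⊗ A` (bicovariance), `κ(ℛ)* ⊆ ℛ` (`*`-covariance). -/
structure BicovariantCalculus (A : Type*) [Ring A] [HopfAlgebra ℂ A] [StarRing A] where
  ideal : Submodule ℂ A
  ideal_mul_mem : ∀ r ∈ ideal, ∀ a : A, r * a ∈ ideal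
  counit_eq_zero : ∀ r ∈ ideal, Coalgebra.counit (R := ℂ) r = 0
  ad_mem : ∀ r ∈ ideal, ad A r ∈ LinearMap.range (ideal.subtype.rTensor A)
  star_antipode_mem : ∀ r ∈ ideal, star (HopfAlgebra.antipode ℂ r) ∈ ideal

section Calculus

variable {A : Type*} [Ring A] [HopfAlgebra ℂ A] [StarRing A] (Γ : BicovariantCalculus A)

namespace BicovariantCalculus

/-- The kernel `ℂ ⊕ ℛ` of `π`. -/
def kerPi : Submodule ℂ A := Submodule.span ℂ {1} ⊔ Γ.ideal

/-- The space `Γ_inv` of left-invariant one-forms, `A / (ℂ ⊕ ℛ) ≅ ker ε / ℛ`. -/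
abbrev Inv : Type _ := A ⧸ Γ.kerPi

/-- The canonical surjection `π : A → Γ_inv`, `π(a) = κ(a₁) d a₂`. -/
def pi : A →ₗ[ℂ] Γ.Inv := Γ.kerPi.mkQ

lemma pi_surjective : Function.Surjective Γ.pi := Submodule.mkQ_surjective _

lemma pi_one : Γ.pi 1 = 0 := by
  refine (Submodule.Quotient.mk_eq_zero _).2 ?_
  exact Submodule.mem_sup_left (Submodule.mem_span_singleton_self _)

lemma pi_eq_zero {r : A} (hr : r ∈ Γ.ideal) : Γ.pi r = 0 :=
  (Submodule.Quotient.mk_eq_zero _).2 (Submodule.mem_sup_right hr)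

lemma kerPi_le_ker {M : Type*} [AddCommGroup M] [Module ℂ M] (f : A →ₗ[ℂ] M) (h1 : f 1 = 0)
    (hR : ∀ r ∈ Γ.ideal, f r = 0) : Γ.kerPi ≤ LinearMap.ker f := by
  refine sup_le ?_ hR
  rw [Submodule.span_le]
  rintro x rfl
  exact h1

/-- The linear map on `Γ_inv` induced by a linear map on `A` that vanishes on `1` and on `ℛ`. -/
def invLift {M : Type*} [AddCommGroup M] [Module ℂ M] (f : A →ₗ[ℂ] M) (h1 : f 1 = 0)
    (hR : ∀ r ∈ Γ.ideal, f r = 0) : Γ.Inv →ₗ[ℂ] M :=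
  Γ.kerPi.liftQ f (Γ.kerPi_le_ker f h1 hR)

@[simp] lemma invLift_pi {M : Type*} [AddCommGroup M] [Module ℂ M] (f : A →ₗ[ℂ] M) (h1 : f 1 = 0)
    (hR : ∀ r ∈ Γ.ideal, f r = 0) (a : A) : Γ.invLift f h1 hR (Γ.pi a) = f a :=
  Submodule.liftQ_apply _ _ _

/-- The right `A`-module structure on `Γ_inv`, `π(a) ∘ b = π(ab - ε(a) b)`. -/
def circ : Γ.Inv →ₗ[ℂ] A →ₗ[ℂ] Γ.Inv :=
  Γ.invLift ((LinearMap.mul ℂ A).compr₂ Γ.pi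
      - (LinearMap.toSpanSingleton ℂ (A →ₗ[ℂ] Γ.Inv) Γ.pi) ∘ₗ Coalgebra.counit)
    (by ext b; simp)
    (fun r hr => by
      ext b
      simp [Γ.counit_eq_zero r hr, Γ.pi_eq_zero (Γ.ideal_mul_mem r hr b)])

lemma circ_pi (a b : A) :
    Γ.circ (Γ.pi a) b = Γ.pi (a * b - Coalgebra.counit (R := ℂ) a • b) := by
  simp [circ]

/-- The adjoint action `ϖ : Γ_inv → Γ_inv ⊗ A`, `ϖ π = (π ⊗ id) ad`. -/
def varpi : Γ.Inv →ₗ[ℂ] Γ.Inv ⊗[ℂ] A :=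
  Γ.invLift (Γ.pi.rTensor A ∘ₗ ad A)
    (by simp [ad, Bialgebra.comul_one, Algebra.TensorProduct.one_def, Γ.pi_one])
    (fun r hr => by
      obtain ⟨t, ht⟩ := Γ.ad_mem r hr
      rw [LinearMap.comp_apply, ← ht, ← LinearMap.rTensor_comp_apply]
      have : Γ.pi ∘ₗ Γ.ideal.subtype = 0 := by
        ext x; exact Γ.pi_eq_zero x.2
      rw [this, LinearMap.rTensor_zero, LinearMap.zero_apply])

lemma varpi_pi (a : A) : Γ.varpi (Γ.pi a) = Γ.pi.rTensor A (ad A a) := by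
  simp [varpi]

/-! ### The algebra `Γ_inv^∧` -/

/-- The quadratic element `π(a₁) ⊗ π(a₂)` of the tensor algebra of `Γ_inv`. -/
def quad : A →ₗ[ℂ] TensorAlgebra ℂ Γ.Inv :=
  LinearMap.mul' ℂ _ ∘ₗ TensorProduct.map (TensorAlgebra.ι ℂ ∘ₗ Γ.pi) (TensorAlgebra.ι ℂ ∘ₗ Γ.pi)
    ∘ₗ Coalgebra.comul

/-- The defining relations of `Γ_inv^∧`. -/
inductive InvRel : TensorAlgebra ℂ Γ.Inv → TensorAlgebra ℂ Γ.Inv → Prop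
  | quad (r : A) (hr : r ∈ Γ.ideal) : InvRel (Γ.quad r) 0

/-- The left-invariant part `Γ_inv^∧` of the universal envelope: the tensor algebra of `Γ_inv`
modulo the ideal generated by `π(a₁) ⊗ π(a₂)`, `a ∈ ℛ`. -/
def InvExt : Type _ := RingQuot Γ.InvRel

instance : Ring Γ.InvExt := inferInstanceAs (Ring (RingQuot Γ.InvRel))

instance : Algebra ℂ Γ.InvExt := inferInstanceAs (Algebra ℂ (RingQuot Γ.InvRel))

/-- The factorization map `Γ_inv^⊗ → Γ_inv^∧`. -/
def invMk : TensorAlgebra ℂ Γ.Inv →ₐ[ℂ] Γ.InvExt := RingQuot.mkAlgHom ℂ Γ.InvRel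

lemma invMk_quad {r : A} (hr : r ∈ Γ.ideal) : Γ.invMk (Γ.quad r) = 0 :=
  (RingQuot.mkAlgHom_rel ℂ (InvRel.quad r hr)).trans (map_zero _)

lemma invMk_surjective : Function.Surjective Γ.invMk :=
  RingQuot.mkAlgHom_surjective ℂ Γ.InvRel

/-- The inclusion of `Γ_inv` into `Γ_inv^∧`. -/
def inc : Γ.Inv →ₗ[ℂ] Γ.InvExt :=
  Γ.invMk.toLinearMap ∘ₗ TensorAlgebra.ι ℂ

/-- The product `ϑ₁ ⋯ ϑₙ` in `Γ_inv^∧`. -/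
def word (l : List Γ.Inv) : Γ.InvExt := (l.map Γ.inc).prod

/-- `x ⊗ y ↦ π(x) π(y)`. -/
def quadExt : A ⊗[ℂ] A →ₗ[ℂ] Γ.InvExt :=
  LinearMap.mul' ℂ Γ.InvExt ∘ₗ TensorProduct.map (Γ.inc ∘ₗ Γ.pi) (Γ.inc ∘ₗ Γ.pi)

lemma mk_quad (a : A) : Γ.invMk (Γ.quad a)
    = LinearMap.mul' ℂ _ (TensorProduct.map (Γ.inc ∘ₗ Γ.pi) (Γ.inc ∘ₗ Γ.pi)
        (Coalgebra.comul (R := ℂ) a)) := by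
  simp only [quad, LinearMap.comp_apply]
  generalize Coalgebra.comul (R := ℂ) a = t
  induction t with
  | zero => simp
  | add x y hx hy => simp only [map_add, hx, hy]
  | tmul x y => simp [inc]

lemma inc_quad {r : A} (hr : r ∈ Γ.ideal) :
    LinearMap.mul' ℂ Γ.InvExt (TensorProduct.map (Γ.inc ∘ₗ Γ.pi) (Γ.inc ∘ₗ Γ.pi)
        (Coalgebra.comul (R := ℂ) r)) = 0 := by
  rw [← mk_quad, Γ.invMk_quad hr]

/-- Algebra homomorphisms out of `Γ_inv^∧`. -/
def extLift {B : Type*} [Semiring B] [Algebra ℂ B] (f : Γ.Inv →ₗ[ℂ] B)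
    (hf : ∀ r ∈ Γ.ideal, LinearMap.mul' ℂ B (TensorProduct.map (f ∘ₗ Γ.pi) (f ∘ₗ Γ.pi)
        (Coalgebra.comul (R := ℂ) r)) = 0) : Γ.InvExt →ₐ[ℂ] B :=
  RingQuot.liftAlgHom ℂ ⟨TensorAlgebra.lift ℂ f, by
    rintro _ _ ⟨r, hr⟩
    rw [map_zero, ← hf r hr]
    simp only [quad, LinearMap.comp_apply]
    generalize Coalgebra.comul (R := ℂ) r = t
    induction t with
    | zero => simp
    | add x y hx hy => simp only [map_add, hx, hy]
    | tmul x y => simp⟩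

@[simp] lemma extLift_inc {B : Type*} [Semiring B] [Algebra ℂ B] (f : Γ.Inv →ₗ[ℂ] B)
    (hf : ∀ r ∈ Γ.ideal, LinearMap.mul' ℂ B (TensorProduct.map (f ∘ₗ Γ.pi) (f ∘ₗ Γ.pi)
        (Coalgebra.comul (R := ℂ) r)) = 0) (x : Γ.Inv) : Γ.extLift f hf (Γ.inc x) = f x := by
  refine (RingQuot.liftAlgHom_mkAlgHom_apply ℂ _ _ _).trans ?_
  simp

/-- The map `Γ_inv → Γ_inv^∧`, `d π(a) = - π(a₁) π(a₂)`. -/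
def dGen : Γ.Inv →ₗ[ℂ] Γ.InvExt :=
  Γ.invLift (-(LinearMap.mul' ℂ _ ∘ₗ TensorProduct.map (Γ.inc ∘ₗ Γ.pi) (Γ.inc ∘ₗ Γ.pi)
      ∘ₗ Coalgebra.comul))
    (by simp [Bialgebra.comul_one, Algebra.TensorProduct.one_def, Γ.pi_one])
    (fun r hr => by
      rw [LinearMap.neg_apply, LinearMap.comp_apply, LinearMap.comp_apply, Γ.inc_quad hr, neg_zero])

lemma dGen_pi (a : A) : Γ.dGen (Γ.pi a) = - LinearMap.mul' ℂ _
    (TensorProduct.map (Γ.inc ∘ₗ Γ.pi) (Γ.inc ∘ₗ Γ.pi) (Coalgebra.comul (R := ℂ) a)) := by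
  simp [dGen]

/-- Auxiliary homomorphism `x ↦ [[(-1)^∂x x, d x], [0, x]]`, which encodes the graded Leibniz
rule. -/
def dMatrixGen : Γ.Inv →ₗ[ℂ] Matrix (Fin 2) (Fin 2) Γ.InvExt where
  toFun x := !![-Γ.inc x, Γ.dGen x; 0, Γ.inc x]
  map_add' x y := by
    ext i j; fin_cases i <;> fin_cases j <;> simp [add_comm]
  map_smul' c x := by
    ext i j; fin_cases i <;> fin_cases j <;> simp

lemma dMatrix_aux (a : A) :
    LinearMap.mul' ℂ _ (TensorProduct.map (Γ.dMatrixGen ∘ₗ Γ.pi) (Γ.dMatrixGen ∘ₗ Γ.pi)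
        (Coalgebra.comul (R := ℂ) a)) =
    !![LinearMap.mul' ℂ Γ.InvExt (TensorProduct.map (Γ.inc ∘ₗ Γ.pi) (Γ.inc ∘ₗ Γ.pi)
        (Coalgebra.comul (R := ℂ) a)), 0; 0,
      LinearMap.mul' ℂ Γ.InvExt (TensorProduct.map (Γ.inc ∘ₗ Γ.pi) (Γ.inc ∘ₗ Γ.pi)
        (Coalgebra.comul (R := ℂ) a))] := by
  have key : ∀ t : A ⊗[ℂ] A,
      LinearMap.mul' ℂ _ (TensorProduct.map (Γ.dMatrixGen ∘ₗ Γ.pi) (Γ.dMatrixGen ∘ₗ Γ.pi) t) =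
      !![LinearMap.mul' ℂ Γ.InvExt (TensorProduct.map (Γ.inc ∘ₗ Γ.pi) (Γ.inc ∘ₗ Γ.pi) t),
        LinearMap.mul' ℂ Γ.InvExt (TensorProduct.map (Γ.dGen ∘ₗ Γ.pi) (Γ.inc ∘ₗ Γ.pi) t)
        - LinearMap.mul' ℂ Γ.InvExt (TensorProduct.map (Γ.inc ∘ₗ Γ.pi) (Γ.dGen ∘ₗ Γ.pi) t); 0,
      LinearMap.mul' ℂ Γ.InvExt (TensorProduct.map (Γ.inc ∘ₗ Γ.pi) (Γ.inc ∘ₗ Γ.pi) t)] := by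
    intro t
    induction t with
    | zero => ext i j; fin_cases i <;> fin_cases j <;> simp
    | add x y hx hy =>
      simp only [map_add, hx, hy]
      ext i j; fin_cases i <;> fin_cases j <;> simp [sub_eq_add_neg] ; abel
    | tmul x y =>
      ext i j; fin_cases i <;> fin_cases j <;>
        simp [dMatrixGen, Matrix.mul_apply, Fin.sum_univ_two, sub_eq_add_neg, add_comm]
  rw [key]
  congr 1
  have hd : Γ.dGen ∘ₗ Γ.pi = -(LinearMap.mul' ℂ _ ∘ₗ
      TensorProduct.map (Γ.inc ∘ₗ Γ.pi) (Γ.inc ∘ₗ Γ.pi) ∘ₗ Coalgebra.comul) := by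
    ext a; simp [dGen_pi]
  have h1 : ∀ t : A ⊗[ℂ] A, LinearMap.mul' ℂ Γ.InvExt
      (TensorProduct.map (Γ.dGen ∘ₗ Γ.pi) (Γ.inc ∘ₗ Γ.pi) t) =
      - LinearMap.mul' ℂ Γ.InvExt (TensorProduct.map (Γ.inc ∘ₗ Γ.pi)
        (LinearMap.mul' ℂ Γ.InvExt ∘ₗ TensorProduct.map (Γ.inc ∘ₗ Γ.pi) (Γ.inc ∘ₗ Γ.pi))
        (TensorProduct.assoc ℂ A A A ((Coalgebra.comul (R := ℂ)).rTensor A t))) := by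
    intro t
    induction t with
    | zero => simp
    | add x y hx hy => simp only [map_add, hx, hy]; abel
    | tmul x y =>
      simp only [hd, TensorProduct.map_tmul, LinearMap.neg_apply, LinearMap.rTensor_tmul,
        LinearMap.comp_apply, LinearMap.mul'_apply]
      generalize Coalgebra.comul (R := ℂ) x = s
      induction s with
      | zero => simp
      | add x y hx hy => simp only [map_add, TensorProduct.add_tmul, neg_add, add_mul, hx, hy]
      | tmul x y => simp [mul_assoc]
  have h2 : ∀ t : A ⊗[ℂ] A, LinearMap.mul' ℂ Γ.InvExt
      (TensorProduct.map (Γ.inc ∘ₗ Γ.pi) (Γ.dGen ∘ₗ Γ.pi) t) =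
      - LinearMap.mul' ℂ Γ.InvExt (TensorProduct.map (Γ.inc ∘ₗ Γ.pi)
        (LinearMap.mul' ℂ Γ.InvExt ∘ₗ TensorProduct.map (Γ.inc ∘ₗ Γ.pi) (Γ.inc ∘ₗ Γ.pi))
        ((Coalgebra.comul (R := ℂ)).lTensor A t)) := by
    intro t
    induction t with
    | zero => simp
    | add x y hx hy => simp only [map_add, hx, hy]; abel
    | tmul x y => simp [hd]
  rw [h1, h2, Coalgebra.coassoc_apply, sub_self]

def dMatrix : Γ.InvExt →ₐ[ℂ] Matrix (Fin 2) (Fin 2) Γ.InvExt :=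
  Γ.extLift Γ.dMatrixGen fun r hr => by
    rw [dMatrix_aux, Γ.inc_quad hr]
    ext i j; fin_cases i <;> fin_cases j <;> simp

/-- The differential of `Γ_inv^∧`: the graded derivation with `d π(a) = - π(a₁) π(a₂)`. -/
def dInv : Γ.InvExt →ₗ[ℂ] Γ.InvExt where
  toFun x := Γ.dMatrix x 0 1
  map_add' x y := by simp
  map_smul' c x := by simp

/-- The map `Γ_inv → Hom(A, Γ_inv^∧)`, `ϑ ↦ (a ↦ ϑ ∘ a)`. -/
def actGen : Γ.Inv →ₗ[ℂ] WithConv (A →ₗ[ℂ] Γ.InvExt) :=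
  (WithConv.linearEquiv ℂ (A →ₗ[ℂ] Γ.InvExt)).symm.toLinearMap ∘ₗ Γ.circ.compr₂ Γ.inc

/-- The right action `∘` of `A` on `Γ_inv^∧`: `1 ∘ a = ε(a) 1`,
`(ϑ η) ∘ a = (ϑ ∘ a₁) (η ∘ a₂)`; the two rules say that `ϑ ↦ (a ↦ ϑ ∘ a)` is a unital
homomorphism into the convolution algebra of linear maps from `A` to `Γ_inv^∧`. -/
def actHom : Γ.InvExt →ₐ[ℂ] WithConv (A →ₗ[ℂ] Γ.InvExt) :=
  Γ.extLift Γ.actGen (by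
    intro r hr
    have key : ∀ t s : A ⊗[ℂ] A, ∀ a : A, Coalgebra.comul (R := ℂ) a = s →
        (LinearMap.mul' ℂ _ (TensorProduct.map (Γ.actGen ∘ₗ Γ.pi) (Γ.actGen ∘ₗ Γ.pi) t)).ofConv a
        = Γ.quadExt (t * s)
          - Γ.quadExt ((1 ⊗ₜ TensorProduct.lid ℂ A (Coalgebra.counit.rTensor A t)) * s)
          - Γ.quadExt ((TensorProduct.rid ℂ A (Coalgebra.counit.lTensor A t) ⊗ₜ 1) * s)
          + Coalgebra.counit (R := ℂ) (TensorProduct.lid ℂ A (Coalgebra.counit.rTensor A t))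
            • Γ.quadExt s := by
      intro t s a ha
      induction t with
      | zero => simp
      | add x y hx hy =>
        simp only [map_add, WithConv.ofConv_add, LinearMap.add_apply, hx, hy, add_mul,
          TensorProduct.tmul_add, TensorProduct.add_tmul, add_smul]
        abel
      | tmul x y =>
        simp only [TensorProduct.map_tmul, LinearMap.mul'_apply, LinearMap.comp_apply]
        rw [LinearMap.convMul_def, WithConv.ofConv_toConv, LinearMap.comp_apply,
          LinearMap.comp_apply, ha]
        clear ha
        induction s with
        | zero => simp
        | add x y hx hy => simp only [map_add, hx, hy, mul_add, smul_add]; abel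
        | tmul b c =>
          simp [actGen, quadExt, circ_pi, sub_mul, mul_sub]
          module
    have hz : ∀ b : A, Γ.inc (Γ.pi (r * b)) = 0 := fun b => by
      rw [Γ.pi_eq_zero (Γ.ideal_mul_mem r hr b), map_zero]
    apply WithConv.ofConv_injective
    ext a
    rw [key _ _ a rfl, Coalgebra.rTensor_counit_comul, Coalgebra.lTensor_counit_comul]
    have e1 : Γ.quadExt (Coalgebra.comul (R := ℂ) r * Coalgebra.comul (R := ℂ) a) = 0 := by
      rw [← Bialgebra.comul_mul]
      exact Γ.inc_quad (Γ.ideal_mul_mem r hr a)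
    have e2 : ∀ s : A ⊗[ℂ] A, Γ.quadExt ((1 ⊗ₜ r) * s) = 0 := by
      intro s
      induction s with
      | zero => simp
      | add x y hx hy => simp only [mul_add, map_add, hx, hy, add_zero]
      | tmul x y => simp [quadExt, hz]
    have e3 : ∀ s : A ⊗[ℂ] A, Γ.quadExt ((r ⊗ₜ 1) * s) = 0 := by
      intro s
      induction s with
      | zero => simp
      | add x y hx hy => simp only [mul_add, map_add, hx, hy, add_zero]
      | tmul x y => simp [quadExt, hz]
    simp [e1, e2, e3, Γ.counit_eq_zero r hr])

/-- `ϑ ∘ a`. -/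
def act (x : Γ.InvExt) : A →ₗ[ℂ] Γ.InvExt := (Γ.actHom x).ofConv

/-! ### The universal envelope `Γ^∧` -/

/-- The map `A ⊗ A → Γ = A ⊗ Γ_inv`, `a ⊗ b ↦ a db = a b₁ π(b₂)`. -/
def formMap : A ⊗[ℂ] A →ₗ[ℂ] A ⊗[ℂ] Γ.Inv :=
  TensorProduct.map (LinearMap.mul' ℂ A) Γ.pi ∘ₗ (TensorProduct.assoc ℂ A A A).symm.toLinearMap
    ∘ₗ (Coalgebra.comul (R := ℂ) (A := A)).lTensor A

/-- The generators `a` of the envelope, in the tensor algebra of `A × A`; the pair `(a, b)` stands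
for `a + db`. -/
def gen : A →ₗ[ℂ] TensorAlgebra ℂ (A × A) := TensorAlgebra.ι ℂ ∘ₗ LinearMap.inl ℂ A A

/-- The generators `da` of the envelope. -/
def dgen : A →ₗ[ℂ] TensorAlgebra ℂ (A × A) := TensorAlgebra.ι ℂ ∘ₗ LinearMap.inr ℂ A A

/-- The defining relations of `Γ^∧`: `A` is a unital subalgebra, `d` satisfies the Leibniz rule,
and `∑ aₖ dbₖ = 0` in `Γ` implies `∑ aₖ dbₖ = 0` and `∑ daₖ dbₖ = 0`. -/
inductive EnvRel : TensorAlgebra ℂ (A × A) → TensorAlgebra ℂ (A × A) → Prop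
  | one : EnvRel (gen 1) 1
  | mul (a b : A) : EnvRel (gen (a * b)) (gen a * gen b)
  | leibniz (a b : A) : EnvRel (dgen (a * b)) (dgen a * gen b + gen a * dgen b)
  | form (t : A ⊗[ℂ] A) (ht : Γ.formMap t = 0) :
      EnvRel (LinearMap.mul' ℂ _ (TensorProduct.map gen dgen t)) 0
  | dform (t : A ⊗[ℂ] A) (ht : Γ.formMap t = 0) :
      EnvRel (LinearMap.mul' ℂ _ (TensorProduct.map dgen dgen t)) 0

/-- The universal differential envelope `Γ^∧` of the first-order calculus. -/
def Env : Type _ := RingQuot Γ.EnvRel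

instance : Ring Γ.Env := inferInstanceAs (Ring (RingQuot Γ.EnvRel))

instance : Algebra ℂ Γ.Env := inferInstanceAs (Algebra ℂ (RingQuot Γ.EnvRel))

def envMk : TensorAlgebra ℂ (A × A) →ₐ[ℂ] Γ.Env := RingQuot.mkAlgHom ℂ Γ.EnvRel

lemma envMk_surjective : Function.Surjective Γ.envMk := RingQuot.mkAlgHom_surjective ℂ Γ.EnvRel

lemma envMk_rel {x y : TensorAlgebra ℂ (A × A)} (h : Γ.EnvRel x y) : Γ.envMk x = Γ.envMk y :=
  RingQuot.mkAlgHom_rel ℂ h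

/-- The inclusion `A → Γ^∧`. -/
def incA : A →ₐ[ℂ] Γ.Env :=
  AlgHom.ofLinearMap (Γ.envMk.toLinearMap ∘ₗ gen)
    ((Γ.envMk_rel EnvRel.one).trans (map_one _))
    (fun a b => (Γ.envMk_rel (EnvRel.mul a b)).trans (map_mul _ _ _))

/-- The differential `A → Γ ⊆ Γ^∧`. -/
def dA : A →ₗ[ℂ] Γ.Env := Γ.envMk.toLinearMap ∘ₗ dgen

lemma dA_mul (a b : A) : Γ.dA (a * b) = Γ.dA a * Γ.incA b + Γ.incA a * Γ.dA b :=
  (Γ.envMk_rel (EnvRel.leibniz a b)).trans (by rw [map_add, map_mul, map_mul]; rfl)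

lemma dA_one : Γ.dA 1 = 0 := by
  have h := Γ.dA_mul 1 1
  simpa using h

lemma envMk_map (f g : A →ₗ[ℂ] TensorAlgebra ℂ (A × A)) (t : A ⊗[ℂ] A) :
    Γ.envMk (LinearMap.mul' ℂ _ (TensorProduct.map f g t)) =
      LinearMap.mul' ℂ _ (TensorProduct.map (Γ.envMk.toLinearMap ∘ₗ f)
        (Γ.envMk.toLinearMap ∘ₗ g) t) := by
  induction t with
  | zero => simp
  | add x y hx hy => simp only [map_add, hx, hy]
  | tmul x y => simp

lemma env_form {t : A ⊗[ℂ] A} (ht : Γ.formMap t = 0) :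
    LinearMap.mul' ℂ _ (TensorProduct.map Γ.incA.toLinearMap Γ.dA t) = 0 := by
  have := Γ.envMk_rel (EnvRel.form t ht)
  rwa [envMk_map, map_zero] at this

lemma env_dform {t : A ⊗[ℂ] A} (ht : Γ.formMap t = 0) :
    LinearMap.mul' ℂ _ (TensorProduct.map Γ.dA Γ.dA t) = 0 := by
  have := Γ.envMk_rel (EnvRel.dform t ht)
  rwa [envMk_map, map_zero] at this

/-- Algebra homomorphisms out of `Γ^∧`. -/
def envLift {B : Type*} [Semiring B] [Algebra ℂ B] (f : A →ₐ[ℂ] B) (g : A →ₗ[ℂ] B)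
    (hL : ∀ a b, g (a * b) = g a * f b + f a * g b)
    (h1 : ∀ t, Γ.formMap t = 0 →
      LinearMap.mul' ℂ B (TensorProduct.map f.toLinearMap g t) = 0)
    (h2 : ∀ t, Γ.formMap t = 0 → LinearMap.mul' ℂ B (TensorProduct.map g g t) = 0) :
    Γ.Env →ₐ[ℂ] B :=
  RingQuot.liftAlgHom ℂ ⟨TensorAlgebra.lift ℂ (f.toLinearMap.coprod g), by
    have key : ∀ (p q : A →ₗ[ℂ] TensorAlgebra ℂ (A × A)) (t : A ⊗[ℂ] A),
        TensorAlgebra.lift ℂ (f.toLinearMap.coprod g)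
          (LinearMap.mul' ℂ _ (TensorProduct.map p q t)) =
        LinearMap.mul' ℂ B (TensorProduct.map
          ((TensorAlgebra.lift ℂ (f.toLinearMap.coprod g)).toLinearMap ∘ₗ p)
          ((TensorAlgebra.lift ℂ (f.toLinearMap.coprod g)).toLinearMap ∘ₗ q) t) := by
      intro p q t
      induction t with
      | zero => simp
      | add x y hx hy => simp only [map_add, hx, hy]
      | tmul x y => simp
    have e1 : (TensorAlgebra.lift ℂ (f.toLinearMap.coprod g)).toLinearMap ∘ₗ gen
        = f.toLinearMap := by ext a; simp [gen]
    have e2 : (TensorAlgebra.lift ℂ (f.toLinearMap.coprod g)).toLinearMap ∘ₗ dgen = g := by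
      ext a; simp [dgen]
    rintro _ _ (_ | ⟨a, b⟩ | ⟨a, b⟩ | ⟨t, ht⟩ | ⟨t, ht⟩)
    · simp [gen]
    · simp [gen]
    · simp [gen, dgen, hL]
    · rw [key, e1, e2, h1 t ht, map_zero]
    · rw [key, e2, h2 t ht, map_zero]⟩

section envLift

variable {B : Type*} [Semiring B] [Algebra ℂ B] (f : A →ₐ[ℂ] B) (g : A →ₗ[ℂ] B)
    (hL : ∀ a b, g (a * b) = g a * f b + f a * g b)
    (h1 : ∀ t, Γ.formMap t = 0 →
      LinearMap.mul' ℂ B (TensorProduct.map f.toLinearMap g t) = 0)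
    (h2 : ∀ t, Γ.formMap t = 0 → LinearMap.mul' ℂ B (TensorProduct.map g g t) = 0)

@[simp] lemma envLift_incA (a : A) : Γ.envLift f g hL h1 h2 (Γ.incA a) = f a := by
  refine (RingQuot.liftAlgHom_mkAlgHom_apply ℂ _ _ _).trans ?_
  simp [gen]

@[simp] lemma envLift_dA (a : A) : Γ.envLift f g hL h1 h2 (Γ.dA a) = g a := by
  refine (RingQuot.liftAlgHom_mkAlgHom_apply ℂ _ _ _).trans ?_
  simp [dgen]

end envLift

lemma env_adjoin :
    Algebra.adjoin ℂ (Set.range Γ.incA ∪ Set.range Γ.dA) = ⊤ := by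
  rw [eq_top_iff]
  rintro x -
  obtain ⟨y, rfl⟩ := Γ.envMk_surjective x
  induction y using TensorAlgebra.induction with
  | algebraMap r => rw [AlgHom.commutes]; exact Subalgebra.algebraMap_mem _ r
  | ι p =>
    have : Γ.envMk (TensorAlgebra.ι ℂ p) = Γ.incA p.1 + Γ.dA p.2 := by
      have e : TensorAlgebra.ι ℂ p = gen p.1 + dgen p.2 := by
        simp [gen, dgen, ← map_add]
      rw [e, map_add]; rfl
    rw [this]
    exact add_mem (Algebra.subset_adjoin (Or.inl ⟨_, rfl⟩))
      (Algebra.subset_adjoin (Or.inr ⟨_, rfl⟩))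
  | mul a b ha hb => rw [map_mul]; exact mul_mem ha hb
  | add a b ha hb => rw [map_add]; exact add_mem ha hb

/-- The projection `p_* : Γ^∧ → A` onto the degree zero part. -/
def pStar : Γ.Env →ₐ[ℂ] A :=
  Γ.envLift (AlgHom.id ℂ A) 0 (by simp) (by simp) (by simp)

lemma pStar_incA (a : A) : Γ.pStar (Γ.incA a) = a := by simp [pStar]

lemma pStar_dA (a : A) : Γ.pStar (Γ.dA a) = 0 := by simp [pStar]

lemma incA_injective : Function.Injective Γ.incA :=
  Function.LeftInverse.injective Γ.pStar_incA

/-- Auxiliary homomorphism `A → M₂(Γ^∧)`, `a ↦ [[a, da], [0, a]]`. -/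
def envMatA : A →ₐ[ℂ] Matrix (Fin 2) (Fin 2) Γ.Env :=
  AlgHom.ofLinearMap
    { toFun := fun a => !![Γ.incA a, Γ.dA a; 0, Γ.incA a]
      map_add' := fun x y => by ext i j; fin_cases i <;> fin_cases j <;> simp
      map_smul' := fun c x => by ext i j; fin_cases i <;> fin_cases j <;> simp }
    (by ext i j; fin_cases i <;> fin_cases j <;> simp [dA_one])
    (fun a b => by
      ext i j; fin_cases i <;> fin_cases j <;> simp [dA_mul, add_comm])

/-- Auxiliary map `A → M₂(Γ^∧)`, `a ↦ [[-da, 0], [0, da]]`. -/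
def envMatD : A →ₗ[ℂ] Matrix (Fin 2) (Fin 2) Γ.Env where
  toFun := fun a => !![-Γ.dA a, 0; 0, Γ.dA a]
  map_add' := fun x y => by ext i j; fin_cases i <;> fin_cases j <;> simp [add_comm]
  map_smul' := fun c x => by ext i j; fin_cases i <;> fin_cases j <;> simp

lemma envMat_form (t : A ⊗[ℂ] A) :
    LinearMap.mul' ℂ _ (TensorProduct.map Γ.envMatA.toLinearMap Γ.envMatD t) =
      !![-LinearMap.mul' ℂ _ (TensorProduct.map Γ.incA.toLinearMap Γ.dA t),
        LinearMap.mul' ℂ _ (TensorProduct.map Γ.dA Γ.dA t); 0,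
        LinearMap.mul' ℂ _ (TensorProduct.map Γ.incA.toLinearMap Γ.dA t)] := by
  induction t with
  | zero => ext i j; fin_cases i <;> fin_cases j <;> simp
  | add x y hx hy =>
    simp only [map_add, hx, hy]
    ext i j; fin_cases i <;> fin_cases j <;> simp [add_comm]
  | tmul x y =>
    ext i j; fin_cases i <;> fin_cases j <;> simp [envMatA, envMatD]

lemma envMat_dform (t : A ⊗[ℂ] A) :
    LinearMap.mul' ℂ _ (TensorProduct.map Γ.envMatD Γ.envMatD t) =
      !![LinearMap.mul' ℂ _ (TensorProduct.map Γ.dA Γ.dA t), 0; 0,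
        LinearMap.mul' ℂ _ (TensorProduct.map Γ.dA Γ.dA t)] := by
  induction t with
  | zero => ext i j; fin_cases i <;> fin_cases j <;> simp
  | add x y hx hy =>
    simp only [map_add, hx, hy]
    ext i j; fin_cases i <;> fin_cases j <;> simp
  | tmul x y =>
    ext i j; fin_cases i <;> fin_cases j <;> simp [envMatD]

/-- Auxiliary homomorphism `x ↦ [[(-1)^∂x x, d x], [0, x]]`, which encodes the graded Leibniz
rule. -/
def envDMatrix : Γ.Env →ₐ[ℂ] Matrix (Fin 2) (Fin 2) Γ.Env :=
  Γ.envLift Γ.envMatA Γ.envMatD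
    (fun a b => by
      ext i j; fin_cases i <;> fin_cases j <;> simp [envMatA, envMatD, dA_mul, add_comm])
    (fun t ht => by
      rw [envMat_form, Γ.env_form ht, Γ.env_dform ht]
      ext i j; fin_cases i <;> fin_cases j <;> simp)
    (fun t ht => by
      rw [envMat_dform, Γ.env_dform ht]
      ext i j; fin_cases i <;> fin_cases j <;> simp)

/-- The differential of `Γ^∧`: the graded derivation of degree one and square zero that extends
`A → Γ`. -/
def dEnv : Γ.Env →ₗ[ℂ] Γ.Env where
  toFun x := Γ.envDMatrix x 0 1
  map_add' x y := by simp
  map_smul' c x := by simp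

lemma dEnv_incA (a : A) : Γ.dEnv (Γ.incA a) = Γ.dA a := by
  simp [dEnv, envDMatrix, envMatA]

lemma dEnv_dA (a : A) : Γ.dEnv (Γ.dA a) = 0 := by
  simp [dEnv, envDMatrix, envMatD]

/-! ### The grading of `Γ^∧` -/

/-- The homomorphism `Γ^∧ → Γ^∧[X]` that multiplies elements of degree `n` by `X ^ n`. -/
def degHom : Γ.Env →ₐ[ℂ] Polynomial Γ.Env :=
  Γ.envLift (Polynomial.CAlgHom.comp Γ.incA)
    ((Polynomial.monomial 1).restrictScalars ℂ ∘ₗ Γ.dA)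
    (fun a b => by
      simp [dA_mul, ← Polynomial.C_mul_X_pow_eq_monomial, add_mul, mul_assoc])
    (fun t ht => by
      have : ∀ t : A ⊗[ℂ] A, LinearMap.mul' ℂ _ (TensorProduct.map
          (Polynomial.CAlgHom.comp Γ.incA).toLinearMap
          ((Polynomial.monomial 1).restrictScalars ℂ ∘ₗ Γ.dA) t) =
          Polynomial.monomial 1 (LinearMap.mul' ℂ _
            (TensorProduct.map Γ.incA.toLinearMap Γ.dA t)) := by
        intro t
        induction t with
        | zero => simp
        | add x y hx hy => simp only [map_add, hx, hy]
        | tmul x y => simp [Polynomial.C_mul_monomial]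
      rw [this, Γ.env_form ht, map_zero])
    (fun t ht => by
      have : ∀ t : A ⊗[ℂ] A, LinearMap.mul' ℂ _ (TensorProduct.map
          ((Polynomial.monomial 1).restrictScalars ℂ ∘ₗ Γ.dA)
          ((Polynomial.monomial 1).restrictScalars ℂ ∘ₗ Γ.dA) t) =
          Polynomial.monomial 2 (LinearMap.mul' ℂ _ (TensorProduct.map Γ.dA Γ.dA t)) := by
        intro t
        induction t with
        | zero => simp
        | add x y hx hy => simp only [map_add, hx, hy]
        | tmul x y => simp [Polynomial.monomial_mul_monomial]
      rw [this, Γ.env_dform ht, map_zero])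

/-- The homogeneous part of degree `n` of `Γ^∧`. -/
def envGrading (n : ℕ) : Submodule ℂ Γ.Env :=
  LinearMap.ker (Γ.degHom.toLinearMap - (Polynomial.monomial n).restrictScalars ℂ)

lemma mem_envGrading {n : ℕ} {x : Γ.Env} :
    x ∈ Γ.envGrading n ↔ Γ.degHom x = Polynomial.monomial n x := by
  simp [envGrading, sub_eq_zero]

lemma incA_mem (a : A) : Γ.incA a ∈ Γ.envGrading 0 := by
  simp [mem_envGrading, degHom]

lemma dA_mem (a : A) : Γ.dA a ∈ Γ.envGrading 1 := by
  simp [mem_envGrading, degHom]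

instance : SetLike.GradedMonoid Γ.envGrading where
  one_mem := by simpa using Γ.incA_mem 1
  mul_mem i j x y hx hy := by
    rw [mem_envGrading] at *
    rw [map_mul, hx, hy, Polynomial.monomial_mul_monomial]

lemma coeff_degHom_mem (x : Γ.Env) :
    (∀ n, (Γ.degHom x).coeff n ∈ Γ.envGrading n) ∧ (Γ.degHom x).eval 1 = x := by
  have hx : x ∈ Algebra.adjoin ℂ (Set.range Γ.incA ∪ Set.range Γ.dA) := by
    rw [env_adjoin]; trivial
  have hom : ∀ (m : ℕ) (y : Γ.Env), y ∈ Γ.envGrading m →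
      (∀ n, (Γ.degHom y).coeff n ∈ Γ.envGrading n) ∧ (Γ.degHom y).eval 1 = y := by
    intro m y hy
    rw [Γ.mem_envGrading.1 hy]
    refine ⟨fun n => ?_, by simp⟩
    rw [Polynomial.coeff_monomial]
    split_ifs with h
    · exact h ▸ hy
    · exact zero_mem _
  induction hx using Algebra.adjoin_induction with
  | mem y hy =>
    rcases hy with ⟨a, rfl⟩ | ⟨a, rfl⟩
    · exact hom 0 _ (Γ.incA_mem a)
    · exact hom 1 _ (Γ.dA_mem a)
  | algebraMap r =>
    refine hom 0 _ ?_
    rw [← Γ.incA.commutes r]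
    exact Γ.incA_mem _
  | add y z _ _ hy hz =>
    rw [map_add]
    refine ⟨fun n => ?_, by rw [Polynomial.eval_add, hy.2, hz.2]⟩
    rw [Polynomial.coeff_add]
    exact add_mem (hy.1 n) (hz.1 n)
  | mul y z _ _ hy hz =>
    rw [map_mul]
    refine ⟨fun n => ?_, ?_⟩
    · rw [Polynomial.coeff_mul]
      refine sum_mem fun p hp => ?_
      rw [← (Finset.HasAntidiagonal.mem_antidiagonal.1 hp : p.1 + p.2 = n)]
      exact SetLike.mul_mem_graded (hy.1 _) (hz.1 _)
    · rw [Polynomial.eval, Polynomial.eval₂_mul_noncomm _ _ fun k => Commute.one_right _]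
      exact congrArg₂ (· * ·) hy.2 hz.2

/-- The homogeneous components of an element of `Γ^∧`. -/
def envDecompose (x : Γ.Env) : DirectSum ℕ fun n => Γ.envGrading n :=
  ∑ n ∈ (Γ.degHom x).support,
    DirectSum.of (fun n => Γ.envGrading n) n ⟨(Γ.degHom x).coeff n, (Γ.coeff_degHom_mem x).1 n⟩

lemma envDecompose_apply (x : Γ.Env) (n : ℕ) :
    (Γ.envDecompose x n : Γ.Env) = (Γ.degHom x).coeff n := by
  rw [envDecompose, DFinsupp.finsetSum_apply, AddSubmonoidClass.coe_finsetSum,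
    Finset.sum_eq_single n]
  · rw [DirectSum.of_eq_same]
  · intro m _ hm
    rw [DirectSum.of_eq_of_ne _ _ _ hm.symm]; rfl
  · intro h
    rw [DirectSum.of_eq_same]
    exact Polynomial.notMem_support_iff.1 h

instance : DirectSum.Decomposition Γ.envGrading where
  decompose' := Γ.envDecompose
  left_inv x := by
    conv_rhs => rw [← (Γ.coeff_degHom_mem x).2]
    rw [envDecompose, map_sum, Polynomial.eval_eq_sum, Polynomial.sum]
    refine Finset.sum_congr rfl fun n _ => ?_
    rw [DirectSum.coeAddMonoidHom_of, one_pow, mul_one]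
  right_inv x := by
    refine DFinsupp.ext fun n => Subtype.ext ?_
    rw [envDecompose_apply]
    induction x using DirectSum.induction_on with
    | zero => simp
    | of i y =>
      rw [DirectSum.coeAddMonoidHom_of, Γ.mem_envGrading.1 y.2, Polynomial.coeff_monomial]
      split_ifs with h
      · subst h; rw [DirectSum.of_eq_same]
      · rw [DirectSum.of_eq_of_ne _ _ _ (Ne.symm h)]; rfl
    | add y z hy hz =>
      rw [map_add, map_add, Polynomial.coeff_add, hy, hz]; rfl

instance : GradedAlgebra Γ.envGrading where

/-! ### The right action of the quantum group on `Γ^∧` -/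

/-! ### The right action of the quantum group on `Γ^∧` -/

/-- The right coaction on `Γ = A ⊗ Γ_inv`. -/
def formCoaction : A ⊗[ℂ] Γ.Inv →ₗ[ℂ] (A ⊗[ℂ] Γ.Inv) ⊗[ℂ] A :=
  (LinearMap.mul' ℂ A).lTensor (A ⊗[ℂ] Γ.Inv)
    ∘ₗ (TensorProduct.tensorTensorTensorComm ℂ A A Γ.Inv A).toLinearMap
    ∘ₗ TensorProduct.map Coalgebra.comul Γ.varpi

lemma formMap_codiag (t : A ⊗[ℂ] A) :
    Γ.formMap.rTensor A (codiag t) = Γ.formCoaction (Γ.formMap t) := by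
  induction t with
  | zero => simp
  | add x y hx hy => simp only [map_add, hx, hy]
  | tmul a b =>
    let M : (A ⊗[ℂ] A) ⊗[ℂ] (A ⊗[ℂ] (A ⊗[ℂ] A)) →ₗ[ℂ] (A ⊗[ℂ] Γ.Inv) ⊗[ℂ] A :=
      TensorProduct.map (TensorProduct.map (LinearMap.mul' ℂ A) Γ.pi
          ∘ₗ (TensorProduct.assoc ℂ A A A).symm.toLinearMap) (LinearMap.mul' ℂ A)
        ∘ₗ (TensorProduct.tensorTensorTensorComm ℂ A A (A ⊗[ℂ] A) A).toLinearMap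
        ∘ₗ (TensorProduct.assoc ℂ A A A).symm.toLinearMap.lTensor (A ⊗[ℂ] A)
    have hL : ∀ c s : A ⊗[ℂ] A,
        Γ.formMap.rTensor A ((LinearMap.mul' ℂ A).lTensor (A ⊗[ℂ] A)
          (TensorProduct.tensorTensorTensorComm ℂ A A A A (c ⊗ₜ s))) =
        M (c ⊗ₜ TensorProduct.assoc ℂ A A A ((Coalgebra.comul (R := ℂ)).rTensor A s)) := by
      intro c s
      induction c with
      | zero => simp
      | add x y hx hy => simp only [map_add, TensorProduct.add_tmul, hx, hy]
      | tmul p q =>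
        induction s with
        | zero => simp
        | add x y hx hy => simp only [map_add, TensorProduct.tmul_add, hx, hy]
        | tmul x y =>
          simp only [TensorProduct.tensorTensorTensorComm_tmul, LinearMap.lTensor_tmul,
            LinearMap.rTensor_tmul, LinearMap.mul'_apply, formMap, LinearMap.comp_apply]
          generalize Coalgebra.comul (R := ℂ) x = u
          induction u with
          | zero => simp
          | add x y hx hy =>
            simp only [map_add, TensorProduct.tmul_add, TensorProduct.add_tmul, hx, hy]
          | tmul x z => simp [M]
    have hR : ∀ (c w : A ⊗[ℂ] A) (y : A), (LinearMap.mul' ℂ A).lTensor (A ⊗[ℂ] Γ.Inv)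
        (TensorProduct.tensorTensorTensorComm ℂ A A Γ.Inv A ((c * w) ⊗ₜ Γ.pi.rTensor A (ad A y))) =
        M (c ⊗ₜ adTwist.lTensor A (TensorProduct.assoc ℂ A A A (w ⊗ₜ y))) := by
      intro c w y
      induction c with
      | zero => simp
      | add x y hx hy => simp only [map_add, TensorProduct.add_tmul, add_mul, hx, hy]
      | tmul p q =>
        induction w with
        | zero => simp
        | add x y hx hy => simp only [map_add, TensorProduct.add_tmul, TensorProduct.tmul_add,
            mul_add, hx, hy]
        | tmul x z =>
          simp only [TensorProduct.assoc_tmul, LinearMap.lTensor_tmul, adTwist,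
            TensorProduct.lift.tmul, LinearMap.mk₂_apply]
          generalize ad A y = v
          induction v with
          | zero => simp
          | add x y hx hy => simp only [map_add, TensorProduct.tmul_add, mul_add, hx, hy]
          | tmul x z => simp [M, mul_assoc]
    have hR' : ∀ s : A ⊗[ℂ] A, Γ.formCoaction (TensorProduct.map (LinearMap.mul' ℂ A) Γ.pi
        ((TensorProduct.assoc ℂ A A A).symm (a ⊗ₜ s))) =
        M (Coalgebra.comul (R := ℂ) a ⊗ₜ adTwist.lTensor A (TensorProduct.assoc ℂ A A A
          ((Coalgebra.comul (R := ℂ)).rTensor A s))) := by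
      intro s
      induction s with
      | zero => simp
      | add x y hx hy => simp only [map_add, TensorProduct.tmul_add, hx, hy]
      | tmul x y =>
        rw [LinearMap.rTensor_tmul, ← hR, ← varpi_pi, ← Bialgebra.comul_mul]
        simp [formCoaction]
    have hR'' : Γ.formCoaction (Γ.formMap (a ⊗ₜ b)) = M (Coalgebra.comul (R := ℂ) a ⊗ₜ
        adTwist.lTensor A (TensorProduct.assoc ℂ A A A
          ((Coalgebra.comul (R := ℂ)).rTensor A (Coalgebra.comul (R := ℂ) b)))) := hR' _
    have hA : (adTwist ∘ₗ Coalgebra.comul : A →ₗ[ℂ] A ⊗[ℂ] A) = Coalgebra.comul :=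
      LinearMap.ext adTwist_comul
    rw [hR'', Coalgebra.coassoc_apply, ← LinearMap.lTensor_comp_apply, hA,
      ← Coalgebra.coassoc_apply]
    exact hL _ _

lemma codiag_mem {t : A ⊗[ℂ] A} (ht : Γ.formMap t = 0) :
    codiag t ∈ LinearMap.range ((LinearMap.ker Γ.formMap).subtype.rTensor A) := by
  have h : Γ.formMap.rTensor A (codiag t) = 0 := by rw [formMap_codiag, ht, map_zero]
  exact (Module.Flat.rTensor_exact A (LinearMap.exact_subtype_ker_map Γ.formMap) _).1 h

lemma map_codiag_eq_zero {B : Type*} [Ring B] [Algebra ℂ B] (f g : A →ₗ[ℂ] B)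
    (h : ∀ t, Γ.formMap t = 0 → LinearMap.mul' ℂ B (TensorProduct.map f g t) = 0)
    {t : A ⊗[ℂ] A} (ht : Γ.formMap t = 0) :
    LinearMap.mul' ℂ (B ⊗[ℂ] A) (TensorProduct.map (f.rTensor A ∘ₗ Coalgebra.comul)
      (g.rTensor A ∘ₗ Coalgebra.comul) t) = 0 := by
  have h1 : ∀ t : A ⊗[ℂ] A, LinearMap.mul' ℂ (B ⊗[ℂ] A)
      (TensorProduct.map (f.rTensor A ∘ₗ Coalgebra.comul) (g.rTensor A ∘ₗ Coalgebra.comul) t) =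
      (LinearMap.mul' ℂ B ∘ₗ TensorProduct.map f g).rTensor A (codiag t) := by
    intro t
    induction t with
    | zero => simp
    | add x y hx hy => simp only [map_add, hx, hy]
    | tmul x y =>
      simp only [codiag, TensorProduct.map_tmul, LinearMap.comp_apply, LinearMap.mul'_apply]
      generalize Coalgebra.comul (R := ℂ) x = u
      generalize Coalgebra.comul (R := ℂ) y = v
      induction u with
      | zero => simp
      | add x y hx hy => simp only [map_add, TensorProduct.add_tmul, add_mul, hx, hy]
      | tmul p q =>
        induction v with
        | zero => simp
        | add x y hx hy => simp only [map_add, TensorProduct.tmul_add, mul_add, hx, hy]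
        | tmul x y => simp
  obtain ⟨s, hs⟩ := Γ.codiag_mem ht
  have h0 : (LinearMap.mul' ℂ B ∘ₗ TensorProduct.map f g) ∘ₗ (LinearMap.ker Γ.formMap).subtype
      = 0 := by
    ext x; exact h x.1 x.2
  rw [h1, ← hs, ← LinearMap.rTensor_comp_apply, h0, LinearMap.rTensor_zero,
    LinearMap.zero_apply]

/-- The right action `Γ^∧ → Γ^∧ ⊗ A` of the quantum group on its envelope. -/
def envCoaction : Γ.Env →ₐ[ℂ] Γ.Env ⊗[ℂ] A :=
  Γ.envLift ((Algebra.TensorProduct.map Γ.incA (AlgHom.id ℂ A)).comp (Bialgebra.comulAlgHom ℂ A))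
    (Γ.dA.rTensor A ∘ₗ Coalgebra.comul)
    (fun a b => by
      simp only [LinearMap.comp_apply, AlgHom.comp_apply, Bialgebra.comulAlgHom_apply,
        Bialgebra.comul_mul]
      generalize Coalgebra.comul (R := ℂ) a = u
      generalize Coalgebra.comul (R := ℂ) b = v
      induction u with
      | zero => simp
      | add x y hx hy => simp only [map_add, add_mul, hx, hy]; abel
      | tmul p q =>
        induction v with
        | zero => simp
        | add x y hx hy => simp only [map_add, mul_add, hx, hy]; abel
        | tmul x y => simp [dA_mul, TensorProduct.add_tmul])
    (fun t ht => Γ.map_codiag_eq_zero Γ.incA.toLinearMap Γ.dA (fun _ => Γ.env_form) ht)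
    (fun t ht => Γ.map_codiag_eq_zero Γ.dA Γ.dA (fun _ => Γ.env_dform) ht)

lemma envCoaction_incA (a : A) :
    Γ.envCoaction (Γ.incA a) = Γ.incA.toLinearMap.rTensor A (Coalgebra.comul (R := ℂ) a) :=
  Γ.envLift_incA _ _ _ _ _ a

lemma envCoaction_dA (a : A) :
    Γ.envCoaction (Γ.dA a) = Γ.dA.rTensor A (Coalgebra.comul (R := ℂ) a) :=
  Γ.envLift_dA _ _ _ _ _ a

lemma env_hom_ext {B : Type*} [Semiring B] [Algebra ℂ B] {f g : Γ.Env →ₐ[ℂ] B}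
    (h0 : ∀ a, f (Γ.incA a) = g (Γ.incA a)) (h1 : ∀ a, f (Γ.dA a) = g (Γ.dA a)) : f = g := by
  refine AlgHom.ext_of_adjoin_eq_top Γ.env_adjoin ?_
  rintro _ (⟨a, rfl⟩ | ⟨a, rfl⟩)
  · exact h0 a
  · exact h1 a

lemma pStar_eq_zero {n : ℕ} (hn : n ≠ 0) {x : Γ.Env} (hx : x ∈ Γ.envGrading n) :
    Γ.pStar x = 0 := by
  have h : (Polynomial.CAlgHom (R := ℂ)).comp Γ.pStar
      = (Polynomial.mapAlgHom Γ.pStar).comp Γ.degHom := by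
    refine Γ.env_hom_ext (fun a => ?_) (fun a => ?_)
    · simp [degHom, pStar_incA]
    · simp [degHom, pStar_dA]
  have h2 := DFunLike.congr_fun h x
  simp only [AlgHom.comp_apply, Γ.mem_envGrading.1 hx] at h2
  have h3 := congrArg (fun p => Polynomial.coeff p 0) h2
  simpa [Polynomial.coeff_monomial, hn] using h3

end BicovariantCalculus

end Calculus

/-! ## Graded algebras -/

section Graded

variable {W : Type*} [Ring W] [Algebra ℂ W] (gr : ℕ → Submodule ℂ W) [GradedAlgebra gr]

/-- The grading involution `w ↦ (-1)^∂w w` of a graded algebra. -/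
def gradeInv : W →ₗ[ℂ] W :=
  DirectSum.toModule ℂ ℕ W (fun n => (-1 : ℂ) ^ n • (gr n).subtype)
    ∘ₗ (DirectSum.decomposeLinearEquiv gr).toLinearMap

lemma gradeInv_of_mem {n : ℕ} {w : W} (hw : w ∈ gr n) : gradeInv gr w = (-1 : ℂ) ^ n • w := by
  lift w to gr n using hw
  simp [gradeInv]

lemma gradeInv_mul (v w : W) : gradeInv gr (v * w) = gradeInv gr v * gradeInv gr w := by
  induction v using DirectSum.Decomposition.inductionOn gr with
  | zero => simp
  | add x y hx hy => simp only [add_mul, map_add, hx, hy]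
  | @homogeneous i x =>
    induction w using DirectSum.Decomposition.inductionOn gr with
    | zero => simp
    | add x y hx hy => simp only [mul_add, map_add, hx, hy]
    | @homogeneous j y =>
      rw [gradeInv_of_mem gr x.2, gradeInv_of_mem gr y.2,
        gradeInv_of_mem gr (SetLike.mul_mem_graded x.2 y.2), smul_mul_smul_comm, pow_add]

/-- The grading involution as an algebra homomorphism. -/
def gradeInvHom : W →ₐ[ℂ] W :=
  AlgHom.ofLinearMap (gradeInv gr)
    (by simpa using gradeInv_of_mem gr (SetLike.one_mem_graded gr)) (gradeInv_mul gr)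

end Graded

/-! ## Quantum principal bundles and differential calculi on them -/

/-- A quantum principal bundle `P = (B, i, F)` over the quantum space represented by `V`: `i` is
injective and its image is the fixed-point algebra of the coaction `F`, and the action is free. -/
structure QuantumPrincipalBundle (V B A : Type*) [Ring V] [Algebra ℂ V] [StarRing V]
    [Ring B] [Algebra ℂ B] [StarRing B] [StarModule ℂ B]
    [Ring A] [HopfAlgebra ℂ A] [StarRing A] [StarModule ℂ A] where
  i : V →⋆ₐ[ℂ] B
  F : B →⋆ₐ[ℂ] B ⊗[ℂ] A
  coassoc : ∀ b, TensorProduct.assoc ℂ B A A (F.toAlgHom.toLinearMap.rTensor A (F b))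
    = (Coalgebra.comul (R := ℂ)).lTensor B (F b)
  counit : ∀ b, TensorProduct.rid ℂ B ((Coalgebra.counit (R := ℂ)).lTensor B (F b)) = b
  i_injective : Function.Injective i
  range_i : ∀ b, b ∈ Set.range i ↔ F b = b ⊗ₜ 1
  free : ∀ a : A, (1 : B) ⊗ₜ[ℂ] a ∈
    Submodule.span ℂ (Set.range fun p : B × B => (p.1 ⊗ₜ[ℂ] (1 : A)) * F p.2)

section GradedTensor

open scoped DirectSum

variable {A : Type*} [Ring A] [HopfAlgebra ℂ A] [StarRing A] (Γ : BicovariantCalculus A)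
variable {Ω : Type*} [Ring Ω] [Algebra ℂ Ω] (gr : ℕ → Submodule ℂ Ω) [GradedAlgebra gr]

/-- The graded tensor product `Ω ⊗̂ Γ^∧`. -/
abbrev GT : Type _ := GradedTensorProduct ℂ gr Γ.envGrading

/-- The differential `w ⊗ α ↦ dw ⊗ α + (-1)^∂w w ⊗ dα` of the graded tensor product of `(Ω, d)`
and `Γ^∧`. -/
def dGT (d : Ω →ₗ[ℂ] Ω) : GT Γ gr →ₗ[ℂ] GT Γ gr :=
  (GradedTensorProduct.of ℂ gr Γ.envGrading).toLinearMap
    ∘ₗ (TensorProduct.map d LinearMap.id + TensorProduct.map (gradeInv gr) Γ.dEnv)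
    ∘ₗ (GradedTensorProduct.of ℂ gr Γ.envGrading).symm.toLinearMap

lemma units_smul {M : Type*} [AddCommGroup M] [Module ℂ M] (n : ℕ) (x : M) :
    ((-1 : ℤˣ) ^ n) • x = (-1 : ℂ) ^ n • x := by
  rcases Nat.even_or_odd n with he | ho
  · rw [he.neg_one_pow, he.neg_one_pow, one_smul, one_smul]
  · rw [ho.neg_one_pow, ho.neg_one_pow, neg_smul, one_smul, Units.neg_smul, one_smul]

/-- The product of the graded tensor product. -/
lemma gt_mul {i k : ℕ} (v : Ω) {y : Γ.Env} (hy : y ∈ Γ.envGrading k) {w : Ω} (hw : w ∈ gr i)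
    (z : Γ.Env) :
    (GradedTensorProduct.tmul ℂ v y * GradedTensorProduct.tmul ℂ w z : GT Γ gr) =
      (-1 : ℂ) ^ (k * i) • (GradedTensorProduct.tmul ℂ (v * w) (y * z) : GT Γ gr) :=
  (GradedTensorProduct.tmul_coe_mul_coe_tmul (R := ℂ) gr Γ.envGrading
    v ⟨y, hy⟩ ⟨w, hw⟩ z).trans (units_smul _ _)

/-- The product of the two grading involutions. -/
def invTensor : GT Γ gr →ₐ[ℂ] GT Γ gr :=
  GradedTensorProduct.lift gr Γ.envGrading
    ((GradedTensorProduct.includeLeft gr Γ.envGrading).comp (gradeInvHom gr))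
    ((GradedTensorProduct.includeRight gr Γ.envGrading).comp (gradeInvHom Γ.envGrading))
    (fun i j a b => by
      have h1 : gradeInvHom gr a = (-1 : ℂ) ^ i • (a : Ω) := gradeInv_of_mem gr a.2
      have h2 : gradeInvHom Γ.envGrading b = (-1 : ℂ) ^ j • (b : Γ.Env) :=
        gradeInv_of_mem Γ.envGrading b.2
      rw [units_smul]
      simp only [AlgHom.comp_apply, h1, h2, map_smul, smul_mul_smul_comm]
      have h3 := gt_mul Γ gr 1 b.2 a.2 1
      rw [one_mul, mul_one] at h3
      simp only [GradedTensorProduct.includeLeft_apply, GradedTensorProduct.includeRight_apply]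
      rw [h3, GradedTensorProduct.tmul_one_mul_one_tmul, smul_comm, smul_smul ((-1 : ℂ) ^ (j * i)),
        ← mul_pow]
      simp [mul_comm])

lemma invTensor_of (z : Ω ⊗[ℂ] Γ.Env) : invTensor Γ gr (GradedTensorProduct.of ℂ gr Γ.envGrading z)
    = GradedTensorProduct.of ℂ gr Γ.envGrading
      (TensorProduct.map (gradeInv gr) (gradeInv Γ.envGrading) z) := by
  induction z with
  | zero => simp
  | add x y hx hy => simp only [map_add, hx, hy]
  | tmul x y =>
    exact GradedTensorProduct.tmul_one_mul_one_tmul gr Γ.envGrading _ _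

/-- The inclusion `Ω ⊗ A → Ω ⊗̂ Γ^∧`. -/
def incTensor : Ω ⊗[ℂ] A →ₐ[ℂ] GT Γ gr :=
  Algebra.TensorProduct.lift (GradedTensorProduct.includeLeft gr Γ.envGrading)
    ((GradedTensorProduct.includeRight gr Γ.envGrading).comp Γ.incA) (fun w a => by
      induction w using DirectSum.Decomposition.inductionOn gr with
      | zero => rw [map_zero]; exact Commute.zero_left _
      | add x y hx hy => rw [map_add]; exact hx.add_left hy
      | @homogeneous i x =>
        have h3 := gt_mul Γ gr 1 (Γ.incA_mem a) x.2 1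
        rw [one_mul, mul_one, zero_mul, pow_zero, one_smul] at h3
        exact (GradedTensorProduct.tmul_one_mul_one_tmul gr Γ.envGrading _ _).trans h3.symm)

lemma incTensor_eq (z : Ω ⊗[ℂ] A) : incTensor Γ gr z =
    GradedTensorProduct.of ℂ gr Γ.envGrading (Γ.incA.toLinearMap.lTensor Ω z) := by
  induction z with
  | zero => simp
  | add x y hx hy => simp only [map_add, hx, hy]
  | tmul x y => exact GradedTensorProduct.tmul_one_mul_one_tmul gr Γ.envGrading _ _

/-- The projection `id ⊗ p_* : Ω ⊗̂ Γ^∧ → Ω ⊗ A`. -/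
def projTensor : GT Γ gr →ₐ[ℂ] Ω ⊗[ℂ] A :=
  GradedTensorProduct.lift gr Γ.envGrading Algebra.TensorProduct.includeLeft
    (Algebra.TensorProduct.includeRight.comp Γ.pStar)
    (fun i j a b => by
      rw [units_smul]
      by_cases hj : j = 0
      · subst hj; simp
      · simp [Γ.pStar_eq_zero hj b.2])

lemma projTensor_of (z : Ω ⊗[ℂ] Γ.Env) :
    projTensor Γ gr (GradedTensorProduct.of ℂ gr Γ.envGrading z)
      = Γ.pStar.toLinearMap.lTensor Ω z := by
  induction z with
  | zero => simp
  | add x y hx hy => simp only [map_add, hx, hy]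
  | tmul x y =>
    refine (GradedTensorProduct.lift_tmul gr Γ.envGrading _ _ _ x y).trans ?_
    simp

lemma gradeInv_envCoaction (x : Γ.Env) : (gradeInv Γ.envGrading).rTensor A (Γ.envCoaction x)
    = Γ.envCoaction (gradeInv Γ.envGrading x) := by
  have h : (Algebra.TensorProduct.map (gradeInvHom Γ.envGrading) (AlgHom.id ℂ A)).comp
      Γ.envCoaction = Γ.envCoaction.comp (gradeInvHom Γ.envGrading) := by
    refine Γ.env_hom_ext (fun a => ?_) (fun a => ?_)
    · have h1 : gradeInvHom Γ.envGrading (Γ.incA a) = Γ.incA a :=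
        (gradeInv_of_mem _ (Γ.incA_mem a)).trans (by simp)
      rw [AlgHom.comp_apply, AlgHom.comp_apply, h1, Γ.envCoaction_incA]
      generalize Coalgebra.comul (R := ℂ) a = t
      induction t with
      | zero => simp
      | add x y hx hy => simp only [map_add, hx, hy]
      | tmul x y =>
        have h1 : gradeInvHom Γ.envGrading (Γ.incA x) = Γ.incA x :=
          (gradeInv_of_mem _ (Γ.incA_mem x)).trans (by simp)
        simp [h1]
    · have h1 : ∀ a, gradeInvHom Γ.envGrading (Γ.dA a) = -Γ.dA a := fun a =>
        (gradeInv_of_mem _ (Γ.dA_mem a)).trans (by simp)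
      rw [AlgHom.comp_apply, AlgHom.comp_apply, h1, map_neg, Γ.envCoaction_dA]
      generalize Coalgebra.comul (R := ℂ) a = t
      induction t with
      | zero => simp
      | add x y hx hy => simp only [map_add, hx, hy, neg_add]
      | tmul x y => simp [h1, TensorProduct.neg_tmul]
  exact DFunLike.congr_fun h x

lemma gradeInv_pow {i k : ℕ} {y : Γ.Env} (hy : y ∈ Γ.envGrading k) :
    ((gradeInv Γ.envGrading) ^ i) y = (-1 : ℂ) ^ (k * i) • y := by
  induction i with
  | zero => simp
  | succ i ih =>
    rw [pow_succ', Module.End.mul_apply, ih, map_smul, gradeInv_of_mem _ hy, smul_smul, ← pow_add,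
      Nat.mul_succ]

lemma gradeInv_pow_envCoaction (i : ℕ) (x : Γ.Env) :
    ((gradeInv Γ.envGrading) ^ i).rTensor A (Γ.envCoaction x)
    = Γ.envCoaction (((gradeInv Γ.envGrading) ^ i) x) := by
  induction i with
  | zero => simp [Module.End.one_eq_id]
  | succ i ih =>
    rw [pow_succ', Module.End.mul_eq_comp, LinearMap.rTensor_comp_apply, ih,
      gradeInv_envCoaction]; rfl

/-- The map `id ⊗ ρ : Ω ⊗̂ Γ^∧ → (Ω ⊗̂ Γ^∧) ⊗ A`, with `ρ` the right action on `Γ^∧`. -/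
def coactTensor : GT Γ gr →ₐ[ℂ] GT Γ gr ⊗[ℂ] A :=
  GradedTensorProduct.lift gr Γ.envGrading
    (Algebra.TensorProduct.includeLeft.comp (GradedTensorProduct.includeLeft gr Γ.envGrading))
    ((Algebra.TensorProduct.map (GradedTensorProduct.includeRight gr Γ.envGrading)
      (AlgHom.id ℂ A)).comp Γ.envCoaction)
    (fun i j a b => by
      have key : ∀ t : Γ.Env ⊗[ℂ] A, Algebra.TensorProduct.map
            (GradedTensorProduct.includeRight gr Γ.envGrading) (AlgHom.id ℂ A) t *
          ((GradedTensorProduct.includeLeft gr Γ.envGrading (a : Ω)) ⊗ₜ[ℂ] (1 : A)) =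
          ((GradedTensorProduct.includeLeft gr Γ.envGrading (a : Ω)) ⊗ₜ[ℂ] (1 : A)) *
          Algebra.TensorProduct.map (GradedTensorProduct.includeRight gr Γ.envGrading)
            (AlgHom.id ℂ A) (((gradeInv Γ.envGrading) ^ i).rTensor A t) := by
        intro t
        induction t with
        | zero => simp
        | add x y hx hy => simp only [map_add, add_mul, mul_add, hx, hy]
        | tmul y c =>
          induction y using DirectSum.Decomposition.inductionOn Γ.envGrading with
          | zero => simp
          | add x y hx hy =>
            simp only [map_add, TensorProduct.add_tmul, add_mul, mul_add, hx, hy]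
          | @homogeneous k y =>
            have h3 := gt_mul Γ gr 1 y.2 a.2 1
            rw [one_mul, mul_one] at h3
            simp only [LinearMap.rTensor_tmul, gradeInv_pow Γ y.2,
              Algebra.TensorProduct.map_tmul, Algebra.TensorProduct.tmul_mul_tmul, mul_one,
              one_mul, map_smul, AlgHom.id_apply, GradedTensorProduct.includeLeft_apply,
              GradedTensorProduct.includeRight_apply, mul_smul_comm]
            rw [h3, GradedTensorProduct.tmul_one_mul_one_tmul]
      rw [units_smul, AlgHom.comp_apply, AlgHom.comp_apply]
      refine Eq.trans ?_ (congrArg (fun x => (-1 : ℂ) ^ (j * i) • x) (key _).symm)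
      rw [gradeInv_pow_envCoaction, gradeInv_pow Γ b.2, map_smul, map_smul, mul_smul_comm,
        smul_smul, ← mul_pow]
      simp)

lemma coactTensor_of (z : Ω ⊗[ℂ] Γ.Env) :
    coactTensor Γ gr (GradedTensorProduct.of ℂ gr Γ.envGrading z) =
      (GradedTensorProduct.of ℂ gr Γ.envGrading).toLinearMap.rTensor A
        ((TensorProduct.assoc ℂ Ω Γ.Env A).symm (Γ.envCoaction.toLinearMap.lTensor Ω z)) := by
  induction z with
  | zero => simp
  | add x y hx hy => simp only [map_add, hx, hy]
  | tmul x y =>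
    refine (GradedTensorProduct.lift_tmul gr Γ.envGrading _ _ _ x y).trans ?_
    simp only [AlgHom.comp_apply, LinearMap.lTensor_tmul, AlgHom.toLinearMap_apply]
    generalize Γ.envCoaction y = t
    induction t with
    | zero => simp
    | add x y hx hy => simp only [map_add, TensorProduct.tmul_add, mul_add, hx, hy]
    | tmul p q => simp [GradedTensorProduct.tmul_one_mul_one_tmul]

end GradedTensor

/-- A differential calculus `Ω(P)` on a quantum principal bundle: a graded-differential `*`-algebra
with `Ω⁰(P) = B`, generated by `B`, such that `F` extends to a homomorphism
`F̂ : Ω(P) → Ω(P) ⊗̂ Γ^∧` of graded-differential algebras. (Such an extension is unique, and it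
automatically preserves the degree and the `*`-structure, because `B` generates `Ω(P)`.) -/
structure BundleCalculus {V B A : Type*} [Ring V] [Algebra ℂ V] [StarRing V]
    [Ring B] [Algebra ℂ B] [StarRing B] [StarModule ℂ B]
    [Ring A] [HopfAlgebra ℂ A] [StarRing A] [StarModule ℂ A]
    (P : QuantumPrincipalBundle V B A) (Γ : BicovariantCalculus A)
    {Ω : Type*} [Ring Ω] [Algebra ℂ Ω] (gr : ℕ → Submodule ℂ Ω) [GradedAlgebra gr] where
  inc : B →ₐ[ℂ] Ω
  inc_injective : Function.Injective inc
  range_inc : LinearMap.range inc.toLinearMap = gr 0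
  d : Ω →ₗ[ℂ] Ω
  d_mem : ∀ n, ∀ w ∈ gr n, d w ∈ gr (n + 1)
  d_d : ∀ w, d (d w) = 0
  d_mul : ∀ n, ∀ w ∈ gr n, ∀ v, d (w * v) = d w * v + (-1 : ℂ) ^ n • (w * d v)
  conj : Ω →ₛₗ[starRingEnd ℂ] Ω
  conj_mem : ∀ n, ∀ w ∈ gr n, conj w ∈ gr n
  conj_conj : ∀ w, conj (conj w) = w
  conj_mul : ∀ m n, ∀ w ∈ gr m, ∀ v ∈ gr n, conj (w * v) = (-1 : ℂ) ^ (m * n) • (conj v * conj w)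
  conj_inc : ∀ b, conj (inc b) = inc (star b)
  conj_d : ∀ w, conj (d w) = d (conj w)
  adjoin_eq_top : Algebra.adjoin ℂ (Set.range inc ∪ Set.range fun b => d (inc b)) = ⊤
  Fhat : Ω →ₐ[ℂ] GT Γ gr
  Fhat_inc : ∀ b, Fhat (inc b) = GradedTensorProduct.of ℂ gr Γ.envGrading
    (TensorProduct.map inc.toLinearMap Γ.incA.toLinearMap (P.F b))
  Fhat_d : ∀ w, Fhat (d w) = dGT Γ gr d (Fhat w)

namespace BundleCalculus

variable {V B A : Type*} [Ring V] [Algebra ℂ V] [StarRing V]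
    [Ring B] [Algebra ℂ B] [StarRing B] [StarModule ℂ B]
    [Ring A] [HopfAlgebra ℂ A] [StarRing A] [StarModule ℂ A]
    {P : QuantumPrincipalBundle V B A} {Γ : BicovariantCalculus A}
    {Ω : Type*} [Ring Ω] [Algebra ℂ Ω] {gr : ℕ → Submodule ℂ Ω} [GradedAlgebra gr]
    (C : BundleCalculus P Γ gr)

/-- `F̂` with values in the underlying space `Ω(P) ⊗ Γ^∧`. -/
def FhatLin : Ω →ₗ[ℂ] Ω ⊗[ℂ] Γ.Env :=
  (GradedTensorProduct.of ℂ gr Γ.envGrading).symm.toLinearMap ∘ₗ C.Fhat.toLinearMap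

/-- The right action `F^∧ = (id ⊗ p_*) F̂ : Ω(P) → Ω(P) ⊗ A`. -/
def Fwedge : Ω →ₗ[ℂ] Ω ⊗[ℂ] A := Γ.pStar.toLinearMap.lTensor Ω ∘ₗ C.FhatLin

lemma Fhat_eq (w : Ω) : C.Fhat w = GradedTensorProduct.of ℂ gr Γ.envGrading (C.FhatLin w) := rfl

lemma mem_range_iff (w : Ω) : C.FhatLin w ∈ LinearMap.range (Γ.incA.toLinearMap.lTensor Ω) ↔
    C.Fhat w ∈ (incTensor Γ gr).range := by
  constructor
  · rintro ⟨z, hz⟩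
    exact ⟨z, by rw [Fhat_eq, ← hz]; exact incTensor_eq Γ gr z⟩
  · rintro ⟨z, hz⟩
    refine ⟨z, (GradedTensorProduct.of ℂ gr Γ.envGrading).injective ?_⟩
    rw [← Fhat_eq, ← hz]
    exact (incTensor_eq Γ gr z).symm

/-- The algebra of horizontal forms, `hor(P) = F̂⁻¹(Ω(P) ⊗ A)`. -/
def hor : Subalgebra ℂ Ω where
  carrier := {w | C.FhatLin w ∈ LinearMap.range (Γ.incA.toLinearMap.lTensor Ω)}
  mul_mem' := by
    intro w v hw hv
    rw [Set.mem_ofPred_eq, mem_range_iff] at *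
    rw [map_mul]
    exact mul_mem hw hv
  add_mem' := by
    intro w v hw hv
    rw [Set.mem_ofPred_eq, mem_range_iff] at *
    rw [map_add]
    exact add_mem hw hv
  algebraMap_mem' := by
    intro r
    rw [Set.mem_ofPred_eq, mem_range_iff, AlgHom.commutes]
    exact Subalgebra.algebraMap_mem _ r

lemma mem_hor {w : Ω} :
    w ∈ C.hor ↔ C.FhatLin w ∈ LinearMap.range (Γ.incA.toLinearMap.lTensor Ω) := Iff.rfl

lemma FhatLin_inc (b : B) :
    C.FhatLin (C.inc b) = TensorProduct.map C.inc.toLinearMap Γ.incA.toLinearMap (P.F b) := by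
  apply (GradedTensorProduct.of ℂ gr Γ.envGrading).injective
  rw [← Fhat_eq, Fhat_inc]

lemma gradeInv_inc (b : B) : gradeInv gr (C.inc b) = C.inc b := by
  have h : C.inc b ∈ gr 0 := C.range_inc ▸ ⟨b, rfl⟩
  rw [gradeInv_of_mem gr h, pow_zero, one_smul]

lemma gradeInv_d_inc (b : B) : gradeInv gr (C.d (C.inc b)) = -C.d (C.inc b) := by
  have h : C.inc b ∈ gr 0 := C.range_inc ▸ ⟨b, rfl⟩
  rw [gradeInv_of_mem gr (C.d_mem 0 _ h), zero_add, pow_one, neg_smul, one_smul]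

lemma FhatLin_d_inc (b : B) :
    C.FhatLin (C.d (C.inc b)) =
      TensorProduct.map (C.d ∘ₗ C.inc.toLinearMap) Γ.incA.toLinearMap (P.F b)
      + TensorProduct.map C.inc.toLinearMap Γ.dA (P.F b) := by
  apply (GradedTensorProduct.of ℂ gr Γ.envGrading).injective
  rw [← Fhat_eq, Fhat_d, Fhat_eq, FhatLin_inc]
  simp only [dGT, LinearMap.comp_apply, LinearEquiv.coe_coe, LinearEquiv.symm_apply_apply,
    LinearMap.add_apply]
  congr 1
  generalize P.F b = t
  induction t with
  | zero => simp
  | add x y hx hy =>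
    simp only [map_add] at *
    rw [add_add_add_comm, hx, hy]; abel
  | tmul x y => simp [gradeInv_inc, Γ.dEnv_incA]

lemma hom_ext {D : Type*} [Semiring D] [Algebra ℂ D] {f g : Ω →ₐ[ℂ] D}
    (h0 : ∀ b, f (C.inc b) = g (C.inc b)) (h1 : ∀ b, f (C.d (C.inc b)) = g (C.d (C.inc b))) :
    f = g := by
  refine AlgHom.ext_of_adjoin_eq_top C.adjoin_eq_top ?_
  rintro _ (⟨a, rfl⟩ | ⟨a, rfl⟩)
  · exact h0 a
  · exact h1 a

/-- `F̂` commutes with the grading involutions. -/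
lemma FhatLin_gradeInv (w : Ω) : C.FhatLin (gradeInv gr w) =
    TensorProduct.map (gradeInv gr) (gradeInv Γ.envGrading) (C.FhatLin w) := by
  have h0 : ∀ a, gradeInv Γ.envGrading (Γ.incA a) = Γ.incA a := fun a =>
    (gradeInv_of_mem _ (Γ.incA_mem a)).trans (by simp)
  have h1 : ∀ a, gradeInv Γ.envGrading (Γ.dA a) = -Γ.dA a := fun a =>
    (gradeInv_of_mem _ (Γ.dA_mem a)).trans (by simp)
  have h : C.Fhat.comp (gradeInvHom gr) = (invTensor Γ gr).comp C.Fhat := by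
    refine C.hom_ext (fun b => ?_) (fun b => ?_)
    · have e : gradeInvHom gr (C.inc b) = C.inc b := C.gradeInv_inc b
      rw [AlgHom.comp_apply, AlgHom.comp_apply, e, Fhat_eq, invTensor_of, FhatLin_inc]
      congr 1
      generalize P.F b = t
      induction t with
      | zero => simp
      | add x y hx hy => simp only [map_add, ← hx, ← hy]
      | tmul x y => simp [gradeInv_inc, h0]
    · have e : gradeInvHom gr (C.d (C.inc b)) = -C.d (C.inc b) := C.gradeInv_d_inc b
      rw [AlgHom.comp_apply, AlgHom.comp_apply, e, map_neg, Fhat_eq, invTensor_of, FhatLin_d_inc,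
        ← map_neg]
      congr 1
      generalize P.F b = t
      induction t with
      | zero => simp
      | add x y hx hy =>
        simp only [map_add] at *
        rw [add_add_add_comm, neg_add, hx, hy]; abel
      | tmul x y =>
        simp [gradeInv_inc, gradeInv_d_inc, h0, h1, TensorProduct.neg_tmul,
          TensorProduct.tmul_neg, add_comm]
  have h2 := DFunLike.congr_fun h w
  rw [AlgHom.comp_apply, AlgHom.comp_apply, Fhat_eq, Fhat_eq, invTensor_of] at h2
  exact (GradedTensorProduct.of ℂ gr Γ.envGrading).injective h2

lemma Fwedge_eq (w : Ω) : C.Fwedge w = projTensor Γ gr (C.Fhat w) := by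
  rw [Fhat_eq, projTensor_of]; rfl

/-- `(F̂ ⊗ id) F^∧ = (id ⊗ ρ) F̂`, with `ρ` the right action on `Γ^∧`. -/
lemma FhatLin_coassoc (w : Ω) : TensorProduct.assoc ℂ Ω Γ.Env A
      (C.FhatLin.rTensor A (C.Fwedge w))
    = Γ.envCoaction.toLinearMap.lTensor Ω (C.FhatLin w) := by
  have h : (Algebra.TensorProduct.map C.Fhat (AlgHom.id ℂ A)).comp
      ((projTensor Γ gr).comp C.Fhat) = (coactTensor Γ gr).comp C.Fhat := by
    have gen : ∀ (f : B →ₗ[ℂ] Ω) (L : B ⊗[ℂ] A →ₗ[ℂ] Ω ⊗[ℂ] Γ.Env)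
        (hf : ∀ b, C.FhatLin (f b) = L (P.F b))
        (hL : ∀ t, Γ.pStar.toLinearMap.lTensor Ω (L t) = f.rTensor A t)
        (hc : ∀ x a, Γ.envCoaction.toLinearMap.lTensor Ω (L (x ⊗ₜ a)) = TensorProduct.assoc ℂ _ _ _
          (L.rTensor A ((TensorProduct.assoc ℂ B A A).symm (x ⊗ₜ Coalgebra.comul (R := ℂ) a))))
        (b : B), Algebra.TensorProduct.map C.Fhat (AlgHom.id ℂ A)
          (projTensor Γ gr (C.Fhat (f b))) = coactTensor Γ gr (C.Fhat (f b)) := by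
      intro f L hf hL hc b
      rw [Fhat_eq, projTensor_of, coactTensor_of, hf, hL]
      have e1 : ∀ t : B ⊗[ℂ] A, Algebra.TensorProduct.map C.Fhat (AlgHom.id ℂ A) (f.rTensor A t)
          = (GradedTensorProduct.of ℂ gr Γ.envGrading).toLinearMap.rTensor A
            (L.rTensor A (P.F.toAlgHom.toLinearMap.rTensor A t)) := by
        intro t
        induction t with
        | zero => simp
        | add x y hx hy => simp only [map_add, hx, hy]
        | tmul x y => simp [Fhat_eq, hf]
      have e2 : ∀ t : B ⊗[ℂ] A, Γ.envCoaction.toLinearMap.lTensor Ω (L t) =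
          TensorProduct.assoc ℂ _ _ _ (L.rTensor A ((TensorProduct.assoc ℂ B A A).symm
            ((Coalgebra.comul (R := ℂ)).lTensor B t))) := by
        intro t
        induction t with
        | zero => simp
        | add x y hx hy => simp only [map_add, hx, hy]
        | tmul x y => exact hc x y
      rw [e1, e2, ← P.coassoc, LinearEquiv.symm_apply_apply, LinearEquiv.symm_apply_apply]
    refine C.hom_ext (fun b => ?_) (fun b => ?_)
    · refine gen C.inc.toLinearMap (TensorProduct.map C.inc.toLinearMap Γ.incA.toLinearMap)
        C.FhatLin_inc (fun t => ?_) (fun x a => ?_) b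
      · induction t with
        | zero => simp
        | add x y hx hy => simp only [map_add, hx, hy]
        | tmul x y => simp [Γ.pStar_incA]
      · rw [TensorProduct.map_tmul, LinearMap.lTensor_tmul, AlgHom.toLinearMap_apply,
          AlgHom.toLinearMap_apply, AlgHom.toLinearMap_apply, Γ.envCoaction_incA]
        generalize Coalgebra.comul (R := ℂ) a = t
        induction t with
        | zero => simp
        | add x y hx hy => simp only [map_add, TensorProduct.tmul_add, hx, hy]
        | tmul x y => simp
    · refine gen (C.d ∘ₗ C.inc.toLinearMap)
        (TensorProduct.map (C.d ∘ₗ C.inc.toLinearMap) Γ.incA.toLinearMap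
          + TensorProduct.map C.inc.toLinearMap Γ.dA)
        C.FhatLin_d_inc (fun t => ?_) (fun x a => ?_) b
      · induction t with
        | zero => simp
        | add x y hx hy => simp only [map_add, hx, hy]
        | tmul x y => simp [Γ.pStar_incA, Γ.pStar_dA]
      · rw [LinearMap.add_apply, TensorProduct.map_tmul, TensorProduct.map_tmul, map_add,
          LinearMap.lTensor_tmul, LinearMap.lTensor_tmul, AlgHom.toLinearMap_apply,
          AlgHom.toLinearMap_apply, AlgHom.toLinearMap_apply, AlgHom.toLinearMap_apply,
          Γ.envCoaction_incA, Γ.envCoaction_dA]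
        generalize Coalgebra.comul (R := ℂ) a = t
        induction t with
        | zero => simp
        | add x y hx hy =>
          simp only [map_add, TensorProduct.tmul_add] at *
          rw [add_add_add_comm, hx, hy]
        | tmul x y => simp
  have h2 := DFunLike.congr_fun h w
  rw [AlgHom.comp_apply, AlgHom.comp_apply, AlgHom.comp_apply, ← Fwedge_eq, Fhat_eq,
    coactTensor_of] at h2
  have h3 : ∀ z : Ω ⊗[ℂ] A, Algebra.TensorProduct.map C.Fhat (AlgHom.id ℂ A) z =
      (GradedTensorProduct.of ℂ gr Γ.envGrading).toLinearMap.rTensor A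
        (C.FhatLin.rTensor A z) := by
    intro z
    induction z with
    | zero => simp
    | add x y hx hy => simp only [map_add, hx, hy]
    | tmul x y => simp [Fhat_eq]
  rw [h3] at h2
  have h4 : Function.Injective
      ((GradedTensorProduct.of ℂ gr Γ.envGrading).toLinearMap.rTensor A) :=
    ((GradedTensorProduct.of ℂ gr Γ.envGrading).rTensor A).injective
  rw [h4 h2, LinearEquiv.apply_symm_apply]

lemma gradeInv_mem_hor {w : Ω} (hw : w ∈ C.hor) : gradeInv gr w ∈ C.hor := by
  rw [mem_hor] at *
  obtain ⟨z, hz⟩ := hw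
  rw [FhatLin_gradeInv, ← hz]
  refine ⟨(gradeInv gr).rTensor A z, ?_⟩
  have h0 : ∀ a, gradeInv Γ.envGrading (Γ.incA a) = Γ.incA a := fun a =>
    (gradeInv_of_mem _ (Γ.incA_mem a)).trans (by simp)
  clear hz
  induction z with
  | zero => simp
  | add x y hx hy => simp only [map_add, hx, hy]
  | tmul x y => simp [h0]

lemma Fwedge_mem_hor {w : Ω} (hw : w ∈ C.hor) :
    C.Fwedge w ∈ LinearMap.range (C.hor.val.toLinearMap.rTensor A) := by
  let q := (LinearMap.range (Γ.incA.toLinearMap.lTensor Ω)).mkQ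
  have hex : Function.Exact C.hor.val.toLinearMap (q ∘ₗ C.FhatLin) := by
    intro v
    rw [LinearMap.comp_apply, Submodule.mkQ_apply, Submodule.Quotient.mk_eq_zero, ← mem_hor]
    exact ⟨fun h => ⟨⟨v, h⟩, rfl⟩, fun ⟨u, hu⟩ => hu ▸ u.2⟩
  refine (Module.Flat.rTensor_exact A hex _).1 ?_
  obtain ⟨z, hz⟩ := hw
  have h1 : C.Fwedge w = z := by
    rw [Fwedge, LinearMap.comp_apply, ← hz, ← LinearMap.lTensor_comp_apply]
    have : Γ.pStar.toLinearMap ∘ₗ Γ.incA.toLinearMap = LinearMap.id :=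
      LinearMap.ext Γ.pStar_incA
    rw [this, LinearMap.lTensor_id, LinearMap.id_apply]
  have h2 := C.FhatLin_coassoc w
  have h3 : ∀ z : Ω ⊗[ℂ] A, Γ.envCoaction.toLinearMap.lTensor Ω (Γ.incA.toLinearMap.lTensor Ω z) =
      TensorProduct.assoc ℂ _ _ _ ((Γ.incA.toLinearMap.lTensor Ω).rTensor A
        ((TensorProduct.assoc ℂ Ω A A).symm ((Coalgebra.comul (R := ℂ)).lTensor Ω z))) := by
    intro z
    induction z with
    | zero => simp
    | add x y hx hy => simp only [map_add, hx, hy]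
    | tmul x a =>
      simp only [LinearMap.lTensor_tmul, AlgHom.toLinearMap_apply, Γ.envCoaction_incA]
      generalize Coalgebra.comul (R := ℂ) a = t
      induction t with
      | zero => simp
      | add x y hx hy => simp only [map_add, TensorProduct.tmul_add, hx, hy]
      | tmul x y => simp
  rw [← hz, h3] at h2
  have h4 := (TensorProduct.assoc ℂ Ω Γ.Env A).injective h2
  rw [LinearMap.rTensor_comp_apply, h4, ← LinearMap.rTensor_comp_apply]
  have h5 : q ∘ₗ Γ.incA.toLinearMap.lTensor Ω = 0 :=
    LinearMap.range_mkQ_comp _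
  rw [h5, LinearMap.rTensor_zero, LinearMap.zero_apply]
end BundleCalculus

/-! ## Vertically-horizontally decomposed forms -/

section PiMul

variable {A : Type*} [Ring A] [HopfAlgebra ℂ A] [StarRing A] (Γ : BicovariantCalculus A)
variable {X : Type*} [AddCommGroup X] [Module ℂ X]

/-- The map `x ⊗ η ↦ ∑ xₖ ⊗ π(cₖ) η` on `X ⊗ Γ_inv^∧`, where `δ(x) = ∑ xₖ ⊗ cₖ`. -/
def piMul (δ : X →ₗ[ℂ] X ⊗[ℂ] A) : X ⊗[ℂ] Γ.InvExt →ₗ[ℂ] X ⊗[ℂ] Γ.InvExt :=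
  (LinearMap.mul' ℂ Γ.InvExt ∘ₗ (Γ.inc ∘ₗ Γ.pi).rTensor Γ.InvExt).lTensor X
    ∘ₗ (TensorProduct.assoc ℂ X A Γ.InvExt).toLinearMap ∘ₗ δ.rTensor Γ.InvExt

lemma piMul_tmul (δ : X →ₗ[ℂ] X ⊗[ℂ] A) (x : X) (η : Γ.InvExt) :
    piMul Γ δ (x ⊗ₜ η) =
      TensorProduct.map LinearMap.id (LinearMap.mulRight ℂ η ∘ₗ Γ.inc ∘ₗ Γ.pi) (δ x) := by
  simp only [piMul, LinearMap.comp_apply, LinearMap.rTensor_tmul, LinearEquiv.coe_coe]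
  generalize δ x = t
  induction t with
  | zero => simp
  | add x y hx hy => simp only [map_add, TensorProduct.add_tmul, hx, hy]
  | tmul x y => simp

/-- The space `Λ_u = H_u ⊗ Γ_inv^∧`. -/
abbrev Lam [StarModule ℂ A] {n : ℕ} (_u : UnitaryRep A n) : Type _ :=
  (Fin n → ℂ) ⊗[ℂ] Γ.InvExt

/-- The differential `d_u(e i ⊗ η) = e i ⊗ dη + ∑ j, e j ⊗ π(u j i) η` of `Λ_u`. -/
def dLam [StarModule ℂ A] {n : ℕ} (u : UnitaryRep A n) : Lam Γ u →ₗ[ℂ] Lam Γ u :=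
  Γ.dInv.lTensor (Fin n → ℂ) + piMul Γ u.coaction

end PiMul

/-- A complex `(X, d)` is acyclic if all its cohomology vanishes: `ker d = im d`. (For a graded
space and a differential of degree one this means exactness in each degree.) -/
def IsAcyclic {X : Type*} [AddCommGroup X] [Module ℂ X] (d : X →ₗ[ℂ] X) : Prop :=
  LinearMap.ker d = LinearMap.range d

namespace BundleCalculus

variable {V B A : Type*} [Ring V] [Algebra ℂ V] [StarRing V]
    [Ring B] [Algebra ℂ B] [StarRing B] [StarModule ℂ B]
    [Ring A] [HopfAlgebra ℂ A] [StarRing A] [StarModule ℂ A]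
    {P : QuantumPrincipalBundle V B A} {Γ : BicovariantCalculus A}
    {Ω : Type*} [Ring Ω] [Algebra ℂ Ω] {gr : ℕ → Submodule ℂ Ω} [GradedAlgebra gr]
    (C : BundleCalculus P Γ gr)

lemma horInc_injective : Function.Injective (C.hor.val.toLinearMap.rTensor A) :=
  Module.Flat.rTensor_preserves_injective_linearMap _ Subtype.val_injective

/-- The restriction `hor(P) → hor(P) ⊗ A` of the right action `F^∧` to horizontal forms. -/
def horCoaction : C.hor →ₗ[ℂ] C.hor ⊗[ℂ] A :=
  (LinearEquiv.ofInjective _ C.horInc_injective).symm.toLinearMap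
    ∘ₗ (C.Fwedge ∘ₗ C.hor.val.toLinearMap).codRestrict _ fun w => C.Fwedge_mem_hor w.2

lemma horCoaction_coe (w : C.hor) :
    C.hor.val.toLinearMap.rTensor A (C.horCoaction w) = C.Fwedge w :=
  congrArg Subtype.val ((LinearEquiv.ofInjective _ C.horInc_injective).apply_symm_apply
    ⟨C.Fwedge w, C.Fwedge_mem_hor w.2⟩)

/-- The map `φ ↦ (-1)^∂φ φ` on `hor(P)`. -/
def horInv : C.hor →ₗ[ℂ] C.hor :=
  (gradeInv gr ∘ₗ C.hor.val.toLinearMap).codRestrict (Subalgebra.toSubmodule C.hor)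
    fun w => C.gradeInv_mem_hor w.2

lemma horInv_of_mem {n : ℕ} {w : C.hor} (hw : (w : Ω) ∈ gr n) :
    C.horInv w = (-1 : ℂ) ^ n • w :=
  Subtype.ext (gradeInv_of_mem gr hw)

/-- The space `vh(P) = hor(P) ⊗ Γ_inv^∧` of vertically-horizontally decomposed forms. -/
abbrev vh : Type _ := C.hor ⊗[ℂ] Γ.InvExt

/-- The differential of `vh(P)`,
`d_vh(φ ⊗ ϑ) = (-1)^∂φ ∑ φₖ ⊗ π(cₖ) ϑ + (-1)^∂φ φ ⊗ dϑ`, where `F^∧(φ) = ∑ φₖ ⊗ cₖ`. -/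
def dvh : C.vh →ₗ[ℂ] C.vh :=
  (piMul Γ C.horCoaction + Γ.dInv.lTensor C.hor) ∘ₗ C.horInv.rTensor Γ.InvExt

/-- Tensorial forms of degree `p`: linear maps `λ : Γ_inv → Ω(P)` with values in the horizontal
forms of degree `p` that intertwine `ϖ` and `F^∧`. -/
structure TensorialForm (p : ℕ) where
  toFun : Γ.Inv →ₗ[ℂ] Ω
  mem_hor : ∀ x, toFun x ∈ C.hor
  mem_degree : ∀ x, toFun x ∈ gr p
  intertwines : ∀ x, C.Fwedge (toFun x) = toFun.rTensor A (Γ.varpi x)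

namespace TensorialForm

variable {C} {p : ℕ} (lam : C.TensorialForm p)

/-- `λ` as a map into `hor(P)`. -/
def toHor : Γ.Inv →ₗ[ℂ] C.hor :=
  lam.toFun.codRestrict (Subalgebra.toSubmodule C.hor) lam.mem_hor

/-- The operator `S_λ(φ ⊗ ϑ) = ∑ φₖ λπ(cₖ) ⊗ ϑ`, where `F^∧(φ) = ∑ φₖ ⊗ cₖ`. -/
def S : C.vh →ₗ[ℂ] C.vh :=
  (LinearMap.mul' ℂ C.hor ∘ₗ (lam.toHor ∘ₗ Γ.pi).lTensor C.hor ∘ₗ C.horCoaction).rTensor Γ.InvExt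

/-- The summand `∑ₗ φ λ(ϑᵢₗ) ⊗ ({ϑ₁ ⋯ ϑᵢ₋₁} ∘ cᵢₗ) {ϑᵢ₊₁ ⋯ ϑₙ}`, where
`ϖ(ϑᵢ) = ∑ₗ ϑᵢₗ ⊗ cᵢₗ`; here the product `ϑ₁ ⋯ ϑₙ` is given by a list, and the index `i` starts
at zero. -/
def termT (φ : C.hor) (l : List Γ.Inv) (i : Fin l.length) : C.vh :=
  TensorProduct.map (LinearMap.mulLeft ℂ φ ∘ₗ lam.toHor)
    (LinearMap.mulRight ℂ (Γ.word (l.drop (i + 1))) ∘ₗ Γ.act (Γ.word (l.take i)))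
    (Γ.varpi (l.get i))

/-- The defining property of `T_λ`: for all `φ ∈ hor(P)` and all `ϑ₁, …, ϑₙ ∈ Γ_inv`,
`T_λ(φ ⊗ ϑ₁ ⋯ ϑₙ)` is `(-1)^∂φ φ` times the sum over `i` of
`(-1)^(i - 1) λ(ϑᵢₗ) ⊗ ({ϑ₁ ⋯ ϑᵢ₋₁} ∘ cᵢₗ) {ϑᵢ₊₁ ⋯ ϑₙ}`. -/
def IsT (T : C.vh →ₗ[ℂ] C.vh) : Prop :=
  ∀ (φ : C.hor) (l : List Γ.Inv), T (φ ⊗ₜ Γ.word l) =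
    ∑ i : Fin l.length, (-1 : ℂ) ^ (i : ℕ) • lam.termT (C.horInv φ) l i

end TensorialForm

end BundleCalculus

end

end QPB

open QPB

/-!
Because of the relations `∑ π(a₁) ⊗ π(a₂)`, `a ∈ R`, the algebra `Γ_inv^∧` carries a braided
antiderivation `t : Γ_inv^∧ → Γ_inv ⊗ Γ_inv^∧` with `t(ϑ) = ϑ ⊗ 1` and `t(ϑ η) = ϑ ⊗ η - ϑ t(η)`,
where `Γ_inv^∧` acts on `Γ_inv ⊗ Γ_inv^∧` through `ϖ` and `∘`. It anticommutes with the
differentials. Hence, for every coaction `δ(x) = ∑ xₖ ⊗ cₖ` on a space `X`, the contraction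
`x ⊗ η ↦ x ⊗ t(η)` is a homotopy between zero and `x ⊗ η ↦ ∑ (xₖ ⊗ π(cₖ)) ⊗ η`.

Composed with the comodule map `φ ⊗ ϑ ↦ φ λ(ϑ)` on `hor(P) ⊗ Γ_inv`, this homotopy is `T_λ` up to
the sign `(-1)^∂φ`, and the null-homotopic map becomes `S_λ`. On `H_u` the comodule map
`x ↦ ∑ xₖ ⊗ π(cₖ)` is injective if `u` is irreducible and `π(u) ≠ 0`. Since `A` is cosemisimple, it
has an equivariant retraction, and composing with this retraction turns the homotopy into a
contraction of `Λ_u`.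
-/

namespace QPB

noncomputable section

open WithConv

/-! ## Coactions and convolution -/

section Coaction

variable {R A X Y Z E : Type*} [CommSemiring R] [AddCommMonoid A] [Module R A]
  [AddCommMonoid X] [Module R X] [AddCommMonoid Y] [Module R Y] [AddCommMonoid Z] [Module R Z]
  [Semiring E] [Algebra R E]

/-- The linear map `f` intertwines the coactions `δ` and `ε`: `ε f = (f ⊗ id) δ`. -/
def Intertwines (δ : X →ₗ[R] X ⊗[R] A) (ε : Y →ₗ[R] Y ⊗[R] A) (f : X →ₗ[R] Y) : Prop :=
  ∀ x, ε (f x) = f.rTensor A (δ x)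

lemma Intertwines.comp {δ : X →ₗ[R] X ⊗[R] A} {ε : Y →ₗ[R] Y ⊗[R] A} {ζ : Z →ₗ[R] Z ⊗[R] A}
    {g : Y →ₗ[R] Z} {f : X →ₗ[R] Y} (hg : Intertwines ε ζ g) (hf : Intertwines δ ε f) :
    Intertwines δ ζ (g ∘ₗ f) := fun x => by
  rw [LinearMap.comp_apply, hg, hf, LinearMap.rTensor_comp_apply]

/-- A linear map `ψ : A → E` into an algebra acts on `X ⊗ E` through the coaction `δ` of `A` on `X`
by `x ⊗ ζ ↦ ∑ xₖ ⊗ ψ(cₖ) ζ`, where `δ(x) = ∑ xₖ ⊗ cₖ`. -/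
def convAct (δ : X →ₗ[R] X ⊗[R] A) :
    WithConv (A →ₗ[R] E) →ₗ[R] Module.End R (X ⊗[R] E) where
  toFun ψ := (LinearMap.mul' R E ∘ₗ ψ.ofConv.rTensor E).lTensor X
    ∘ₗ (TensorProduct.assoc R X A E).toLinearMap ∘ₗ δ.rTensor E
  map_add' ψ χ := by
    simp only [ofConv_add, LinearMap.rTensor_add, LinearMap.comp_add, LinearMap.lTensor_add,
      LinearMap.add_comp]
  map_smul' c ψ := by
    simp only [ofConv_smul, LinearMap.rTensor_smul, LinearMap.comp_smul, LinearMap.lTensor_smul,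
      LinearMap.smul_comp, RingHom.id_apply]

lemma convAct_tmul (δ : X →ₗ[R] X ⊗[R] A) (ψ : WithConv (A →ₗ[R] E)) (x : X) (ζ : E) :
    convAct δ ψ (x ⊗ₜ ζ) = (LinearMap.mulRight R ζ ∘ₗ ψ.ofConv).lTensor X (δ x) := by
  simp only [convAct, LinearMap.coe_mk, AddHom.coe_mk, LinearMap.comp_apply,
    LinearMap.rTensor_tmul, LinearEquiv.coe_coe]
  generalize δ x = t
  induction t with
  | zero => simp
  | add x y hx hy => simp only [map_add, TensorProduct.add_tmul, hx, hy]
  | tmul x y => simp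

lemma lTensor_rTensor_comm {B : Type*} [AddCommMonoid B] [Module R B] (f : X →ₗ[R] Y)
    (g : A →ₗ[R] B) (t : X ⊗[R] A) :
    g.lTensor Y (f.rTensor A t) = f.rTensor B (g.lTensor X t) := by
  rw [← LinearMap.comp_apply, LinearMap.lTensor_comp_rTensor, ← LinearMap.comp_apply,
    LinearMap.rTensor_comp_lTensor]

lemma rid_rTensor (f : X →ₗ[R] Y) (t : X ⊗[R] R) :
    TensorProduct.rid R Y (f.rTensor R t) = f (TensorProduct.rid R X t) :=
  DFunLike.congr_fun (TensorProduct.ext' fun _ _ => by simp :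
    (TensorProduct.rid R Y).toLinearMap ∘ₗ f.rTensor R
      = f ∘ₗ (TensorProduct.rid R X).toLinearMap) t

lemma assoc_rTensor_rTensor (f : X →ₗ[R] Y) (t : (X ⊗[R] A) ⊗[R] A) :
    TensorProduct.assoc R Y A A ((f.rTensor A).rTensor A t)
      = f.rTensor (A ⊗[R] A) (TensorProduct.assoc R X A A t) :=
  DFunLike.congr_fun (TensorProduct.ext_threefold fun _ _ _ => rfl :
    (TensorProduct.assoc R Y A A).toLinearMap ∘ₗ (f.rTensor A).rTensor A
      = f.rTensor (A ⊗[R] A) ∘ₗ (TensorProduct.assoc R X A A).toLinearMap) t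

lemma Intertwines.convAct_rTensor {δ : X →ₗ[R] X ⊗[R] A} {ε : Y →ₗ[R] Y ⊗[R] A} {f : X →ₗ[R] Y}
    (hf : Intertwines δ ε f) (ψ : WithConv (A →ₗ[R] E)) :
    convAct ε ψ ∘ₗ f.rTensor E = f.rTensor E ∘ₗ convAct δ ψ :=
  TensorProduct.ext' fun x ζ => by
    simp only [LinearMap.comp_apply, LinearMap.rTensor_tmul, convAct_tmul, hf x,
      lTensor_rTensor_comm]

variable [Coalgebra R A]

/-- Coassociativity `(δ ⊗ id) δ = (id ⊗ φ) δ` of a right coaction `δ : X → X ⊗ A`. -/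
def IsCoassociative (δ : X →ₗ[R] X ⊗[R] A) : Prop :=
  ∀ x, TensorProduct.assoc R X A A (δ.rTensor A (δ x)) = Coalgebra.comul.lTensor X (δ x)

/-- The counit law `(id ⊗ ε) δ = id` of a right coaction `δ : X → X ⊗ A`. -/
def IsCounital (δ : X →ₗ[R] X ⊗[R] A) : Prop :=
  ∀ x, TensorProduct.rid R X ((Coalgebra.counit (R := R)).lTensor X (δ x)) = x

lemma IsCoassociative.of_surjective {δ : X →ₗ[R] X ⊗[R] A} {ε : Y →ₗ[R] Y ⊗[R] A} {f : X →ₗ[R] Y}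
    (hδ : IsCoassociative δ) (hf : Intertwines δ ε f) (hs : Function.Surjective f) :
    IsCoassociative ε := fun y => by
  obtain ⟨x, rfl⟩ := hs y
  have hcomp : ε ∘ₗ f = f.rTensor A ∘ₗ δ := LinearMap.ext hf
  rw [hf, ← LinearMap.rTensor_comp_apply, hcomp, LinearMap.rTensor_comp_apply,
    assoc_rTensor_rTensor, hδ, lTensor_rTensor_comm]

lemma IsCounital.rid_lTensor_counit {δ : X →ₗ[R] X ⊗[R] A} {ε : Y →ₗ[R] Y ⊗[R] A}
    {f : X →ₗ[R] Y} (hδ : IsCounital δ) (hf : Intertwines δ ε f) (x : X) :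
    TensorProduct.rid R Y ((Coalgebra.counit (R := R)).lTensor Y (ε (f x))) = f x := by
  rw [hf, lTensor_rTensor_comm, rid_rTensor, hδ]

lemma IsCounital.of_surjective {δ : X →ₗ[R] X ⊗[R] A} {ε : Y →ₗ[R] Y ⊗[R] A} {f : X →ₗ[R] Y}
    (hδ : IsCounital δ) (hf : Intertwines δ ε f) (hs : Function.Surjective f) :
    IsCounital ε :=
  hs.forall.2 (hδ.rid_lTensor_counit hf)

lemma IsCounital.of_injective {δ : X →ₗ[R] X ⊗[R] A} {ε : Y →ₗ[R] Y ⊗[R] A} {f : X →ₗ[R] Y}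
    (hε : IsCounital ε) (hf : Intertwines δ ε f) (hi : Function.Injective f) :
    IsCounital δ := fun x => by
  apply hi
  rw [← rid_rTensor, ← lTensor_rTensor_comm, ← hf, hε]

lemma IsCounital.lTensor_counit_smulRight {δ : X →ₗ[R] X ⊗[R] A} (hδ : IsCounital δ) (x : X)
    (y : Y) : ((Coalgebra.counit (R := R) (A := A)).smulRight y).lTensor X (δ x) = x ⊗ₜ y := by
  conv_rhs => rw [← hδ x]
  generalize δ x = t
  induction t with
  | zero => simp
  | add t t' ht ht' => simp only [map_add, TensorProduct.add_tmul, ht, ht']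
  | tmul x a => simp [TensorProduct.smul_tmul]

lemma isCoassociative_comul : IsCoassociative (Coalgebra.comul (R := R) (A := A)) :=
  Coalgebra.coassoc_apply

lemma isCounital_comul : IsCounital (Coalgebra.comul (R := R) (A := A)) := fun a => by
  rw [Coalgebra.lTensor_counit_comul, TensorProduct.rid_tmul, one_smul]

lemma convAct_mul {δ : X →ₗ[R] X ⊗[R] A} (hδ : IsCoassociative δ) (ψ χ : WithConv (A →ₗ[R] E)) :
    convAct δ (ψ * χ) = convAct δ ψ * convAct δ χ := by
  refine TensorProduct.ext' fun x ζ => ?_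
  let H : X ⊗[R] (A ⊗[R] A) →ₗ[R] X ⊗[R] E :=
    (LinearMap.mulRight R ζ ∘ₗ LinearMap.mul' R E ∘ₗ TensorProduct.map ψ.ofConv χ.ofConv).lTensor X
  have convAct_eq (t : X ⊗[R] A) : convAct δ ψ ((LinearMap.mulRight R ζ ∘ₗ χ.ofConv).lTensor X t)
      = H (TensorProduct.assoc R X A A (δ.rTensor A t)) := by
    induction t with
    | zero => simp
    | add x y hx hy => simp only [map_add, hx, hy]
    | tmul x a =>
      rw [LinearMap.lTensor_tmul, convAct_tmul, LinearMap.rTensor_tmul]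
      generalize δ x = s
      induction s with
      | zero => simp
      | add x y hx hy => simp only [map_add, TensorProduct.add_tmul, hx, hy]
      | tmul y b => simp [H, mul_assoc]
  rw [Module.End.mul_apply, convAct_tmul, convAct_tmul, convAct_eq, hδ,
    ← LinearMap.lTensor_comp_apply]
  rfl

lemma convAct_one {δ : X →ₗ[R] X ⊗[R] A} (hδ : IsCounital δ) :
    convAct δ (1 : WithConv (A →ₗ[R] E)) = 1 := by
  refine TensorProduct.ext' fun x ζ => ?_
  rw [convAct_tmul, Module.End.one_apply]
  conv_rhs => rw [← hδ x]
  generalize δ x = t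
  induction t with
  | zero => simp
  | add x y hx hy => simp only [map_add, TensorProduct.add_tmul, hx, hy]
  | tmul x a => simp [LinearMap.convOne_def, TensorProduct.smul_tmul, Algebra.smul_def]

/-- `convAct` for a coassociative and counital `δ`, as an algebra homomorphism from the convolution
algebra. -/
def convHom {δ : X →ₗ[R] X ⊗[R] A} (hδ : IsCoassociative δ) (hδ' : IsCounital δ) :
    WithConv (A →ₗ[R] E) →ₐ[R] Module.End R (X ⊗[R] E) :=
  AlgHom.ofLinearMap (convAct δ) (convAct_one hδ') (convAct_mul hδ)

lemma map_comp_comul {F : Type*} [Semiring F] [Algebra R F] (f : A →ₗ[R] E) (g : A →ₗ[R] F) :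
    toConv (TensorProduct.map f g ∘ₗ Coalgebra.comul)
      = toConv (Algebra.TensorProduct.includeLeft.toLinearMap ∘ₗ f)
        * toConv (Algebra.TensorProduct.includeRight.toLinearMap ∘ₗ g) := by
  have hmap : TensorProduct.map f g = LinearMap.mul' R (E ⊗[R] F)
      ∘ₗ TensorProduct.map (Algebra.TensorProduct.includeLeft.toLinearMap ∘ₗ f)
        (Algebra.TensorProduct.includeRight.toLinearMap ∘ₗ g) := by
    ext; simp
  rw [hmap]
  rfl

/-- The homomorphism `id ⊗ ε : E ⊗ A → E` given by the counit `ε`. -/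
def counitRight (R A E : Type*) [CommSemiring R] [Semiring A] [Bialgebra R A] [Semiring E]
    [Algebra R E] : E ⊗[R] A →ₐ[R] E :=
  (Algebra.TensorProduct.rid R R E).toAlgHom.comp
    (Algebra.TensorProduct.map (.id R E) (Bialgebra.counitAlgHom R A))

lemma counitRight_apply {A : Type*} [Semiring A] [Bialgebra R A] (t : E ⊗[R] A) :
    counitRight R A E t = TensorProduct.rid R E (Coalgebra.counit.lTensor E t) := rfl

end Coaction

section Adjoint

variable {A : Type*} [Ring A] [HopfAlgebra ℂ A]

open Algebra.TensorProduct in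
/-- `a₁ · ad(a₂) = φ(a)`, with the product in the second leg: the antipode in `ad` cancels. -/
lemma includeRight_convMul_ad :
    toConv includeRight.toLinearMap * toConv (ad A)
      = toConv (Coalgebra.comul (R := ℂ) (A := A)) := by
  have htwist : adTwist = LinearMap.mul' ℂ (A ⊗[ℂ] A)
      ∘ₗ TensorProduct.map includeRight.toLinearMap (ad A) := by
    ext; simp [adTwist]
  apply ofConv_injective
  refine LinearMap.ext fun a => ?_
  rw [← adTwist_comul a, htwist]
  rfl

lemma toConv_algHom_comp {E F : Type*} [Semiring E] [Algebra ℂ E] [Semiring F] [Algebra ℂ F]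
    (h : E →ₐ[ℂ] F) (f g : WithConv (A →ₗ[ℂ] E)) :
    toConv (h.toLinearMap ∘ₗ (f * g).ofConv)
      = toConv (h.toLinearMap ∘ₗ f.ofConv) * toConv (h.toLinearMap ∘ₗ g.ofConv) :=
  congrArg toConv (LinearMap.algHom_comp_convMul_distrib h f g)

lemma algHom_convMul_left_cancel {E : Type*} [Semiring E] [Algebra ℂ E] (j : A →ₐ[ℂ] E)
    {f g : WithConv (A →ₗ[ℂ] E)} (h : toConv j.toLinearMap * f = toConv j.toLinearMap * g) :
    f = g := by
  have hinv : toConv (j.toLinearMap ∘ₗ HopfAlgebra.antipode ℂ) * toConv j.toLinearMap = 1 := by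
    refine (toConv_algHom_comp j (toConv (HopfAlgebra.antipode ℂ)) (toConv .id)).symm.trans ?_
    rw [LinearMap.antipode_mul_id]
    apply ofConv_injective
    ext
    simp [LinearMap.convOne_def]
  rw [← one_mul f, ← hinv, mul_assoc, h, ← mul_assoc, hinv, one_mul]

open Algebra.TensorProduct in
lemma isCounital_ad : IsCounital (ad A) := fun a => by
  have h_includeRight :
      toConv ((counitRight ℂ A A).toLinearMap ∘ₗ includeRight.toLinearMap) = 1 := by
    apply ofConv_injective
    ext
    simp [counitRight_apply, LinearMap.convOne_def, Algebra.algebraMap_eq_smul_one]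
  have h := toConv_algHom_comp (counitRight ℂ A A) (toConv includeRight.toLinearMap)
    (toConv (ad A))
  rw [includeRight_convMul_ad, h_includeRight, one_mul] at h
  refine (DFunLike.congr_fun (toConv_injective h) a).symm.trans ?_
  exact isCounital_comul a

open Algebra.TensorProduct in
lemma includeRight_convMul_rTensor {E : Type*} [Semiring E] [Algebra ℂ E] (f : A →ₗ[ℂ] E)
    (g : WithConv (A →ₗ[ℂ] A ⊗[ℂ] A)) :
    toConv includeRight.toLinearMap * toConv (f.rTensor A ∘ₗ g.ofConv)
      = toConv (f.rTensor A ∘ₗ (toConv includeRight.toLinearMap * g).ofConv) := by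
  apply ofConv_injective
  ext a
  simp only [LinearMap.convMul_def, ofConv_toConv, LinearMap.comp_apply]
  generalize Coalgebra.comul (R := ℂ) a = t
  induction t with
  | zero => simp
  | add x y hx hy => simp only [map_add, hx, hy]
  | tmul x y =>
    simp only [TensorProduct.map_tmul, LinearMap.comp_apply, LinearMap.mul'_apply]
    generalize g.ofConv y = s
    induction s with
    | zero => simp
    | add x y hx hy => simp only [map_add, mul_add, hx, hy]
    | tmul p q => simp

open Algebra.TensorProduct in
lemma rTensor_comp_comul {E : Type*} [Semiring E] [Algebra ℂ E] (f : A →ₗ[ℂ] E) :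
    toConv (f.rTensor A ∘ₗ Coalgebra.comul)
      = toConv ((includeLeft : E →ₐ[ℂ] E ⊗[ℂ] A).toLinearMap ∘ₗ f)
        * toConv (includeRight : A →ₐ[ℂ] E ⊗[ℂ] A).toLinearMap :=
  map_comp_comul f .id

open Algebra.TensorProduct in
/-- The algebra homomorphism `id ⊗ φ`, with values in `(A ⊗ A) ⊗ A`. -/
def lTensorComul (A : Type*) [Ring A] [HopfAlgebra ℂ A] : A ⊗[ℂ] A →ₐ[ℂ] (A ⊗[ℂ] A) ⊗[ℂ] A :=
  (Algebra.TensorProduct.assoc ℂ ℂ ℂ A A A).symm.toAlgHom.comp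
    (map (.id ℂ A) (Bialgebra.comulAlgHom ℂ A))

lemma assoc_lTensorComul (t : A ⊗[ℂ] A) :
    TensorProduct.assoc ℂ A A A (lTensorComul A t) = Coalgebra.comul.lTensor A t := by
  induction t with
  | zero => simp
  | add x y hx hy => simp only [map_add, hx, hy]
  | tmul x y =>
    exact (Algebra.TensorProduct.assoc ℂ ℂ ℂ A A A).apply_symm_apply (x ⊗ₜ Coalgebra.comul y)

lemma lTensorComul_comp_comul :
    (lTensorComul A).toLinearMap ∘ₗ Coalgebra.comul
      = Coalgebra.comul.rTensor A ∘ₗ Coalgebra.comul (R := ℂ) (A := A) := by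
  refine LinearMap.ext fun a => (TensorProduct.assoc ℂ A A A).injective ?_
  simp [assoc_lTensorComul]

open Algebra.TensorProduct in
lemma toConv_lTensorComul_comp_includeRight :
    toConv ((lTensorComul A).comp includeRight).toLinearMap
      = toConv ((includeLeft : A ⊗[ℂ] A →ₐ[ℂ] (A ⊗[ℂ] A) ⊗[ℂ] A).comp includeRight).toLinearMap
        * toConv (includeRight : A →ₐ[ℂ] (A ⊗[ℂ] A) ⊗[ℂ] A).toLinearMap := by
  refine Eq.trans ?_ (map_comp_comul (includeRight : A →ₐ[ℂ] A ⊗[ℂ] A).toLinearMap .id)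
  apply ofConv_injective
  refine LinearMap.ext fun a => (TensorProduct.assoc ℂ A A A).injective ?_
  simp only [AlgHom.toLinearMap_apply, AlgHom.comp_apply, assoc_lTensorComul,
    LinearMap.comp_apply, includeRight_apply, LinearMap.lTensor_tmul]
  generalize Coalgebra.comul (R := ℂ) a = t
  induction t with
  | zero => simp
  | add x y hx hy => simp only [TensorProduct.tmul_add, map_add, hx, hy]
  | tmul x y => simp

open Algebra.TensorProduct in
lemma algHom_comp_includeRight_convMul_ad {E : Type*} [Semiring E] [Algebra ℂ E]
    (j : A ⊗[ℂ] A →ₐ[ℂ] E) :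
    toConv (j.comp includeRight).toLinearMap * toConv (j.toLinearMap ∘ₗ ad A)
      = toConv (j.toLinearMap ∘ₗ Coalgebra.comul) := by
  refine (toConv_algHom_comp j (toConv includeRight.toLinearMap) (toConv (ad A))).symm.trans ?_
  rw [includeRight_convMul_ad]

open Algebra.TensorProduct in
lemma lTensorComul_convMul_rTensor_ad :
    toConv ((lTensorComul A).comp includeRight).toLinearMap * toConv ((ad A).rTensor A ∘ₗ ad A)
      = toConv (Coalgebra.comul.rTensor A ∘ₗ Coalgebra.comul) := by
  let i₁₂ : A ⊗[ℂ] A →ₐ[ℂ] (A ⊗[ℂ] A) ⊗[ℂ] A := includeLeft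
  let i₃ : A →ₐ[ℂ] (A ⊗[ℂ] A) ⊗[ℂ] A := includeRight
  calc _ = toConv (i₁₂.comp includeRight).toLinearMap
          * toConv ((ad A).rTensor A ∘ₗ Coalgebra.comul) := by
        rw [toConv_lTensorComul_comp_includeRight, mul_assoc,
          includeRight_convMul_rTensor (ad A) (toConv (ad A)), includeRight_convMul_ad]
    _ = toConv (i₁₂.comp includeRight).toLinearMap * (toConv (i₁₂.toLinearMap ∘ₗ ad A)
          * toConv i₃.toLinearMap) := by rw [rTensor_comp_comul]
    _ = toConv (i₁₂.toLinearMap ∘ₗ Coalgebra.comul) * toConv i₃.toLinearMap := by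
        rw [← mul_assoc, algHom_comp_includeRight_convMul_ad]
    _ = _ := by rw [rTensor_comp_comul]

/-- Multiplying `b₁ ⊗ b₂` into the last two legs is injective on `Hom(A, A ⊗ A ⊗ A)`, since the
antipode provides a convolution inverse; it turns both sides of the coassociativity of `ad` into
the iterated coproduct. -/
lemma isCoassociative_ad : IsCoassociative (ad A) := fun a => by
  have h : toConv ((ad A).rTensor A ∘ₗ ad A) = toConv ((lTensorComul A).toLinearMap ∘ₗ ad A) := by
    refine algHom_convMul_left_cancel ((lTensorComul A).comp Algebra.TensorProduct.includeRight) ?_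
    rw [lTensorComul_convMul_rTensor_ad, algHom_comp_includeRight_convMul_ad,
      lTensorComul_comp_comul]
  rw [← assoc_lTensorComul]
  exact congrArg _ (DFunLike.congr_fun (toConv_injective h) a)

end Adjoint

/-! ## Matrix coefficients -/

section MatrixCoefficients

variable {A : Type*} [Ring A] [HopfAlgebra ℂ A] [StarRing A] {m n : ℕ}

namespace UnitaryRep

lemma sum_mul_star (u : UnitaryRep A n) (i j : Fin n) :
    ∑ k, u.mat i k * star (u.mat j k) = if i = j then 1 else 0 := by
  have h := congrFun (congrFun (Unitary.mem_iff.1 u.mem_unitary).2 i) j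
  simpa [Matrix.mul_apply, Matrix.star_apply, Matrix.one_apply] using h

lemma sum_star_mul (u : UnitaryRep A n) (i j : Fin n) :
    ∑ k, star (u.mat k i) * u.mat k j = if i = j then 1 else 0 := by
  have h := congrFun (congrFun (Unitary.mem_iff.1 u.mem_unitary).1 i) j
  simpa [Matrix.mul_apply, Matrix.star_apply, Matrix.one_apply] using h

/-- The one-dimensional trivial representation. -/
def trivial : UnitaryRep A 1 where
  mat := 1
  comul_mat i j := by
    rw [Subsingleton.elim i j]
    simp [Algebra.TensorProduct.one_def, Matrix.one_apply, Subsingleton.elim j 0]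
  counit_mat i j := by
    rw [Subsingleton.elim i j]; simp
  mem_unitary := one_mem _

lemma sum_tensor_mul_star (u : UnitaryRep A m) (v : UnitaryRep A n) (i j : Fin m × Fin n) :
    ∑ k : Fin m × Fin n, (u.mat i.1 k.1 * v.mat i.2 k.2) * star (u.mat j.1 k.1 * v.mat j.2 k.2)
      = if i = j then 1 else 0 := by
  calc _ = ∑ x, u.mat i.1 x * (∑ y, v.mat i.2 y * star (v.mat j.2 y)) * star (u.mat j.1 x) := by
        simp only [Fintype.sum_prod_type, star_mul, Finset.mul_sum, Finset.sum_mul, mul_assoc]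
    _ = if i = j then 1 else 0 := by
        by_cases h : i.2 = j.2 <;> simp [Prod.ext_iff, sum_mul_star, h]

lemma sum_star_mul_tensor (u : UnitaryRep A m) (v : UnitaryRep A n) (i j : Fin m × Fin n) :
    ∑ k : Fin m × Fin n, star (u.mat k.1 i.1 * v.mat k.2 i.2) * (u.mat k.1 j.1 * v.mat k.2 j.2)
      = if i = j then 1 else 0 := by
  calc _ = ∑ y, star (v.mat y i.2) * (∑ x, star (u.mat x i.1) * u.mat x j.1) * v.mat y j.2 := by
        simp only [Fintype.sum_prod_type_right, star_mul, Finset.mul_sum, Finset.sum_mul,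
          mul_assoc]
    _ = if i = j then 1 else 0 := by
        by_cases h : i.1 = j.1 <;> simp [Prod.ext_iff, sum_star_mul, h]

/-- The tensor product of two unitary representations, its basis being indexed through
`finProdFinEquiv`. -/
def tensor (u : UnitaryRep A m) (v : UnitaryRep A n) : UnitaryRep A (m * n) where
  mat := (Matrix.of fun i j : Fin m × Fin n => u.mat i.1 j.1 * v.mat i.2 j.2).reindex
    finProdFinEquiv finProdFinEquiv
  comul_mat i j := by
    rw [← finProdFinEquiv.sum_comp]
    simp [-finProdFinEquiv_symm_apply, Bialgebra.comul_mul, u.comul_mat, v.comul_mat,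
      Finset.sum_mul_sum, Fintype.sum_prod_type]
  counit_mat i j := by
    obtain ⟨i, rfl⟩ := finProdFinEquiv.surjective i
    obtain ⟨j, rfl⟩ := finProdFinEquiv.surjective j
    simp [-finProdFinEquiv_symm_apply, Bialgebra.counit_mul, u.counit_mat, v.counit_mat,
      Prod.ext_iff, and_comm (a := i.1 = j.1), ite_and]
  mem_unitary := by
    refine Unitary.mem_iff.2 ⟨?_, ?_⟩ <;> ext i j <;>
      obtain ⟨i, rfl⟩ := finProdFinEquiv.surjective i <;>
      obtain ⟨j, rfl⟩ := finProdFinEquiv.surjective j <;>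
      rw [Matrix.mul_apply, ← finProdFinEquiv.sum_comp, Matrix.one_apply]
    · simpa [-finProdFinEquiv_symm_apply] using sum_star_mul_tensor u v i j
    · simpa [-finProdFinEquiv_symm_apply] using sum_tensor_mul_star u v i j

end UnitaryRep

variable (A) in
/-- The matrix coefficients of the finite-dimensional unitary representations. -/
def matrixCoefficients : Set A :=
  {a | ∃ (n : ℕ) (u : UnitaryRep A n) (i j : Fin n), u.mat i j = a}

lemma one_mem_matrixCoefficients : (1 : A) ∈ matrixCoefficients A :=
  ⟨1, UnitaryRep.trivial, 0, 0, by simp [UnitaryRep.trivial]⟩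

lemma mul_mem_matrixCoefficients {a b : A} (ha : a ∈ matrixCoefficients A)
    (hb : b ∈ matrixCoefficients A) : a * b ∈ matrixCoefficients A := by
  obtain ⟨m, u, i, j, rfl⟩ := ha
  obtain ⟨n, v, k, l, rfl⟩ := hb
  exact ⟨m * n, u.tensor v, finProdFinEquiv (i, k), finProdFinEquiv (j, l), by
    simp [UnitaryRep.tensor, -finProdFinEquiv_symm_apply]⟩

lemma span_matrixCoefficients_eq_top [StarModule ℂ A] [CompactMatrixQuantumGroup A] :
    Submodule.span ℂ (matrixCoefficients A) = ⊤ := by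
  obtain ⟨n, u, hu⟩ := CompactMatrixQuantumGroup.exists_fundamental (A := A)
  let M : Submonoid A :=
    ⟨⟨matrixCoefficients A, mul_mem_matrixCoefficients⟩, one_mem_matrixCoefficients⟩
  have hM : Submodule.span ℂ (M : Set A)
      = Subalgebra.toSubmodule (Algebra.adjoin ℂ (M : Set A)) := by
    rw [Algebra.adjoin_eq_span, Submonoid.closure_eq]
  refine hM.trans (top_unique ?_)
  rw [← Algebra.top_toSubmodule, ← hu]
  refine Algebra.adjoin_mono ?_
  rintro _ ⟨p, rfl⟩
  exact ⟨n, u, p.1, p.2, rfl⟩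

end MatrixCoefficients

/-! ## The algebra of left-invariant forms -/

namespace BicovariantCalculus

section InvariantForms

variable {A : Type*} [Ring A] [HopfAlgebra ℂ A] [StarRing A] (Γ : BicovariantCalculus A)

lemma invExt_induction {p : Γ.InvExt → Prop} (one : p 1) (add : ∀ x y, p x → p y → p (x + y))
    (smul : ∀ (c : ℂ) x, p x → p (c • x)) (inc_mul : ∀ x η, p η → p (Γ.inc x * η))
    (η : Γ.InvExt) : p η := by
  have invMk_mul (t : TensorAlgebra ℂ Γ.Inv) : ∀ η, p η → p (Γ.invMk t * η) := by
    induction t using TensorAlgebra.induction with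
    | algebraMap r =>
      intro η hη
      rw [AlgHom.commutes, ← Algebra.smul_def]
      exact smul r η hη
    | ι x => exact inc_mul x
    | mul a b ha hb =>
      intro η hη
      rw [map_mul, mul_assoc]
      exact ha _ (hb _ hη)
    | add a b ha hb =>
      intro η hη
      rw [map_add, add_mul]
      exact add _ _ (ha _ hη) (hb _ hη)
  obtain ⟨t, rfl⟩ := Γ.invMk_surjective η
  simpa using invMk_mul t 1 one

lemma invExt_linearMap_ext {M : Type*} [AddCommMonoid M] [Module ℂ M] {f g : Γ.InvExt →ₗ[ℂ] M}
    (one : f 1 = g 1) (inc_mul : ∀ x η, f η = g η → f (Γ.inc x * η) = g (Γ.inc x * η)) : f = g :=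
  LinearMap.ext <| Γ.invExt_induction one (fun x y hx hy => by rw [map_add, map_add, hx, hy])
    (fun c x hx => by rw [map_smul, map_smul, hx]) inc_mul

lemma word_cons (x : Γ.Inv) (l : List Γ.Inv) : Γ.word (x :: l) = Γ.inc x * Γ.word l := by
  simp [word]

lemma span_word : Submodule.span ℂ (Set.range Γ.word) = ⊤ := by
  refine top_unique fun η _ => ?_
  refine Γ.invExt_induction (p := (· ∈ Submodule.span ℂ (Set.range Γ.word)))
    (Submodule.subset_span ⟨[], rfl⟩) (fun _ _ => add_mem)
    (fun c _ => Submodule.smul_mem _ c) (fun x η hη => ?_) η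
  induction hη using Submodule.span_induction with
  | mem y h => obtain ⟨l, rfl⟩ := h; exact Submodule.subset_span ⟨x :: l, Γ.word_cons x l⟩
  | zero => simp
  | add y z _ _ hy hz => rw [mul_add]; exact add_mem hy hz
  | smul c y _ hy => rw [mul_smul_comm]; exact Submodule.smul_mem _ c hy

/-- The projection `π`, as an element of the convolution algebra of maps `A → Γ_inv^∧`. -/
def piConv : WithConv (A →ₗ[ℂ] Γ.InvExt) := toConv (Γ.inc ∘ₗ Γ.pi)

lemma quadExt_tmul (a b : A) : Γ.quadExt (a ⊗ₜ b) = Γ.inc (Γ.pi a) * Γ.inc (Γ.pi b) := by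
  simp [quadExt]

lemma dGen_pi_eq_neg_quadExt (a : A) :
    Γ.dGen (Γ.pi a) = -Γ.quadExt (Coalgebra.comul (R := ℂ) a) :=
  Γ.dGen_pi a

lemma toConv_dGen_comp_pi : toConv (Γ.dGen ∘ₗ Γ.pi) = -(Γ.piConv * Γ.piConv) :=
  ofConv_injective <| LinearMap.ext Γ.dGen_pi

lemma dMatrix_inc (x : Γ.Inv) : Γ.dMatrix (Γ.inc x) = Γ.dMatrixGen x := Γ.extLift_inc _ _ _

lemma dMatrix_dGen (x : Γ.Inv) : Γ.dMatrix (Γ.dGen x) = !![Γ.dGen x, 0; 0, Γ.dGen x] := by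
  obtain ⟨a, rfl⟩ := Γ.pi_surjective x
  have dMatrix_quadExt (t : A ⊗[ℂ] A) : Γ.dMatrix (Γ.quadExt t) = LinearMap.mul' ℂ _
      (TensorProduct.map (Γ.dMatrixGen ∘ₗ Γ.pi) (Γ.dMatrixGen ∘ₗ Γ.pi) t) := by
    induction t with
    | zero => simp
    | add x y hx hy => simp only [map_add, hx, hy]
    | tmul x y => simp [quadExt_tmul, dMatrix_inc]
  rw [dGen_pi_eq_neg_quadExt, map_neg, dMatrix_quadExt, dMatrix_aux]
  ext i j
  fin_cases i <;> fin_cases j <;> simp [quadExt]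

lemma dMatrix_one_one (η : Γ.InvExt) : Γ.dMatrix η 1 1 = η := by
  suffices h : Γ.dMatrix η 1 0 = 0 ∧ Γ.dMatrix η 1 1 = η from h.2
  refine Γ.invExt_induction (p := fun η => Γ.dMatrix η 1 0 = 0 ∧ Γ.dMatrix η 1 1 = η)
    (by simp) ?_ ?_ ?_ η
  · rintro x y ⟨hx, hx'⟩ ⟨hy, hy'⟩
    simp [hx, hx', hy, hy']
  · rintro c x ⟨hx, hx'⟩
    simp [hx, hx']
  · rintro x η ⟨h, h'⟩
    simp [Matrix.mul_apply, Fin.sum_univ_two, dMatrix_inc, dMatrixGen, h, h']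

lemma dInv_one : Γ.dInv 1 = 0 := by simp [dInv]

lemma dInv_inc_mul (x : Γ.Inv) (η : Γ.InvExt) :
    Γ.dInv (Γ.inc x * η) = Γ.dGen x * η - Γ.inc x * Γ.dInv η := by
  simp [dInv, Matrix.mul_apply, Fin.sum_univ_two, dMatrix_inc, dMatrixGen, dMatrix_one_one,
    sub_eq_add_neg, add_comm]

lemma dInv_dGen_mul (x : Γ.Inv) (η : Γ.InvExt) :
    Γ.dInv (Γ.dGen x * η) = Γ.dGen x * Γ.dInv η := by
  simp [dInv, Matrix.mul_apply, Fin.sum_univ_two, dMatrix_dGen]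

lemma dInv_comp_dInv : Γ.dInv ∘ₗ Γ.dInv = 0 := by
  refine Γ.invExt_linearMap_ext (by simp [dInv_one]) fun x η hη => ?_
  simp only [LinearMap.comp_apply, LinearMap.zero_apply] at hη ⊢
  rw [dInv_inc_mul, map_sub, dInv_dGen_mul, dInv_inc_mul, hη]
  simp

lemma actHom_inc (x : Γ.Inv) : Γ.actHom (Γ.inc x) = toConv (Γ.inc ∘ₗ Γ.circ x) :=
  Γ.extLift_inc _ _ _

end InvariantForms

section ComodD

variable {A X Y : Type*} [Ring A] [HopfAlgebra ℂ A] [StarRing A] (Γ : BicovariantCalculus A)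
  [AddCommGroup X] [Module ℂ X] [AddCommGroup Y] [Module ℂ Y]

lemma lTensor_dInv_mul_convAct (δ : X →ₗ[ℂ] X ⊗[ℂ] A) (θ : A →ₗ[ℂ] Γ.Inv) :
    Γ.dInv.lTensor X * convAct δ (toConv (Γ.inc ∘ₗ θ))
      = convAct δ (toConv (Γ.dGen ∘ₗ θ))
        - convAct δ (toConv (Γ.inc ∘ₗ θ)) * Γ.dInv.lTensor X := by
  refine TensorProduct.ext' fun x ζ => ?_
  simp only [LinearMap.sub_apply, Module.End.mul_apply, LinearMap.lTensor_tmul, convAct_tmul]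
  generalize δ x = t
  induction t with
  | zero => simp
  | add x y hx hy => simp only [map_add, hx, hy]; abel
  | tmul x a => simp [dInv_inc_mul, TensorProduct.tmul_sub]

/-- The differential `x ⊗ ζ ↦ ∑ xₖ ⊗ π(cₖ) ζ + x ⊗ dζ` on `X ⊗ Γ_inv^∧`, where
`δ(x) = ∑ xₖ ⊗ cₖ`; both `d_u` and, up to signs, `d_vh` are of this form. -/
def comodD (δ : X →ₗ[ℂ] X ⊗[ℂ] A) : Module.End ℂ (X ⊗[ℂ] Γ.InvExt) :=
  piMul Γ δ + Γ.dInv.lTensor X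

lemma comodD_mul_self {δ : X →ₗ[ℂ] X ⊗[ℂ] A} (hδ : IsCoassociative δ) :
    Γ.comodD δ * Γ.comodD δ = 0 := by
  have hconv : Γ.dInv.lTensor X * piMul Γ δ
      = -(piMul Γ δ * piMul Γ δ) - piMul Γ δ * Γ.dInv.lTensor X := by
    refine (Γ.lTensor_dInv_mul_convAct δ Γ.pi).trans ?_
    rw [toConv_dGen_comp_pi, map_neg, convAct_mul hδ]
    rfl
  have hd : Γ.dInv.lTensor X * Γ.dInv.lTensor X = 0 := by
    rw [Module.End.mul_eq_comp, ← LinearMap.lTensor_comp, dInv_comp_dInv, LinearMap.lTensor_zero]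
  rw [comodD, mul_add, add_mul, add_mul, hconv, hd]
  abel

lemma comodD_comp_rTensor {δ : X →ₗ[ℂ] X ⊗[ℂ] A} {ε : Y →ₗ[ℂ] Y ⊗[ℂ] A} {f : X →ₗ[ℂ] Y}
    (hf : Intertwines δ ε f) :
    Γ.comodD ε ∘ₗ f.rTensor Γ.InvExt = f.rTensor Γ.InvExt ∘ₗ Γ.comodD δ := by
  rw [comodD, LinearMap.add_comp, LinearMap.lTensor_comp_rTensor, comodD, LinearMap.comp_add,
    LinearMap.rTensor_comp_lTensor]
  exact congrArg (· + _) (hf.convAct_rTensor _)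

end ComodD

end BicovariantCalculus

/-! ## Braided contraction -/

section CounitConvolution

variable {R A E : Type*} [CommSemiring R] [AddCommMonoid A] [Module R A] [Coalgebra R A]
  [Semiring E] [Algebra R E]

lemma counit_smulRight_convMul (c : E) (f : A →ₗ[R] E) :
    toConv ((Coalgebra.counit (R := R)).smulRight c) * toConv f
      = toConv (LinearMap.mulLeft R c ∘ₗ f) := by
  have h (t : A ⊗[R] A) :
      LinearMap.mul' R E (TensorProduct.map ((Coalgebra.counit (R := R)).smulRight c) f t)
        = c * f (TensorProduct.lid R A ((Coalgebra.counit (R := R)).rTensor A t)) := by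
    induction t with
    | zero => simp
    | add x y hx hy => simp only [map_add, hx, hy, mul_add]
    | tmul x y => simp
  refine ofConv_injective <| LinearMap.ext fun a => (h (Coalgebra.comul a)).trans ?_
  simp [Coalgebra.rTensor_counit_comul]

lemma convMul_counit_smulRight (f : A →ₗ[R] E) (c : E) :
    toConv f * toConv ((Coalgebra.counit (R := R)).smulRight c)
      = toConv (LinearMap.mulRight R c ∘ₗ f) := by
  have h (t : A ⊗[R] A) :
      LinearMap.mul' R E (TensorProduct.map f ((Coalgebra.counit (R := R)).smulRight c) t)
        = f (TensorProduct.rid R A ((Coalgebra.counit (R := R)).lTensor A t)) * c := by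
    induction t with
    | zero => simp
    | add x y hx hy => simp only [map_add, hx, hy, add_mul]
    | tmul x y => simp
  refine ofConv_injective <| LinearMap.ext fun a => (h (Coalgebra.comul a)).trans ?_
  simp [Coalgebra.lTensor_counit_comul]

end CounitConvolution

namespace BicovariantCalculus

variable {A : Type*} [Ring A] [HopfAlgebra ℂ A] [StarRing A] (Γ : BicovariantCalculus A)

section Circ

/-- The map `b ↦ (a ↦ π(ba))` into the convolution algebra. -/
def piTranslate : A →ₗ[ℂ] WithConv (A →ₗ[ℂ] Γ.InvExt) :=
  (WithConv.linearEquiv ℂ (A →ₗ[ℂ] Γ.InvExt)).symm.toLinearMap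
    ∘ₗ (LinearMap.mul ℂ A).compr₂ (Γ.inc ∘ₗ Γ.pi)

lemma actHom_comp_pi : Γ.actHom.toLinearMap ∘ₗ Γ.inc ∘ₗ Γ.pi
    = Γ.piTranslate - Coalgebra.counit.smulRight Γ.piConv :=
  LinearMap.ext fun b => ofConv_injective <| LinearMap.ext fun a => by
    simp [actHom_inc, circ_pi, piTranslate, piConv]

lemma piTranslate_convMul_self (b : A) :
    (toConv Γ.piTranslate * toConv Γ.piTranslate).ofConv b
      = -toConv (Γ.dGen ∘ₗ Γ.pi ∘ₗ LinearMap.mulLeft ℂ b) := by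
  refine ofConv_injective <| LinearMap.ext fun a => ?_
  have h (s t : A ⊗[ℂ] A) (ht : t = Coalgebra.comul a) :
      (LinearMap.mul' ℂ _ (TensorProduct.map Γ.piTranslate Γ.piTranslate s)).ofConv a
        = Γ.quadExt (s * t) := by
    induction s with
    | zero => simp
    | add x y hx hy => simp only [map_add, ofConv_add, LinearMap.add_apply, hx, hy, add_mul]
    | tmul x y =>
      simp only [TensorProduct.map_tmul, LinearMap.mul'_apply, LinearMap.convMul_def,
        ofConv_toConv, LinearMap.comp_apply, ← ht]
      clear ht
      induction t with
      | zero => simp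
      | add p q hp hq => simp only [map_add, mul_add, hp, hq]
      | tmul p q => simp [piTranslate, quadExt_tmul]
  refine (h _ _ rfl).trans ?_
  simp [dGen_pi_eq_neg_quadExt, Bialgebra.comul_mul]

lemma actHom_dGen_pi (b : A) :
    Γ.actHom (Γ.dGen (Γ.pi b)) = toConv (Γ.dGen ∘ₗ Γ.pi ∘ₗ LinearMap.mulLeft ℂ b)
      + Γ.piConv * Γ.piTranslate b + Γ.piTranslate b * Γ.piConv
      - Coalgebra.counit (R := ℂ) b • (Γ.piConv * Γ.piConv) := by
  have hsq : toConv (Γ.actHom.toLinearMap ∘ₗ Γ.dGen ∘ₗ Γ.pi)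
      = -(toConv (Γ.piTranslate - Coalgebra.counit.smulRight Γ.piConv)
        * toConv (Γ.piTranslate - Coalgebra.counit.smulRight Γ.piConv)) := by
    have hmul := toConv_algHom_comp Γ.actHom Γ.piConv Γ.piConv
    rw [piConv, ofConv_toConv, actHom_comp_pi] at hmul
    rw [← hmul, ← toConv_neg, ← LinearMap.comp_neg, ← ofConv_neg]
    exact congrArg (fun f => toConv (Γ.actHom.toLinearMap ∘ₗ ofConv f)) Γ.toConv_dGen_comp_pi
  rw [toConv_sub, sub_mul, mul_sub, mul_sub, counit_smulRight_convMul, counit_smulRight_convMul,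
    convMul_counit_smulRight] at hsq
  calc Γ.actHom (Γ.dGen (Γ.pi b))
      = -((toConv Γ.piTranslate * toConv Γ.piTranslate).ofConv b
          - Γ.piTranslate b * Γ.piConv
          - (Γ.piConv * Γ.piTranslate b
            - Γ.piConv * (Coalgebra.counit (R := ℂ) b • Γ.piConv))) :=
        DFunLike.congr_fun (toConv_injective hsq) b
    _ = _ := by
        rw [piTranslate_convMul_self, mul_smul_comm]
        abel

lemma piConv_mul_actHom_inc (θ : Γ.Inv) :
    Γ.piConv * Γ.actHom (Γ.inc θ) + toConv (Γ.dGen ∘ₗ Γ.circ θ)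
      = Γ.actHom (Γ.dGen θ) - Γ.actHom (Γ.inc θ) * Γ.piConv := by
  obtain ⟨b, rfl⟩ := Γ.pi_surjective θ
  have hinc : Γ.actHom (Γ.inc (Γ.pi b))
      = Γ.piTranslate b - Coalgebra.counit (R := ℂ) b • Γ.piConv :=
    DFunLike.congr_fun Γ.actHom_comp_pi b
  have hcirc : toConv (Γ.dGen ∘ₗ Γ.circ (Γ.pi b))
      = toConv (Γ.dGen ∘ₗ Γ.pi ∘ₗ LinearMap.mulLeft ℂ b)
        + Coalgebra.counit (R := ℂ) b • (Γ.piConv * Γ.piConv) := by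
    rw [← neg_neg (Γ.piConv * Γ.piConv), ← toConv_dGen_comp_pi]
    refine ofConv_injective <| LinearMap.ext fun a => ?_
    simp [circ_pi, sub_eq_add_neg]
  rw [hinc, hcirc, actHom_dGen_pi, mul_sub, sub_mul, mul_smul_comm, smul_mul_assoc]
  abel

end Circ

section Contraction

lemma isCoassociative_varpi : IsCoassociative Γ.varpi :=
  isCoassociative_ad.of_surjective Γ.varpi_pi Γ.pi_surjective

lemma isCounital_varpi : IsCounital Γ.varpi :=
  isCounital_ad.of_surjective Γ.varpi_pi Γ.pi_surjective

/-- The left action `ξ (ϑ ⊗ ζ) = ∑ ϑₖ ⊗ (ξ ∘ cₖ) ζ` of `Γ_inv^∧` on `Γ_inv ⊗ Γ_inv^∧`, where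
`ϖ(ϑ) = ∑ ϑₖ ⊗ cₖ`. -/
def leftAct : Γ.InvExt →ₐ[ℂ] Module.End ℂ (Γ.Inv ⊗[ℂ] Γ.InvExt) :=
  (convHom Γ.isCoassociative_varpi Γ.isCounital_varpi).comp Γ.actHom

lemma leftAct_apply (ξ : Γ.InvExt) : Γ.leftAct ξ = convAct Γ.varpi (Γ.actHom ξ) := rfl

/-- The map `a ⊗ b ↦ π(a) ⊗ π(b) ζ`. -/
def pairMap (ζ : Γ.InvExt) : A ⊗[ℂ] A →ₗ[ℂ] Γ.Inv ⊗[ℂ] Γ.InvExt :=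
  TensorProduct.map Γ.pi (LinearMap.mulRight ℂ ζ ∘ₗ Γ.inc ∘ₗ Γ.pi)

lemma pairMap_tmul (ζ : Γ.InvExt) (a b : A) :
    Γ.pairMap ζ (a ⊗ₜ b) = Γ.pi a ⊗ₜ (Γ.inc (Γ.pi b) * ζ) := rfl

/-- The map `a ⊗ b ↦ π(a) (π(b) ⊗ ζ)`. -/
def braidMap (ζ : Γ.InvExt) : A ⊗[ℂ] A →ₗ[ℂ] Γ.Inv ⊗[ℂ] Γ.InvExt :=
  TensorProduct.lift ((Γ.leftAct.toLinearMap ∘ₗ Γ.inc ∘ₗ Γ.pi).compl₂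
    ((TensorProduct.mk ℂ Γ.Inv Γ.InvExt).flip ζ ∘ₗ Γ.pi))

lemma braidMap_tmul (ζ : Γ.InvExt) (a b : A) :
    Γ.braidMap ζ (a ⊗ₜ b) = Γ.leftAct (Γ.inc (Γ.pi a)) (Γ.pi b ⊗ₜ ζ) := rfl

lemma pairMap_ad (ζ : Γ.InvExt) (a : A) :
    Γ.pairMap ζ (ad A a) = piMul Γ Γ.varpi (Γ.pi a ⊗ₜ ζ) := by
  rw [piMul_tmul, varpi_pi]
  exact (DFunLike.congr_fun (LinearMap.lTensor_comp_rTensor ..) (ad A a)).symm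

lemma braidMap_comul (ζ : Γ.InvExt) (a : A) :
    Γ.braidMap ζ (Coalgebra.comul (R := ℂ) a)
      = Γ.pairMap ζ (Coalgebra.comul (R := ℂ) a) - Γ.pairMap ζ (ad A a) := by
  have h (s : A ⊗[ℂ] A) : Γ.braidMap ζ s = Γ.pairMap ζ (adTwist s)
      - Γ.pairMap ζ (ad A (TensorProduct.lid ℂ A (Coalgebra.counit.rTensor A s))) := by
    induction s with
    | zero => simp
    | add x y hx hy => simp only [map_add, hx, hy]; abel
    | tmul x y =>
      simp only [braidMap_tmul, adTwist, TensorProduct.lift.tmul, LinearMap.mk₂_apply,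
        LinearMap.rTensor_tmul, TensorProduct.lid_tmul, map_smul, leftAct_apply, convAct_tmul,
        varpi_pi, actHom_inc]
      generalize ad A y = t
      induction t with
      | zero => simp
      | add x y hx hy => simp only [map_add, mul_add, smul_add, hx, hy]; abel
      | tmul p q => simp [pairMap_tmul, circ_pi, sub_mul, TensorProduct.tmul_sub]
  rw [h, adTwist_comul, Coalgebra.rTensor_counit_comul, TensorProduct.lid_tmul, one_smul]

/-- The operators `(m, ζ) ↦ (ϑ ⊗ ζ - ϑ m, ϑ ζ)` on `(Γ_inv ⊗ Γ_inv^∧) × Γ_inv^∧`; they define the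
contraction `t` by multiplicativity, since `(t(η), η) ↦ (t(ϑ η), ϑ η)`. -/
def contractGen : Γ.Inv →ₗ[ℂ] Module.End ℂ ((Γ.Inv ⊗[ℂ] Γ.InvExt) × Γ.InvExt) where
  toFun θ := ((TensorProduct.mk ℂ Γ.Inv Γ.InvExt θ).comp (LinearMap.snd ℂ _ _)
      - (Γ.leftAct (Γ.inc θ)).comp (LinearMap.fst ℂ _ _)).prod
    ((LinearMap.mulLeft ℂ (Γ.inc θ)).comp (LinearMap.snd ℂ _ _))
  map_add' x y := by
    refine LinearMap.ext fun m => Prod.ext ?_ ?_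
    · simp [add_sub_add_comm]
    · simp [add_mul]
  map_smul' c x := by
    refine LinearMap.ext fun m => Prod.ext ?_ ?_
    · simp [TensorProduct.smul_tmul', smul_sub]
    · simp

lemma contractGen_apply (θ : Γ.Inv) (m : (Γ.Inv ⊗[ℂ] Γ.InvExt) × Γ.InvExt) :
    Γ.contractGen θ m = (θ ⊗ₜ m.2 - Γ.leftAct (Γ.inc θ) m.1, Γ.inc θ * m.2) := rfl

lemma contractGen_quad (s : A ⊗[ℂ] A) (m : (Γ.Inv ⊗[ℂ] Γ.InvExt) × Γ.InvExt) :
    LinearMap.mul' ℂ _ (TensorProduct.map (Γ.contractGen ∘ₗ Γ.pi) (Γ.contractGen ∘ₗ Γ.pi) s) m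
      = (Γ.pairMap m.2 s - Γ.braidMap m.2 s + Γ.leftAct (Γ.quadExt s) m.1,
        Γ.quadExt s * m.2) := by
  induction s with
  | zero => simp [Prod.zero_eq_mk]
  | add x y hx hy =>
    simp only [map_add, LinearMap.add_apply, hx, hy, Prod.mk_add_mk, add_mul]
    congr 1; abel
  | tmul x y =>
    simp only [TensorProduct.map_tmul, LinearMap.mul'_apply, LinearMap.comp_apply,
      Module.End.mul_apply, contractGen_apply, pairMap_tmul, braidMap_tmul, quadExt_tmul,
      map_mul, map_sub, mul_assoc]
    congr 1; abel

/-- The extension of `contractGen` to an action of the algebra `Γ_inv^∧`. -/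
def contractHom : Γ.InvExt →ₐ[ℂ] Module.End ℂ ((Γ.Inv ⊗[ℂ] Γ.InvExt) × Γ.InvExt) :=
  Γ.extLift Γ.contractGen fun r hr => by
    refine LinearMap.ext fun m => ?_
    have h : Γ.quadExt (Coalgebra.comul (R := ℂ) r) = 0 := Γ.inc_quad hr
    rw [contractGen_quad, h, braidMap_comul, pairMap_ad, Γ.pi_eq_zero hr]
    simp

/-- The braided antiderivation `t : Γ_inv^∧ → Γ_inv ⊗ Γ_inv^∧` with `t(ϑ) = ϑ ⊗ 1`, so that
`t(ϑ η) = ϑ ⊗ η - ϑ t(η)`. -/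
def contract : Γ.InvExt →ₗ[ℂ] Γ.Inv ⊗[ℂ] Γ.InvExt :=
  LinearMap.fst ℂ _ _ ∘ₗ LinearMap.applyₗ ((0 : Γ.Inv ⊗[ℂ] Γ.InvExt), (1 : Γ.InvExt))
    ∘ₗ Γ.contractHom.toLinearMap

lemma contractHom_inc (θ : Γ.Inv) : Γ.contractHom (Γ.inc θ) = Γ.contractGen θ :=
  Γ.extLift_inc _ _ _

lemma contractHom_apply (η : Γ.InvExt) : Γ.contractHom η (0, 1) = (Γ.contract η, η) := by
  refine Prod.ext rfl ?_
  refine Γ.invExt_induction (p := fun η => (Γ.contractHom η (0, 1)).2 = η) (by simp)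
    (fun x y hx hy => ?_) (fun c x hx => ?_) (fun x η hη => ?_) η
  · rw [map_add, LinearMap.add_apply, Prod.snd_add, hx, hy]
  · rw [map_smul, LinearMap.smul_apply, Prod.smul_snd, hx]
  · rw [map_mul, contractHom_inc, Module.End.mul_apply, contractGen_apply, hη]

lemma contract_one : Γ.contract 1 = 0 := by simp [contract]

lemma contract_inc_mul (θ : Γ.Inv) (η : Γ.InvExt) :
    Γ.contract (Γ.inc θ * η) = θ ⊗ₜ η - Γ.leftAct (Γ.inc θ) (Γ.contract η) := by
  have h := Γ.contractHom_apply (Γ.inc θ * η)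
  rw [map_mul, Module.End.mul_apply, contractHom_apply, contractHom_inc, contractGen_apply] at h
  exact (congrArg Prod.fst h).symm

lemma contract_quadExt_mul (s : A ⊗[ℂ] A) (η : Γ.InvExt) :
    Γ.contract (Γ.quadExt s * η)
      = Γ.pairMap η s - Γ.braidMap η s + Γ.leftAct (Γ.quadExt s) (Γ.contract η) := by
  induction s with
  | zero => simp
  | add x y hx hy => simp only [map_add, LinearMap.add_apply, hx, hy, add_mul]; abel
  | tmul x y =>
    simp only [quadExt_tmul, mul_assoc, contract_inc_mul, map_sub, pairMap_tmul, braidMap_tmul,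
      map_mul, Module.End.mul_apply]
    abel

lemma contract_dGen_mul (θ : Γ.Inv) (η : Γ.InvExt) :
    Γ.contract (Γ.dGen θ * η)
      = Γ.leftAct (Γ.dGen θ) (Γ.contract η) - piMul Γ Γ.varpi (θ ⊗ₜ η) := by
  obtain ⟨a, rfl⟩ := Γ.pi_surjective θ
  rw [dGen_pi_eq_neg_quadExt, neg_mul, map_neg, contract_quadExt_mul, braidMap_comul, pairMap_ad,
    map_neg, LinearMap.neg_apply]
  abel

lemma comodD_mul_leftAct (θ : Γ.Inv) : Γ.comodD Γ.varpi * Γ.leftAct (Γ.inc θ)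
    = Γ.leftAct (Γ.dGen θ) - Γ.leftAct (Γ.inc θ) * Γ.comodD Γ.varpi := by
  have hd := Γ.lTensor_dInv_mul_convAct Γ.varpi (Γ.circ θ)
  have hpi := congrArg (convAct Γ.varpi) (Γ.piConv_mul_actHom_inc θ)
  rw [map_add, map_sub, convAct_mul Γ.isCoassociative_varpi,
    convAct_mul Γ.isCoassociative_varpi] at hpi
  rw [← actHom_inc] at hd
  rw [comodD, leftAct_apply, leftAct_apply, add_mul, mul_add, hd]
  refine LinearMap.ext fun m => ?_
  have hm := DFunLike.congr_fun hpi m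
  simp only [LinearMap.add_apply, LinearMap.sub_apply] at hm ⊢
  rw [← sub_sub, ← add_sub_assoc]
  exact congrArg (· - _) hm

lemma contract_comp_dInv : Γ.contract ∘ₗ Γ.dInv = -(Γ.comodD Γ.varpi ∘ₗ Γ.contract) := by
  refine Γ.invExt_linearMap_ext (by simp [dInv_one, contract_one]) fun x η hη => ?_
  simp only [LinearMap.comp_apply, LinearMap.neg_apply] at hη ⊢
  have hx := DFunLike.congr_fun (Γ.comodD_mul_leftAct x) (Γ.contract η)
  simp only [Module.End.mul_apply, LinearMap.sub_apply] at hx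
  rw [dInv_inc_mul, map_sub, contract_dGen_mul, contract_inc_mul, contract_inc_mul, hη, map_sub,
    hx, map_neg]
  simp only [comodD, LinearMap.add_apply, LinearMap.lTensor_tmul]
  abel

end Contraction

end BicovariantCalculus

/-! ## The contraction homotopy -/

section TensorCoaction

variable {R A X Y Z : Type*} [CommSemiring R] [Semiring A] [Algebra R A]
  [AddCommMonoid X] [Module R X] [AddCommMonoid Y] [Module R Y] [AddCommMonoid Z] [Module R Z]

/-- The map `(x ⊗ a) ⊗ (y ⊗ b) ↦ (x ⊗ y) ⊗ ab`. -/
def tensorMul (R A X Y : Type*) [CommSemiring R] [Semiring A] [Algebra R A]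
    [AddCommMonoid X] [Module R X] [AddCommMonoid Y] [Module R Y] :
    (X ⊗[R] A) ⊗[R] (Y ⊗[R] A) →ₗ[R] (X ⊗[R] Y) ⊗[R] A :=
  (LinearMap.mul' R A).lTensor (X ⊗[R] Y)
    ∘ₗ (TensorProduct.tensorTensorTensorComm R X A Y A).toLinearMap

/-- The tensor product of the coactions `δ` and `ε`. -/
def tensorCoaction (δ : X →ₗ[R] X ⊗[R] A) (ε : Y →ₗ[R] Y ⊗[R] A) :
    X ⊗[R] Y →ₗ[R] (X ⊗[R] Y) ⊗[R] A :=
  tensorMul R A X Y ∘ₗ TensorProduct.map δ ε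

lemma tensorMul_tmul (x : X) (a : A) (y : Y) (b : A) :
    tensorMul R A X Y ((x ⊗ₜ a) ⊗ₜ (y ⊗ₜ b)) = (x ⊗ₜ y) ⊗ₜ (a * b) := rfl

lemma tensorCoaction_tmul (δ : X →ₗ[R] X ⊗[R] A) (ε : Y →ₗ[R] Y ⊗[R] A) (x : X) (y : Y) :
    tensorCoaction δ ε (x ⊗ₜ y) = tensorMul R A X Y (δ x ⊗ₜ ε y) := rfl

lemma assoc_tensorMul_tmul (t : X ⊗[R] A) (s : Y ⊗[R] A) (a b : A) :
    TensorProduct.assoc R (X ⊗[R] Y) A A (tensorMul R A X Y (t ⊗ₜ s) ⊗ₜ (a * b))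
      = tensorMul R (A ⊗[R] A) X Y
        (TensorProduct.assoc R X A A (t ⊗ₜ a) ⊗ₜ TensorProduct.assoc R Y A A (s ⊗ₜ b)) := by
  induction t with
  | zero => simp
  | add t t' ht ht' => simp only [map_add, TensorProduct.add_tmul, ht, ht']
  | tmul x c =>
    induction s with
    | zero => simp
    | add s s' hs hs' =>
      simp only [map_add, TensorProduct.add_tmul, TensorProduct.tmul_add, hs, hs']
    | tmul y d => simp [tensorMul_tmul]

lemma assoc_rTensor_tensorMul (δ : X →ₗ[R] X ⊗[R] A) (ε : Y →ₗ[R] Y ⊗[R] A)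
    (t : X ⊗[R] A) (s : Y ⊗[R] A) :
    TensorProduct.assoc R (X ⊗[R] Y) A A
        ((tensorCoaction δ ε).rTensor A (tensorMul R A X Y (t ⊗ₜ s)))
      = tensorMul R (A ⊗[R] A) X Y (TensorProduct.assoc R X A A (δ.rTensor A t)
          ⊗ₜ TensorProduct.assoc R Y A A (ε.rTensor A s)) := by
  induction t with
  | zero => simp
  | add t t' ht ht' => simp only [map_add, TensorProduct.add_tmul, ht, ht']
  | tmul x a =>
    induction s with
    | zero => simp
    | add s s' hs hs' => simp only [map_add, TensorProduct.tmul_add, hs, hs']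
    | tmul y b =>
      rw [tensorMul_tmul, LinearMap.rTensor_tmul, tensorCoaction_tmul, assoc_tensorMul_tmul,
        LinearMap.rTensor_tmul, LinearMap.rTensor_tmul]

lemma tensorMul_lTensor_rTensor (g : Y →ₗ[R] Z) (t : X ⊗[R] A) (s : Y ⊗[R] A) :
    tensorMul R A X Z (t ⊗ₜ g.rTensor A s)
      = (g.lTensor X).rTensor A (tensorMul R A X Y (t ⊗ₜ s)) := by
  induction t with
  | zero => simp
  | add t t' ht ht' => simp only [map_add, TensorProduct.add_tmul, ht, ht']
  | tmul x a =>
    induction s with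
    | zero => simp
    | add s s' hs hs' => simp only [map_add, TensorProduct.tmul_add, hs, hs']
    | tmul y b => simp [tensorMul_tmul]

lemma Intertwines.lTensor {ε : Y →ₗ[R] Y ⊗[R] A} {ζ : Z →ₗ[R] Z ⊗[R] A} {g : Y →ₗ[R] Z}
    (hg : Intertwines ε ζ g) (δ : X →ₗ[R] X ⊗[R] A) :
    Intertwines (tensorCoaction δ ε) (tensorCoaction δ ζ) (g.lTensor X) := fun t => by
  induction t with
  | zero => simp
  | add t t' ht ht' => simp only [map_add, ht, ht']
  | tmul x y =>
    rw [LinearMap.lTensor_tmul, tensorCoaction_tmul, hg, tensorMul_lTensor_rTensor,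
      tensorCoaction_tmul]

lemma rTensor_mul'_tensorMul {E : Type*} [Semiring E] [Algebra R E] (t s : E ⊗[R] A) :
    (LinearMap.mul' R E).rTensor A (tensorMul R A E E (t ⊗ₜ s)) = t * s := by
  induction t with
  | zero => simp
  | add t t' ht ht' => simp only [map_add, TensorProduct.add_tmul, add_mul, ht, ht']
  | tmul x a =>
    induction s with
    | zero => simp
    | add s s' hs hs' => simp only [map_add, TensorProduct.tmul_add, mul_add, hs, hs']
    | tmul y b => simp [tensorMul_tmul]

lemma intertwines_mul' {E : Type*} [Semiring E] [Algebra R E] {δ : E →ₗ[R] E ⊗[R] A}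
    (hδ : ∀ x y, δ (x * y) = δ x * δ y) :
    Intertwines (tensorCoaction δ δ) δ (LinearMap.mul' R E) := fun z => by
  induction z with
  | zero => simp
  | add x y hx hy => simp only [map_add, hx, hy]
  | tmul x y => rw [LinearMap.mul'_apply, hδ, tensorCoaction_tmul, rTensor_mul'_tensorMul]

variable {H : Type*} [Semiring H] [Bialgebra R H]

lemma lTensor_comul_tensorMul (t : X ⊗[R] H) (s : Y ⊗[R] H) :
    Coalgebra.comul.lTensor (X ⊗[R] Y) (tensorMul R H X Y (t ⊗ₜ s))
      = tensorMul R (H ⊗[R] H) X Y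
        (Coalgebra.comul.lTensor X t ⊗ₜ Coalgebra.comul.lTensor Y s) := by
  induction t with
  | zero => simp
  | add t t' ht ht' => simp only [map_add, TensorProduct.add_tmul, ht, ht']
  | tmul x a =>
    induction s with
    | zero => simp
    | add s s' hs hs' => simp only [map_add, TensorProduct.tmul_add, hs, hs']
    | tmul y b => simp [tensorMul_tmul, Bialgebra.comul_mul]

lemma IsCoassociative.tensorCoaction {δ : X →ₗ[R] X ⊗[R] H} {ε : Y →ₗ[R] Y ⊗[R] H}
    (hδ : IsCoassociative δ) (hε : IsCoassociative ε) :
    IsCoassociative (tensorCoaction δ ε) := fun z => by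
  induction z with
  | zero => simp
  | add x y hx hy => simp only [map_add, hx, hy]
  | tmul x y =>
    rw [tensorCoaction_tmul, assoc_rTensor_tensorMul, lTensor_comul_tensorMul, hδ, hε]

end TensorCoaction

namespace BicovariantCalculus

variable {A : Type*} [Ring A] [HopfAlgebra ℂ A] [StarRing A] (Γ : BicovariantCalculus A)

section Homotopy

variable {X Y : Type*} [AddCommGroup X] [Module ℂ X] [AddCommGroup Y] [Module ℂ Y]

lemma piMul_tensorCoaction (δ : X →ₗ[ℂ] X ⊗[ℂ] A) (ε : Y →ₗ[ℂ] Y ⊗[ℂ] A) (x : X)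
    (m : Y ⊗[ℂ] Γ.InvExt) :
    piMul Γ (tensorCoaction δ ε) ((TensorProduct.assoc ℂ X Y Γ.InvExt).symm (x ⊗ₜ m))
      = (TensorProduct.assoc ℂ X Y Γ.InvExt).symm
        ((LinearMap.applyₗ m ∘ₗ convAct ε ∘ₗ Γ.piTranslate).lTensor X (δ x)) := by
  induction m with
  | zero => simp
  | add m n hm hn =>
    simp only [TensorProduct.tmul_add, map_add, hm, hn, LinearMap.add_comp, LinearMap.lTensor_add,
      LinearMap.add_apply]
  | tmul y ζ =>
    rw [TensorProduct.assoc_symm_tmul, piMul_tmul, tensorCoaction_tmul]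
    generalize δ x = t
    induction t with
    | zero => simp
    | add t t' ht ht' => simp only [map_add, TensorProduct.add_tmul, ht, ht']
    | tmul x a =>
      simp only [LinearMap.lTensor_tmul, LinearMap.comp_apply, LinearMap.applyₗ_apply_apply,
        convAct_tmul]
      generalize ε y = s
      induction s with
      | zero => simp
      | add s s' hs hs' => simp only [map_add, TensorProduct.tmul_add, hs, hs']
      | tmul y b => simp [tensorMul_tmul, piTranslate]

lemma lTensor_piTranslate {δ : X →ₗ[ℂ] X ⊗[ℂ] A} (hδ : IsCounital δ) (x : X)
    (m : Γ.Inv ⊗[ℂ] Γ.InvExt) :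
    (LinearMap.applyₗ m ∘ₗ convAct Γ.varpi ∘ₗ Γ.piTranslate).lTensor X (δ x)
      = (LinearMap.applyₗ m ∘ₗ Γ.leftAct.toLinearMap ∘ₗ Γ.inc ∘ₗ Γ.pi).lTensor X (δ x)
        + x ⊗ₜ piMul Γ Γ.varpi m := by
  have h : LinearMap.applyₗ m ∘ₗ convAct Γ.varpi ∘ₗ Γ.piTranslate
      = LinearMap.applyₗ m ∘ₗ Γ.leftAct.toLinearMap ∘ₗ Γ.inc ∘ₗ Γ.pi
        + (Coalgebra.counit (R := ℂ) (A := A)).smulRight (piMul Γ Γ.varpi m) := by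
    rw [← sub_add_cancel Γ.piTranslate (Coalgebra.counit.smulRight Γ.piConv), ← actHom_comp_pi,
      LinearMap.comp_add, LinearMap.comp_add]
    congr 1
    refine LinearMap.ext fun a => ?_
    simp only [LinearMap.comp_apply, LinearMap.smulRight_apply, LinearMap.applyₗ_apply_apply,
      map_smul]
    rfl
  rw [h, LinearMap.lTensor_add, LinearMap.add_apply, hδ.lTensor_counit_smulRight]

lemma lTensor_contract_piMul (δ : X →ₗ[ℂ] X ⊗[ℂ] A) (x : X) (η : Γ.InvExt) :
    Γ.contract.lTensor X (piMul Γ δ (x ⊗ₜ η))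
      = TensorProduct.assoc ℂ X Γ.Inv Γ.InvExt (Γ.pi.lTensor X (δ x) ⊗ₜ η)
        - (LinearMap.applyₗ (Γ.contract η)
            ∘ₗ Γ.leftAct.toLinearMap ∘ₗ Γ.inc ∘ₗ Γ.pi).lTensor X (δ x) := by
  rw [piMul_tmul]
  generalize δ x = t
  induction t with
  | zero => simp
  | add t t' ht ht' =>
    simp only [map_add, TensorProduct.add_tmul, ht, ht']
    abel
  | tmul y a => simp [contract_inc_mul, TensorProduct.tmul_sub]

/-- The contraction `x ⊗ η ↦ x ⊗ t(η)`. -/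
def contractRight (X : Type*) [AddCommGroup X] [Module ℂ X] :
    X ⊗[ℂ] Γ.InvExt →ₗ[ℂ] (X ⊗[ℂ] Γ.Inv) ⊗[ℂ] Γ.InvExt :=
  (TensorProduct.assoc ℂ X Γ.Inv Γ.InvExt).symm.toLinearMap ∘ₗ Γ.contract.lTensor X

lemma contractRight_apply (z : X ⊗[ℂ] Γ.InvExt) :
    Γ.contractRight X z
      = (TensorProduct.assoc ℂ X Γ.Inv Γ.InvExt).symm (Γ.contract.lTensor X z) := rfl

lemma contractRight_comp_rTensor (f : X →ₗ[ℂ] Y) :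
    Γ.contractRight Y ∘ₗ f.rTensor Γ.InvExt
      = (f.rTensor Γ.Inv).rTensor Γ.InvExt ∘ₗ Γ.contractRight X := by
  refine TensorProduct.ext' fun x η => ?_
  simp only [LinearMap.comp_apply, contractRight_apply, LinearMap.rTensor_tmul,
    LinearMap.lTensor_tmul]
  generalize Γ.contract η = t
  induction t with
  | zero => simp
  | add t t' ht ht' => simp only [map_add, TensorProduct.tmul_add, ht, ht']
  | tmul θ ζ => simp

lemma comodD_tensorCoaction {δ : X →ₗ[ℂ] X ⊗[ℂ] A} (hδ : IsCounital δ) (x : X)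
    (m : Γ.Inv ⊗[ℂ] Γ.InvExt) :
    Γ.comodD (tensorCoaction δ Γ.varpi) ((TensorProduct.assoc ℂ X Γ.Inv Γ.InvExt).symm (x ⊗ₜ m))
      = (TensorProduct.assoc ℂ X Γ.Inv Γ.InvExt).symm
        ((LinearMap.applyₗ m ∘ₗ Γ.leftAct.toLinearMap ∘ₗ Γ.inc ∘ₗ Γ.pi).lTensor X (δ x)
          + x ⊗ₜ Γ.comodD Γ.varpi m) := by
  have hd : Γ.dInv.lTensor (X ⊗[ℂ] Γ.Inv)
      ((TensorProduct.assoc ℂ X Γ.Inv Γ.InvExt).symm (x ⊗ₜ m))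
      = (TensorProduct.assoc ℂ X Γ.Inv Γ.InvExt).symm (x ⊗ₜ Γ.dInv.lTensor Γ.Inv m) := by
    induction m with
    | zero => simp
    | add m n hm hn => simp only [map_add, TensorProduct.tmul_add, hm, hn]
    | tmul θ ζ => simp
  rw [comodD, LinearMap.add_apply, piMul_tensorCoaction, lTensor_piTranslate Γ hδ, hd, ← map_add,
    comodD, LinearMap.add_apply, TensorProduct.tmul_add, add_assoc]

lemma contractRight_comodD {δ : X →ₗ[ℂ] X ⊗[ℂ] A} (hδ : IsCounital δ) :
    Γ.contractRight X ∘ₗ Γ.comodD δ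
        + Γ.comodD (tensorCoaction δ Γ.varpi) ∘ₗ Γ.contractRight X
      = (Γ.pi.lTensor X ∘ₗ δ).rTensor Γ.InvExt := by
  refine TensorProduct.ext' fun x η => ?_
  have hη : Γ.contract (Γ.dInv η) = -Γ.comodD Γ.varpi (Γ.contract η) :=
    DFunLike.congr_fun Γ.contract_comp_dInv η
  simp only [LinearMap.add_apply, LinearMap.comp_apply, contractRight_apply,
    LinearMap.lTensor_tmul, LinearMap.rTensor_tmul, Γ.comodD_tensorCoaction hδ]
  rw [comodD, LinearMap.add_apply, map_add, lTensor_contract_piMul, LinearMap.lTensor_tmul,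
    LinearMap.lTensor_tmul, hη, TensorProduct.tmul_neg, ← map_add]
  refine (congrArg _ ?_).trans (LinearEquiv.symm_apply_apply _ _)
  abel

lemma contractRight_homotopy {δ : X →ₗ[ℂ] X ⊗[ℂ] A} {ε : Y →ₗ[ℂ] Y ⊗[ℂ] A} (hδ : IsCounital δ)
    {μ : X ⊗[ℂ] Γ.Inv →ₗ[ℂ] Y} (hμ : Intertwines (tensorCoaction δ Γ.varpi) ε μ) :
    (μ.rTensor Γ.InvExt ∘ₗ Γ.contractRight X) ∘ₗ Γ.comodD δ
        + Γ.comodD ε ∘ₗ (μ.rTensor Γ.InvExt ∘ₗ Γ.contractRight X)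
      = (μ ∘ₗ Γ.pi.lTensor X ∘ₗ δ).rTensor Γ.InvExt := by
  rw [← LinearMap.comp_assoc (Γ.contractRight X), Γ.comodD_comp_rTensor hμ, LinearMap.comp_assoc,
    LinearMap.comp_assoc, ← LinearMap.comp_add, Γ.contractRight_comodD hδ,
    ← LinearMap.rTensor_comp]

end Homotopy

end BicovariantCalculus

/-! ## Complete reducibility -/

section DualModule

variable {K A X Y : Type*} [Field K] [AddCommGroup A] [Module K A]
  [AddCommGroup X] [Module K X] [AddCommGroup Y] [Module K Y]

lemma eq_of_forall_rid_lTensor_eq {s t : X ⊗[K] A}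
    (h : ∀ f : A →ₗ[K] K,
      TensorProduct.rid K X (f.lTensor X s) = TensorProduct.rid K X (f.lTensor X t)) : s = t := by
  classical
  let b := Module.Basis.ofVectorSpace K A
  refine (TensorProduct.equivFinsuppOfBasisRight b).injective (Finsupp.ext fun i => ?_)
  rw [TensorProduct.equivFinsuppOfBasisRight_apply, TensorProduct.equivFinsuppOfBasisRight_apply]
  exact h (b.coord i)

variable [Coalgebra K A]
  {δ : X →ₗ[K] X ⊗[K] A} {hδ : IsCoassociative δ} {hδ' : IsCounital δ}
  {ε : Y →ₗ[K] Y ⊗[K] A} {hε : IsCoassociative ε} {hε' : IsCounital ε}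

/-- The action of linear functionals on a comodule, `f • x = ∑ f(cₖ) xₖ` for `δ(x) = ∑ xₖ ⊗ cₖ`. -/
def dualAct (hδ : IsCoassociative δ) (hδ' : IsCounital δ) :
    WithConv (A →ₗ[K] K) →ₐ[K] Module.End K X :=
  ((TensorProduct.rid K X).conjAlgEquiv K).toAlgHom.comp (convHom hδ hδ')

lemma dualAct_apply (f : WithConv (A →ₗ[K] K)) (x : X) :
    dualAct hδ hδ' f x = TensorProduct.rid K X (f.ofConv.lTensor X (δ x)) := by
  have h : dualAct hδ hδ' f x = TensorProduct.rid K X (convAct δ f (x ⊗ₜ 1)) := rfl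
  rw [h, convAct_tmul, LinearMap.mulRight_one, LinearMap.id_comp]

/-- The space `X` of a comodule as a module over the convolution algebra of linear functionals;
comodule maps become module maps and conversely. -/
@[nolint unusedArguments]
def DualModule (_hδ : IsCoassociative δ) (_hδ' : IsCounital δ) : Type _ := X

instance : AddCommGroup (DualModule hδ hδ') := inferInstanceAs (AddCommGroup X)

instance : Module K (DualModule hδ hδ') := inferInstanceAs (Module K X)

instance : Module (WithConv (A →ₗ[K] K)) (DualModule hδ hδ') :=
  Module.compHom X (dualAct hδ hδ').toRingHom

instance : IsScalarTower K (WithConv (A →ₗ[K] K)) (DualModule hδ hδ') :=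
  .of_algebraMap_smul fun c x => LinearMap.congr_fun ((dualAct hδ hδ').commutes c) x

/-- The identity map, which forgets the module structure over the linear functionals. -/
def DualModule.equiv (hδ : IsCoassociative δ) (hδ' : IsCounital δ) : DualModule hδ hδ' ≃ₗ[K] X :=
  .refl K X

lemma Intertwines.map_dualAct {g : X →ₗ[K] Y} (hg : Intertwines δ ε g)
    (f : WithConv (A →ₗ[K] K)) (x : X) : g (dualAct hδ hδ' f x) = dualAct hε hε' f (g x) := by
  rw [dualAct_apply, dualAct_apply, hg, lTensor_rTensor_comm, rid_rTensor]

/-- A comodule map, regarded as a module map. -/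
def Intertwines.toDualHom {g : X →ₗ[K] Y} (hg : Intertwines δ ε g) :
    DualModule hδ hδ' →ₗ[WithConv (A →ₗ[K] K)] DualModule hε hε' where
  toFun x := (DualModule.equiv hε hε').symm (g (DualModule.equiv hδ hδ' x))
  map_add' x y := by simp only [map_add]
  map_smul' f x := (DualModule.equiv hε hε').injective (hg.map_dualAct f _)

/-- The linear map underlying a map of modules over the linear functionals. -/
def DualModule.toLinearMap
    (h : DualModule hδ hδ' →ₗ[WithConv (A →ₗ[K] K)] DualModule hε hε') : X →ₗ[K] Y :=
  (equiv hε hε').toLinearMap ∘ₗ h.restrictScalars K ∘ₗ (equiv hδ hδ').symm.toLinearMap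

lemma DualModule.intertwines_toLinearMap
    (h : DualModule hδ hδ' →ₗ[WithConv (A →ₗ[K] K)] DualModule hε hε') :
    Intertwines δ ε (toLinearMap h) := fun x =>
  eq_of_forall_rid_lTensor_eq fun f => by
    rw [lTensor_rTensor_comm, rid_rTensor, ← ofConv_toConv f, ← dualAct_apply (hδ := hδ)
      (hδ' := hδ'), ← dualAct_apply (hδ := hε) (hδ' := hε')]
    exact congrArg (equiv hε hε') (h.map_smul (toConv f) ((equiv hδ hδ').symm x)).symm

lemma exists_retraction_of_isSemisimpleModule
    [IsSemisimpleModule (WithConv (A →ₗ[K] K)) (DualModule hε hε')] (hδ : IsCoassociative δ)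
    (hδ' : IsCounital δ) {s : X →ₗ[K] Y} (hs : Intertwines δ ε s) (hi : Function.Injective s) :
    ∃ r : Y →ₗ[K] X, Intertwines ε δ r ∧ r ∘ₗ s = .id := by
  obtain ⟨h, hh⟩ := IsSemisimpleModule.extension_property
    (hs.toDualHom : DualModule hδ hδ' →ₗ[_] DualModule hε hε') hi .id
  exact ⟨DualModule.toLinearMap h, DualModule.intertwines_toLinearMap h,
    LinearMap.ext fun x => LinearMap.congr_fun hh x⟩

end DualModule

namespace UnitaryRep

variable {A : Type*} [Ring A] [HopfAlgebra ℂ A] [StarRing A] {n : ℕ} (u : UnitaryRep A n)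

lemma antipode_mat (i j : Fin n) : HopfAlgebra.antipode ℂ (u.mat i j) = star (u.mat j i) := by
  have sum_antipode_mul (p q : Fin n) :
      ∑ k, HopfAlgebra.antipode ℂ (u.mat p k) * u.mat k q = if p = q then 1 else 0 := by
    simpa [u.comul_mat, u.counit_mat, apply_ite] using
      HopfAlgebra.mul_antipode_rTensor_comul_apply (R := ℂ) (u.mat p q)
  calc HopfAlgebra.antipode ℂ (u.mat i j)
      = ∑ p, HopfAlgebra.antipode ℂ (u.mat i p) * ∑ q, u.mat p q * star (u.mat j q) := by
        simp [sum_mul_star]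
    _ = ∑ q, (∑ p, HopfAlgebra.antipode ℂ (u.mat i p) * u.mat p q) * star (u.mat j q) := by
        simp only [Finset.mul_sum, Finset.sum_mul, mul_assoc]
        exact Finset.sum_comm
    _ = star (u.mat j i) := by simp [sum_antipode_mul]

lemma coaction_single (i : Fin n) :
    u.coaction (Pi.single i 1) = ∑ j, (Pi.single j (1 : ℂ)) ⊗ₜ[ℂ] u.mat j i := by
  rw [← Pi.basisFun_apply]
  exact (Pi.basisFun ℂ (Fin n)).constr_basis ..

lemma isCoassociative_coaction : IsCoassociative u.coaction :=
  LinearMap.congr_fun (f := (TensorProduct.assoc ℂ _ A A).toLinearMap ∘ₗ u.coaction.rTensor A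
      ∘ₗ u.coaction) (g := (Coalgebra.comul (R := ℂ)).lTensor _ ∘ₗ u.coaction) <|
    (Pi.basisFun ℂ (Fin n)).ext fun i => by
      simp only [Pi.basisFun_apply, LinearMap.comp_apply, coaction_single, map_sum,
        LinearMap.rTensor_tmul, LinearMap.lTensor_tmul, LinearEquiv.coe_coe, u.comul_mat,
        TensorProduct.sum_tmul, TensorProduct.tmul_sum, TensorProduct.assoc_tmul]
      exact Finset.sum_comm

lemma isCounital_coaction : IsCounital u.coaction :=
  LinearMap.congr_fun (f := (TensorProduct.rid ℂ _).toLinearMap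
      ∘ₗ (Coalgebra.counit (R := ℂ)).lTensor _ ∘ₗ u.coaction) (g := .id) <|
    (Pi.basisFun ℂ (Fin n)).ext fun i => by simp [coaction_single, u.counit_mat]

/-- The Hilbert space `H_u` as a module over the linear functionals on `A`. -/
abbrev DualModule : Type :=
  QPB.DualModule u.isCoassociative_coaction u.isCounital_coaction

/-- The functional `f ↦ f*`, `f*(a) = conj (f (κ(a)*))`. On a unitary representation it acts as the
adjoint of `f`. -/
def adjointFunctional [StarModule ℂ A] (f : A →ₗ[ℂ] ℂ) : A →ₗ[ℂ] ℂ where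
  toFun a := star (f (star (HopfAlgebra.antipode ℂ a)))
  map_add' a b := by simp
  map_smul' c a := by simp

lemma adjointFunctional_mat [StarModule ℂ A] (f : A →ₗ[ℂ] ℂ) (i j : Fin n) :
    adjointFunctional f (u.mat i j) = star (f (u.mat j i)) := by
  simp [adjointFunctional, u.antipode_mat]

/-- The identity map of `H_u`, with its inner product. -/
def toEuclidean : u.DualModule ≃ₗ[ℂ] EuclideanSpace ℂ (Fin n) :=
  DualModule.equiv _ _ ≪≫ₗ (WithLp.linearEquiv 2 ℂ (Fin n → ℂ)).symm

lemma toEuclidean_smul (f : WithConv (A →ₗ[ℂ] ℂ)) (x : u.DualModule) :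
    u.toEuclidean (f • x)
      = WithLp.toLp 2 ((u.mat.map f.ofConv).mulVec (WithLp.ofLp (u.toEuclidean x))) := by
  have h : dualAct u.isCoassociative_coaction u.isCounital_coaction f
      = (u.mat.map f.ofConv).mulVecLin :=
    (Pi.basisFun ℂ (Fin n)).ext fun i => funext fun j => by
      simp [dualAct_apply, coaction_single, Finset.sum_apply, Pi.single_apply]
  exact congrArg (WithLp.toLp 2) (LinearMap.congr_fun h _)

lemma inner_smul_toEuclidean [StarModule ℂ A] (f : WithConv (A →ₗ[ℂ] ℂ)) (x y : u.DualModule) :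
    inner ℂ (u.toEuclidean x) (u.toEuclidean (f • y))
      = inner ℂ (u.toEuclidean (toConv (adjointFunctional f.ofConv) • x)) (u.toEuclidean y) := by
  have h : u.mat.map (adjointFunctional f.ofConv) = (u.mat.map f.ofConv).conjTranspose :=
    Matrix.ext fun i j => u.adjointFunctional_mat f.ofConv i j
  simp only [EuclideanSpace.inner_eq_star_dotProduct, toEuclidean_smul, h,
    Matrix.star_mulVec, Matrix.conjTranspose_conjTranspose]
  exact (dotProduct_comm ..).trans ((Matrix.dotProduct_mulVec ..).trans (dotProduct_comm ..))

lemma exists_isCompl [StarModule ℂ A] (W : Submodule (WithConv (A →ₗ[ℂ] ℂ)) u.DualModule) :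
    ∃ C, IsCompl W C := by
  let S : Submodule ℂ (EuclideanSpace ℂ (Fin n)) :=
    (W.restrictScalars ℂ).map u.toEuclidean.toLinearMap
  let C : Submodule (WithConv (A →ₗ[ℂ] ℂ)) u.DualModule :=
    { Sᗮ.comap u.toEuclidean.toLinearMap with
      smul_mem' := fun f x hx => (Submodule.mem_orthogonal _ _).2 <| by
        rintro _ ⟨w, hw, rfl⟩
        exact (u.inner_smul_toEuclidean f w x).trans
          ((Submodule.mem_orthogonal _ _).1 hx _ ⟨_, W.smul_mem _ hw, rfl⟩) }
  refine ⟨C, Submodule.disjoint_def.2 fun x hx hx' => ?_,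
    Submodule.codisjoint_iff_exists_add_eq.2 fun x => ?_⟩
  · exact u.toEuclidean.map_eq_zero_iff.1 (inner_self_eq_zero.1
      (Submodule.inner_right_of_mem_orthogonal (Submodule.mem_map_of_mem hx) hx'))
  · obtain ⟨_, ⟨y, hy, rfl⟩, z, hz, h⟩ := S.exists_add_mem_mem_orthogonal (u.toEuclidean x)
    refine ⟨y, u.toEuclidean.symm z, hy, ?_, u.toEuclidean.injective ?_⟩
    · exact (congrArg (· ∈ Sᗮ) (u.toEuclidean.apply_symm_apply z)).mpr hz
    · rw [map_add, LinearEquiv.apply_symm_apply, h]; rfl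

instance [StarModule ℂ A] : IsSemisimpleModule (WithConv (A →ₗ[ℂ] ℂ)) u.DualModule :=
  (isSemisimpleModule_iff _ _).2 ⟨u.exists_isCompl⟩

/-- The map `e i ↦ u j i` of `H_u` into `A`. -/
def rowMap (j : Fin n) : (Fin n → ℂ) →ₗ[ℂ] A := (Pi.basisFun ℂ (Fin n)).constr ℂ (u.mat j)

lemma rowMap_single (j i : Fin n) : u.rowMap j (Pi.single i 1) = u.mat j i := by
  rw [← Pi.basisFun_apply]
  exact (Pi.basisFun ℂ (Fin n)).constr_basis ..

lemma intertwines_rowMap (j : Fin n) :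
    Intertwines u.coaction (Coalgebra.comul (R := ℂ)) (u.rowMap j) :=
  LinearMap.congr_fun (f := Coalgebra.comul ∘ₗ u.rowMap j)
      (g := (u.rowMap j).rTensor A ∘ₗ u.coaction) <|
    (Pi.basisFun ℂ (Fin n)).ext fun i => by
      simp [rowMap_single, coaction_single, u.comul_mat]

end UnitaryRep

section Cosemisimple

variable {A : Type*} [Ring A] [HopfAlgebra ℂ A] [StarRing A] [StarModule ℂ A]

lemma isSemisimpleModule_comul (hA : Submodule.span ℂ (matrixCoefficients A) = ⊤) :
    IsSemisimpleModule (WithConv (A →ₗ[ℂ] ℂ)) (DualModule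
      (isCoassociative_comul (R := ℂ) (A := A)) isCounital_comul) := by
  let p (q : Σ n : ℕ, UnitaryRep A n × Fin n) : Submodule (WithConv (A →ₗ[ℂ] ℂ)) (DualModule
      (isCoassociative_comul (R := ℂ) (A := A)) isCounital_comul) :=
    LinearMap.range ((q.2.1.intertwines_rowMap q.2.2).toDualHom :
      q.2.1.DualModule →ₗ[WithConv (A →ₗ[ℂ] ℂ)] _)
  refine isSemisimpleModule_of_isSemisimpleModule_submodule' (p := p)
    (fun q => IsSemisimpleModule.range _) ((Submodule.restrictScalars_eq_top_iff ℂ _ _).1 ?_)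
  refine top_unique (hA.symm.trans_le (Submodule.span_le.2 ?_))
  rintro _ ⟨n, u, j, i, rfl⟩
  exact le_iSup p ⟨n, u, j⟩ ⟨(Pi.single i 1 : Fin n → ℂ), u.rowMap_single j i⟩

end Cosemisimple

/-! ## Equivariant retractions -/

section CoefficientMap

variable {R A X Y : Type*} [CommSemiring R] [AddCommMonoid A] [Module R A]
  [AddCommMonoid X] [Module R X] [AddCommMonoid Y] [Module R Y]

/-- The matrix coefficients `x ↦ ∑ f(xₖ) cₖ` of a coaction `δ(x) = ∑ xₖ ⊗ cₖ` against a linear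
functional `f`. -/
def coefficientMap (δ : X →ₗ[R] X ⊗[R] A) (f : X →ₗ[R] R) : X →ₗ[R] A :=
  (TensorProduct.lid R A).toLinearMap ∘ₗ f.rTensor A ∘ₗ δ

lemma Intertwines.coefficientMap_comp {δ : X →ₗ[R] X ⊗[R] A} {ε : Y →ₗ[R] Y ⊗[R] A}
    {g : X →ₗ[R] Y} (hg : Intertwines δ ε g) (f : Y →ₗ[R] R) :
    coefficientMap ε f ∘ₗ g = coefficientMap δ (f ∘ₗ g) :=
  LinearMap.ext fun x => by
    simp only [coefficientMap, LinearMap.comp_apply, hg x, LinearMap.rTensor_comp]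

variable [Coalgebra R A] {δ : X →ₗ[R] X ⊗[R] A}

lemma IsCounital.counit_coefficientMap (hδ : IsCounital δ) (f : X →ₗ[R] R) (x : X) :
    Coalgebra.counit (R := R) (coefficientMap δ f x) = f x := by
  conv_rhs => rw [← hδ x]
  simp only [coefficientMap, LinearMap.comp_apply]
  generalize δ x = t
  induction t with
  | zero => simp
  | add t t' ht ht' => simp only [map_add, ht, ht']
  | tmul x a => simp [mul_comm]

lemma IsCoassociative.intertwines_coefficientMap (hδ : IsCoassociative δ) (f : X →ₗ[R] R) :
    Intertwines δ Coalgebra.comul (coefficientMap δ f) := fun x => by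
  let L : X ⊗[R] (A ⊗[R] A) →ₗ[R] A ⊗[R] A :=
    (TensorProduct.lid R (A ⊗[R] A)).toLinearMap ∘ₗ f.rTensor (A ⊗[R] A)
  have comul_lid (t : X ⊗[R] A) : Coalgebra.comul (TensorProduct.lid R A (f.rTensor A t))
      = L (Coalgebra.comul.lTensor X t) := by
    induction t with
    | zero => simp
    | add t t' ht ht' => simp only [map_add, ht, ht']
    | tmul x a => simp [L]
  have rTensor_eq (t : X ⊗[R] A) : (coefficientMap δ f).rTensor A t
      = L (TensorProduct.assoc R X A A (δ.rTensor A t)) := by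
    induction t with
    | zero => simp
    | add t t' ht ht' => simp only [map_add, ht, ht']
    | tmul x a =>
      simp only [LinearMap.rTensor_tmul, coefficientMap, LinearMap.comp_apply]
      generalize δ x = s
      induction s with
      | zero => simp
      | add s s' hs hs' => simp only [map_add, TensorProduct.add_tmul, hs, hs']
      | tmul y b => simp [L, TensorProduct.smul_tmul']
  rw [rTensor_eq, hδ, ← comul_lid]
  rfl

end CoefficientMap

namespace UnitaryRep.IsIrreducible

variable {A : Type*} [Ring A] [HopfAlgebra ℂ A] [StarRing A] {n : ℕ} {u : UnitaryRep A n}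
  {X : Type*} [AddCommGroup X] [Module ℂ X] {ε : X →ₗ[ℂ] X ⊗[ℂ] A} {f : (Fin n → ℂ) →ₗ[ℂ] X}

lemma injective (hu : u.IsIrreducible) (hf : Intertwines u.coaction ε f) (hne : f ≠ 0) :
    Function.Injective f := by
  rw [← LinearMap.ker_eq_bot]
  refine (hu.2 f.ker fun x hx => ?_).resolve_right fun h => hne (LinearMap.ker_eq_top.1 h)
  refine (Module.Flat.rTensor_exact A (LinearMap.exact_subtype_ker_map f) _).1 ?_
  rw [← hf, LinearMap.mem_ker.1 hx, map_zero]

/-- The matrix coefficients against a functional that does not vanish on the image of `f` embed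
`H_u` into `A`, which is cosemisimple; the embedding factors through `f`. -/
lemma exists_retraction [StarModule ℂ A] (hA : Submodule.span ℂ (matrixCoefficients A) = ⊤)
    (hu : u.IsIrreducible) (hε : IsCoassociative ε) (hf : Intertwines u.coaction ε f)
    (hne : f ≠ 0) : ∃ r : X →ₗ[ℂ] Fin n → ℂ, Intertwines ε u.coaction r ∧ r ∘ₗ f = .id := by
  obtain ⟨x, hx⟩ := DFunLike.ne_iff.1 hne
  obtain ⟨y, hy⟩ : ∃ y : Module.Dual ℂ X, y (f x) ≠ 0 := by
    simpa using (Module.forall_dual_apply_eq_zero_iff ℂ (f x)).not.2 hx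
  have hs := (hε.intertwines_coefficientMap y).comp hf
  have hs_ne : coefficientMap ε y ∘ₗ f ≠ 0 := fun h => hy <| by
    rw [hf.coefficientMap_comp] at h
    rw [← LinearMap.comp_apply, ← u.isCounital_coaction.counit_coefficientMap, h,
      LinearMap.zero_apply, map_zero]
  have := isSemisimpleModule_comul hA
  obtain ⟨r, hr, hrs⟩ := exists_retraction_of_isSemisimpleModule u.isCoassociative_coaction
    u.isCounital_coaction hs (hu.injective hs hs_ne)
  exact ⟨r ∘ₗ coefficientMap ε y, hr.comp (hε.intertwines_coefficientMap y), hrs⟩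

end UnitaryRep.IsIrreducible

/-! ## Acyclicity of `Λ_u` -/

section AdjointCoaction

variable {A X : Type*} [Ring A] [HopfAlgebra ℂ A] [AddCommMonoid X] [Module ℂ X]

lemma tensorCoaction_ad (δ : X →ₗ[ℂ] X ⊗[ℂ] A) (t : X ⊗[ℂ] A) :
    TensorProduct.assoc ℂ X A A (tensorCoaction δ (ad A) t)
      = adTwist.lTensor X (TensorProduct.assoc ℂ X A A (δ.rTensor A t)) := by
  induction t with
  | zero => simp
  | add t t' ht ht' => simp only [map_add, ht, ht']
  | tmul x a =>
    rw [tensorCoaction_tmul, LinearMap.rTensor_tmul]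
    generalize δ x = s
    induction s with
    | zero => simp
    | add s s' hs hs' => simp only [map_add, TensorProduct.add_tmul, hs, hs']
    | tmul y b =>
      simp only [TensorProduct.assoc_tmul, LinearMap.lTensor_tmul, adTwist,
        TensorProduct.lift.tmul, LinearMap.mk₂_apply]
      generalize ad A a = r
      induction r with
      | zero => simp
      | add r r' hr hr' => simp only [map_add, TensorProduct.tmul_add, mul_add, hr, hr']
      | tmul c d => simp [tensorMul_tmul]

/-- This is `∑ c₁ · ad(c₂) = φ(c)` applied to the coefficients of `δ`. -/
lemma IsCoassociative.intertwines_self_tensorCoaction_ad {δ : X →ₗ[ℂ] X ⊗[ℂ] A}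
    (hδ : IsCoassociative δ) :
    Intertwines δ (QPB.tensorCoaction δ (ad A)) δ := fun x => by
  have hcomul : adTwist ∘ₗ Coalgebra.comul (R := ℂ) (A := A) = Coalgebra.comul :=
    LinearMap.ext adTwist_comul
  apply (TensorProduct.assoc ℂ X A A).injective
  rw [tensorCoaction_ad, hδ, ← LinearMap.lTensor_comp_apply, hcomul]

end AdjointCoaction

lemma isAcyclic_of_homotopy {X : Type*} [AddCommGroup X] [Module ℂ X] {d h : X →ₗ[ℂ] X}
    (hd : d * d = 0) (hh : h ∘ₗ d + d ∘ₗ h = .id) : IsAcyclic d := by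
  refine le_antisymm (fun z hz => ?_) ?_
  · have hz' := DFunLike.congr_fun hh z
    rw [LinearMap.add_apply, LinearMap.comp_apply, LinearMap.mem_ker.1 hz, map_zero,
      zero_add] at hz'
    exact ⟨h z, hz'⟩
  · rintro _ ⟨z, rfl⟩
    exact DFunLike.congr_fun hd z

section Acyclic

variable {A : Type*} [Ring A] [HopfAlgebra ℂ A] [StarRing A] (Γ : BicovariantCalculus A)

namespace BicovariantCalculus

lemma intertwines_lTensor_pi_comp {X : Type*} [AddCommGroup X] [Module ℂ X]
    {δ : X →ₗ[ℂ] X ⊗[ℂ] A} (hδ : IsCoassociative δ) :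
    Intertwines δ (tensorCoaction δ Γ.varpi) (Γ.pi.lTensor X ∘ₗ δ) :=
  (Intertwines.lTensor Γ.varpi_pi δ).comp hδ.intertwines_self_tensorCoaction_ad

lemma lTensor_pi_comp_coaction_ne_zero {n : ℕ} {u : UnitaryRep A n}
    (h : ∃ i j, Γ.pi (u.mat i j) ≠ 0) : Γ.pi.lTensor _ ∘ₗ u.coaction ≠ 0 := by
  obtain ⟨i, j, hij⟩ := h
  intro h
  have hj : (LinearMap.proj i).rTensor Γ.Inv (Γ.pi.lTensor _ (u.coaction (Pi.single j 1))) = 0 := by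
    rw [← LinearMap.comp_apply (Γ.pi.lTensor _), h, LinearMap.zero_apply, map_zero]
  refine hij ?_
  simpa [u.coaction_single, Pi.single_apply] using congrArg (TensorProduct.lid ℂ Γ.Inv) hj

lemma contract_word (l : List Γ.Inv) : Γ.contract (Γ.word l) = ∑ i : Fin l.length,
    (-1 : ℂ) ^ (i : ℕ) • Γ.leftAct (Γ.word (l.take i)) (l.get i ⊗ₜ Γ.word (l.drop (i + 1))) := by
  induction l with
  | nil => simp [word, contract_one]
  | cons x l ih =>
    have hnil : Γ.word [] = 1 := rfl
    refine Eq.trans ?_ (Fin.sum_univ_succ (n := l.length) _).symm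
    rw [word_cons, contract_inc_mul, ih, map_sum, sub_eq_add_neg]
    refine congrArg₂ (· + ·) (by simp [hnil]) ((Finset.sum_neg_distrib _).symm.trans
      (Finset.sum_congr rfl fun i _ => ?_))
    simp only [map_smul, Fin.val_succ, List.take_succ_cons, List.drop_succ_cons,
      word_cons, map_mul, Module.End.mul_apply, pow_succ, mul_neg, mul_one]
    exact (neg_smul _ _).symm

end BicovariantCalculus

/-- The comodule map `x ↦ ∑ xₖ ⊗ π(cₖ)` is injective on `H_u`, and an equivariant retraction of it
turns the homotopy of `contractRight_homotopy` into a contraction of `Λ_u`. -/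
theorem UnitaryRep.IsIrreducible.isAcyclic [StarModule ℂ A]
    (hA : Submodule.span ℂ (matrixCoefficients A) = ⊤) {n : ℕ} {u : UnitaryRep A n}
    (hu : u.IsIrreducible) (hpi : ∃ i j, Γ.pi (u.mat i j) ≠ 0) : IsAcyclic (dLam Γ u) := by
  have hdLam : dLam Γ u = Γ.comodD u.coaction := add_comm _ _
  obtain ⟨r, hr, hr_id⟩ := hu.exists_retraction hA
    (u.isCoassociative_coaction.tensorCoaction Γ.isCoassociative_varpi)
    (Γ.intertwines_lTensor_pi_comp u.isCoassociative_coaction)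
    (Γ.lTensor_pi_comp_coaction_ne_zero hpi)
  have hhomotopy := Γ.contractRight_homotopy u.isCounital_coaction hr
  rw [hr_id, LinearMap.rTensor_id] at hhomotopy
  rw [hdLam]
  exact isAcyclic_of_homotopy (Γ.comodD_mul_self u.isCoassociative_coaction) hhomotopy

end Acyclic

/-! ## Tensorial forms -/

lemma BicovariantCalculus.pStar_gradeInv {A : Type*} [Ring A] [HopfAlgebra ℂ A] [StarRing A]
    [StarModule ℂ A] (Γ : BicovariantCalculus A) (x : Γ.Env) :
    Γ.pStar (gradeInv Γ.envGrading x) = Γ.pStar x := by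
  have h : Γ.pStar.comp (gradeInvHom Γ.envGrading) = Γ.pStar := by
    refine Γ.env_hom_ext (fun a => ?_) (fun a => ?_)
    · have h0 : gradeInvHom Γ.envGrading (Γ.incA a) = Γ.incA a :=
        (gradeInv_of_mem _ (Γ.incA_mem a)).trans (by simp)
      rw [AlgHom.comp_apply, h0]
    · have h1 : gradeInvHom Γ.envGrading (Γ.dA a) = -Γ.dA a :=
        (gradeInv_of_mem _ (Γ.dA_mem a)).trans (by simp)
      rw [AlgHom.comp_apply, h1, map_neg, Γ.pStar_dA, neg_zero]
  exact DFunLike.congr_fun h x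

lemma gradeInv_gradeInv {Ω : Type*} [Ring Ω] [Algebra ℂ Ω] (gr : ℕ → Submodule ℂ Ω)
    [GradedAlgebra gr] (w : Ω) : gradeInv gr (gradeInv gr w) = w := by
  induction w using DirectSum.Decomposition.inductionOn gr with
  | zero => simp
  | add x y hx hy => simp only [map_add, hx, hy]
  | homogeneous x =>
    rw [gradeInv_of_mem gr x.2, map_smul, gradeInv_of_mem gr x.2, smul_smul, ← mul_pow, neg_mul_neg,
      one_mul, one_pow, one_smul]

namespace BundleCalculus

variable {V B A : Type*} [Ring V] [Algebra ℂ V] [StarRing V]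
    [Ring B] [Algebra ℂ B] [StarRing B] [StarModule ℂ B]
    [Ring A] [HopfAlgebra ℂ A] [StarRing A] [StarModule ℂ A]
    {P : QuantumPrincipalBundle V B A} {Γ : BicovariantCalculus A}
    {Ω : Type*} [Ring Ω] [Algebra ℂ Ω] {gr : ℕ → Submodule ℂ Ω} [GradedAlgebra gr]
    (C : BundleCalculus P Γ gr)

lemma intertwines_inc :
    Intertwines P.F.toAlgHom.toLinearMap C.Fwedge C.inc.toLinearMap := fun b => by
  have h : Γ.pStar.toLinearMap ∘ₗ Γ.incA.toLinearMap = LinearMap.id := LinearMap.ext Γ.pStar_incA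
  refine (congrArg (Γ.pStar.toLinearMap.lTensor Ω) (C.FhatLin_inc b)).trans ?_
  rw [← LinearMap.comp_apply, LinearMap.lTensor_comp_map, h]
  rfl

lemma intertwines_d_inc :
    Intertwines P.F.toAlgHom.toLinearMap C.Fwedge (C.d ∘ₗ C.inc.toLinearMap) := fun b => by
  have h : Γ.pStar.toLinearMap ∘ₗ Γ.incA.toLinearMap = LinearMap.id := LinearMap.ext Γ.pStar_incA
  have h' : Γ.pStar.toLinearMap ∘ₗ Γ.dA = 0 := LinearMap.ext Γ.pStar_dA
  refine (congrArg (Γ.pStar.toLinearMap.lTensor Ω) (C.FhatLin_d_inc b)).trans ?_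
  rw [map_add, ← LinearMap.comp_apply, LinearMap.lTensor_comp_map, h, ← LinearMap.comp_apply,
    LinearMap.lTensor_comp_map, h', TensorProduct.map_zero_right, LinearMap.zero_apply, add_zero]
  rfl

lemma Fwedge_mul (v w : Ω) : C.Fwedge (v * w) = C.Fwedge v * C.Fwedge w := by
  simp only [Fwedge_eq, map_mul]

lemma isCounital_Fwedge : IsCounital C.Fwedge := by
  have hP : IsCounital P.F.toAlgHom.toLinearMap := P.counit
  have hFwedge (w : Ω) : (counitRight ℂ A Ω).comp ((projTensor Γ gr).comp C.Fhat) w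
      = TensorProduct.rid ℂ Ω (Coalgebra.counit.lTensor Ω (C.Fwedge w)) := by
    rw [Fwedge_eq, ← counitRight_apply]
    rfl
  have hid : (counitRight ℂ A Ω).comp ((projTensor Γ gr).comp C.Fhat) = AlgHom.id ℂ Ω :=
    C.hom_ext (fun b => (hFwedge _).trans (hP.rid_lTensor_counit C.intertwines_inc b))
      fun b => (hFwedge _).trans (hP.rid_lTensor_counit C.intertwines_d_inc b)
  exact fun w => (hFwedge w).symm.trans (DFunLike.congr_fun hid w)

lemma intertwines_gradeInv : Intertwines C.Fwedge C.Fwedge (gradeInv gr) := fun w => by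
  have h : Γ.pStar.toLinearMap ∘ₗ gradeInv Γ.envGrading = Γ.pStar.toLinearMap :=
    LinearMap.ext Γ.pStar_gradeInv
  rw [Fwedge, LinearMap.comp_apply, FhatLin_gradeInv, ← LinearMap.comp_apply,
    LinearMap.lTensor_comp_map, h, LinearMap.comp_apply,
    ← LinearMap.comp_apply (LinearMap.rTensor A _), LinearMap.rTensor_comp_lTensor]

lemma isCounital_horCoaction : IsCounital C.horCoaction :=
  C.isCounital_Fwedge.of_injective (f := C.hor.val.toLinearMap)
    (fun w => (C.horCoaction_coe w).symm) Subtype.val_injective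

lemma horCoaction_mul (v w : C.hor) :
    C.horCoaction (v * w) = C.horCoaction v * C.horCoaction w := by
  apply C.horInc_injective
  have hmul : ∀ s t : C.hor ⊗[ℂ] A, C.hor.val.toLinearMap.rTensor A (s * t)
      = C.hor.val.toLinearMap.rTensor A s * C.hor.val.toLinearMap.rTensor A t :=
    map_mul (Algebra.TensorProduct.map C.hor.val (AlgHom.id ℂ A))
  rw [hmul, horCoaction_coe, horCoaction_coe, horCoaction_coe, ← Fwedge_mul]
  rfl

lemma intertwines_horCoaction {X : Type*} [AddCommGroup X] [Module ℂ X] {δ : X →ₗ[ℂ] X ⊗[ℂ] A}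
    {f : X →ₗ[ℂ] C.hor} (hf : Intertwines δ C.Fwedge (C.hor.val.toLinearMap ∘ₗ f)) :
    Intertwines δ C.horCoaction f := fun x => by
  apply C.horInc_injective
  rw [horCoaction_coe, ← LinearMap.rTensor_comp_apply]
  exact hf x

lemma intertwines_horInv : Intertwines C.horCoaction C.horCoaction C.horInv :=
  C.intertwines_horCoaction
    (C.intertwines_gradeInv.comp fun w => (C.horCoaction_coe w).symm)

lemma horInv_comp_horInv : C.horInv ∘ₗ C.horInv = LinearMap.id :=
  LinearMap.ext fun w => Subtype.ext (gradeInv_gradeInv gr w)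

lemma dvh_eq : C.dvh = Γ.comodD C.horCoaction ∘ₗ C.horInv.rTensor Γ.InvExt := rfl

lemma dvh_comp_rTensor {n m : ℕ} (u : UnitaryRep A n) {f : (Fin n → ℂ) →ₗ[ℂ] C.hor}
    (hf : Intertwines u.coaction C.horCoaction f) (hm : ∀ x, (f x : Ω) ∈ gr m) :
    C.dvh ∘ₗ f.rTensor Γ.InvExt = (-1 : ℂ) ^ m • (f.rTensor Γ.InvExt ∘ₗ dLam Γ u) := by
  have hD : dLam Γ u = Γ.comodD u.coaction := add_comm _ _
  have hf_deg : C.horInv ∘ₗ f = (-1 : ℂ) ^ m • f := LinearMap.ext fun x => C.horInv_of_mem (hm x)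
  rw [dvh_eq, LinearMap.comp_assoc, ← LinearMap.rTensor_comp, hf_deg, LinearMap.rTensor_smul,
    LinearMap.comp_smul, hD, Γ.comodD_comp_rTensor hf]

namespace TensorialForm

variable {C} {p : ℕ} (lam : C.TensorialForm p)

/-- The map `φ ⊗ ϑ ↦ φ λ(ϑ)`. -/
def mulMap : C.hor ⊗[ℂ] Γ.Inv →ₗ[ℂ] C.hor :=
  LinearMap.mul' ℂ C.hor ∘ₗ lam.toHor.lTensor C.hor

lemma mulMap_tmul (φ : C.hor) (θ : Γ.Inv) : lam.mulMap (φ ⊗ₜ θ) = φ * lam.toHor θ := rfl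

lemma intertwines_mulMap :
    Intertwines (tensorCoaction C.horCoaction Γ.varpi) C.horCoaction lam.mulMap :=
  (intertwines_mul' C.horCoaction_mul).comp
    ((C.intertwines_horCoaction (f := lam.toHor) lam.intertwines).lTensor C.horCoaction)

lemma horInv_comp_mulMap :
    C.horInv ∘ₗ lam.mulMap = (-1 : ℂ) ^ p • (lam.mulMap ∘ₗ C.horInv.rTensor Γ.Inv) := by
  refine TensorProduct.ext' fun φ θ => ?_
  have hθ : C.horInv (lam.toHor θ) = (-1 : ℂ) ^ p • lam.toHor θ :=
    C.horInv_of_mem (lam.mem_degree θ)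
  simp only [LinearMap.comp_apply, LinearMap.smul_apply, LinearMap.rTensor_tmul, mulMap_tmul]
  rw [← mul_smul_comm, ← hθ]
  exact Subtype.ext (gradeInv_mul gr _ _)

lemma S_eq_rTensor :
    lam.S = (lam.mulMap ∘ₗ Γ.pi.lTensor C.hor ∘ₗ C.horCoaction).rTensor Γ.InvExt := by
  rw [S, mulMap, LinearMap.lTensor_comp]
  rfl

lemma IsT.unique {lam : C.TensorialForm p} {T T' : C.vh →ₗ[ℂ] C.vh} (hT : lam.IsT T)
    (hT' : lam.IsT T') : T = T' := by
  refine TensorProduct.ext (LinearMap.ext fun φ => LinearMap.ext_on Γ.span_word ?_)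
  rintro _ ⟨l, rfl⟩
  exact (hT φ l).trans (hT' φ l).symm

/-- The operator `φ ⊗ η ↦ ∑ φ λ(ϑ) ⊗ ζ`, where `t(η) = ∑ ϑ ⊗ ζ`; it is `T_λ` without the sign
`(-1)^∂φ`. -/
def contractMap : C.vh →ₗ[ℂ] C.vh := lam.mulMap.rTensor Γ.InvExt ∘ₗ Γ.contractRight C.hor

/-- The operator `T_λ`, written without words in `Γ_inv`. -/
def T : C.vh →ₗ[ℂ] C.vh := lam.contractMap ∘ₗ C.horInv.rTensor Γ.InvExt

lemma isT_T : lam.IsT lam.T := by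
  intro φ l
  simp only [T, contractMap, LinearMap.comp_apply, LinearMap.rTensor_tmul,
    BicovariantCalculus.contractRight_apply, LinearMap.lTensor_tmul, Γ.contract_word,
    TensorProduct.tmul_sum, map_sum, TensorProduct.tmul_smul, map_smul]
  refine Finset.sum_congr rfl fun i _ => ?_
  congr 1
  rw [termT, BicovariantCalculus.leftAct_apply, convAct_tmul]
  generalize Γ.varpi (l.get i) = t
  induction t with
  | zero => simp
  | add x y hx hy => simp only [map_add, TensorProduct.tmul_add, hx, hy]
  | tmul θ a => rfl

lemma horInv_comp_contractMap :
    C.horInv.rTensor Γ.InvExt ∘ₗ lam.contractMap = (-1 : ℂ) ^ p • lam.T := by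
  rw [T, contractMap, LinearMap.comp_assoc, Γ.contractRight_comp_rTensor, ← LinearMap.comp_assoc,
    ← LinearMap.rTensor_comp, horInv_comp_mulMap, LinearMap.rTensor_smul, LinearMap.smul_comp,
    LinearMap.rTensor_comp, LinearMap.comp_assoc]

lemma S_eq_homotopy : lam.S = lam.T ∘ₗ C.dvh + (-1 : ℂ) ^ p • (C.dvh ∘ₗ lam.T) := by
  let N : Module.End ℂ C.vh := C.horInv.rTensor Γ.InvExt
  let D : Module.End ℂ C.vh := Γ.comodD C.horCoaction
  let K : Module.End ℂ C.vh := lam.contractMap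
  have hND : D * N = N * D := Γ.comodD_comp_rTensor C.intertwines_horInv
  have hNN : N * N = 1 := by
    rw [Module.End.mul_eq_comp, ← LinearMap.rTensor_comp, horInv_comp_horInv, LinearMap.rTensor_id]
    rfl
  have hNK : N * K = (-1 : ℂ) ^ p • (K * N) := lam.horInv_comp_contractMap
  have hleft : (K * N) * (D * N) = K * D := by
    rw [hND, ← mul_assoc, mul_assoc K, hNN, mul_one]
  have hright : (-1 : ℂ) ^ p • ((D * N) * (K * N)) = D * K := by
    rw [← mul_smul_comm, ← hNK, ← mul_assoc, mul_assoc D, hNN, mul_one]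
  calc lam.S = K * D + D * K := by
        rw [S_eq_rTensor]
        exact (Γ.contractRight_homotopy C.isCounital_horCoaction lam.intertwines_mulMap).symm
    _ = (K * N) * (D * N) + (-1 : ℂ) ^ p • ((D * N) * (K * N)) := by rw [hleft, hright]

lemma existsUnique_isT : ∃! T : C.vh →ₗ[ℂ] C.vh, lam.IsT T :=
  ⟨lam.T, lam.isT_T, fun _ hT => hT.unique lam.isT_T⟩

lemma IsT.S_eq_homotopy {lam : C.TensorialForm p} {T : C.vh →ₗ[ℂ] C.vh} (hT : lam.IsT T) :
    lam.S = T ∘ₗ C.dvh + (-1 : ℂ) ^ p • (C.dvh ∘ₗ T) :=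
  hT.unique lam.isT_T ▸ lam.S_eq_homotopy

end TensorialForm

end BundleCalculus

end

end QPB

theorem mainTheorem8_general {A : Type*} [Ring A] [HopfAlgebra ℂ A] [StarRing A] [StarModule ℂ A]
    (hA : Submodule.span ℂ (matrixCoefficients A) = ⊤) (Γ : BicovariantCalculus A) :
    (∀ {V B Ω : Type*} [Ring V] [Algebra ℂ V] [StarRing V]
        [Ring B] [Algebra ℂ B] [StarRing B] [StarModule ℂ B]
        [Ring Ω] [Algebra ℂ Ω] (gr : ℕ → Submodule ℂ Ω) [GradedAlgebra gr]
        (P : QuantumPrincipalBundle V B A) (C : BundleCalculus P Γ gr),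
      (∀ (p : ℕ) (lam : C.TensorialForm p),
        (∃! T : C.vh →ₗ[ℂ] C.vh, lam.IsT T) ∧
        ∀ T : C.vh →ₗ[ℂ] C.vh, lam.IsT T →
          lam.S = T ∘ₗ C.dvh + (-1 : ℂ) ^ p • (C.dvh ∘ₗ T)) ∧
      (∀ (n : ℕ) (u : UnitaryRep A n), u.IsIrreducible →
        ∀ (m : ℕ) (φ : (Fin n → ℂ) →ₗ[ℂ] C.hor),
          (∀ x, C.horCoaction (φ x) = φ.rTensor A (u.coaction x)) →
          (∀ x, (φ x : Ω) ∈ gr m) → φ ≠ 0 →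
          Function.Injective (φ.rTensor Γ.InvExt) ∧
          C.dvh ∘ₗ φ.rTensor Γ.InvExt = (-1 : ℂ) ^ m • (φ.rTensor Γ.InvExt ∘ₗ dLam Γ u))) ∧
    (∀ (n : ℕ) (u : UnitaryRep A n), u.IsIrreducible → (∃ i j, Γ.pi (u.mat i j) ≠ 0) →
      IsAcyclic (dLam Γ u)) :=
  ⟨fun _ _ _ C =>
    ⟨fun _ lam => ⟨lam.existsUnique_isT, fun _ hT => hT.S_eq_homotopy⟩,
      fun _ u hu _ f hf hm hne =>
        have hinj : Function.Injective f := hu.injective hf hne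
        ⟨Module.Flat.rTensor_preserves_injective_linearMap f hinj, C.dvh_comp_rTensor u hf hm⟩⟩,
    fun _ _ hu hpi => hu.isAcyclic Γ hA hpi⟩

theorem mainTheorem8 {A : Type*} [Ring A] [HopfAlgebra ℂ A] [StarRing A] [StarModule ℂ A]
    [CompactMatrixQuantumGroup A] (Γ : BicovariantCalculus A) :
    (∀ {V B Ω : Type*} [Ring V] [Algebra ℂ V] [StarRing V]
        [Ring B] [Algebra ℂ B] [StarRing B] [StarModule ℂ B]
        [Ring Ω] [Algebra ℂ Ω] (gr : ℕ → Submodule ℂ Ω) [GradedAlgebra gr]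
        (P : QuantumPrincipalBundle V B A) (C : BundleCalculus P Γ gr),
      (∀ (p : ℕ) (lam : C.TensorialForm p),
        (∃! T : C.vh →ₗ[ℂ] C.vh, lam.IsT T) ∧
        ∀ T : C.vh →ₗ[ℂ] C.vh, lam.IsT T →
          lam.S = T ∘ₗ C.dvh + (-1 : ℂ) ^ p • (C.dvh ∘ₗ T)) ∧
      (∀ (n : ℕ) (u : UnitaryRep A n), u.IsIrreducible →
        ∀ (m : ℕ) (φ : (Fin n → ℂ) →ₗ[ℂ] C.hor),
          (∀ x, C.horCoaction (φ x) = φ.rTensor A (u.coaction x)) →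
          (∀ x, (φ x : Ω) ∈ gr m) → φ ≠ 0 →
          Function.Injective (φ.rTensor Γ.InvExt) ∧
          C.dvh ∘ₗ φ.rTensor Γ.InvExt = (-1 : ℂ) ^ m • (φ.rTensor Γ.InvExt ∘ₗ dLam Γ u))) ∧
    (∀ (n : ℕ) (u : UnitaryRep A n), u.IsIrreducible → (∃ i j, Γ.pi (u.mat i j) ≠ 0) →
      IsAcyclic (dLam Γ u)) :=
  mainTheorem8_general span_matrixCoefficients_eq_top Γ
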